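/- Let $I=(a,b)$ be a bounded interval, $d\in\mathbb N$, and let $u_D\in H^2(I)^d$ be boundary data with $|u_D'(a)|=|u_D'(b)|=1$. Put $H^2_D(I)=\{v\in H^2(I): v(a)=0,\ v'(a)=v'(b)=0\}$, $H^{-1}(I)=H^1_0(I)'$, and embed $L^2(I)$ into $H^{-1}(I)$ by $\langle\lambda,w\rangle=\int_I\lambda w\,dx$. For $u\in u_D+H^2_D(I)^d$, $\lambda,\mu\in H^{-1}(I)$ and $v,w\in H^2_D(I)^d$ let $$F(u,\lambda)[v,\mu]=\int_I u''\cdot v''\,dx+\langle\lambda,u'\cdot v'\rangle+\tfrac12\langle\mu,|u'|^2-1\rangle,$$ $$a_\lambda(v,w)=\int_I v''\cdot w''\,dx+\langle\lambda,v'\cdot w'\rangle,\qquad \ker B_u=\{v\in H^2_D(I)^d:\ \langle\mu,u'\cdot v'\rangle=0\ \text{for all }\mu\in H^{-1}(I)\}.$$ For a decomposition $\mathcal T_h$: $a=x_0<x_1<\dots<x_M=b$ with $h_i=x_i-x_{i-1}$ and $h=\max_i h_i$, let $\mathcal S^{k,l}(\mathcal T_h)$ be the functions in $C^l([a,b])$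 that are polynomials of degree at most $k$ on each $[x_{i-1},x_i]$, and put $\mathcal S^{3,1}_D=\mathcal S^{3,1}\cap H^2_D(I)$, $\mathcal S^{2,0}_0=\mathcal S^{2,0}\cap H^1_0(I)$. Let $\mathcal I_{h,2}w\in\mathcal S^{2,0}$ be the interpolant of $w$ at all nodes $x_i$ and all midpoints $(x_{i-1}+x_i)/2$, and let $\mathcal I_{h,3}v\in(\mathcal S^{3,1})^d$ be the interpolant of $v$ and $v'$ at all nodes $x_i$. For $u_h\in\mathcal I_{h,3}u_D+(\mathcal S^{3,1}_D)^d$ and $\lambda_h\in\mathcal S^{2,0}_0$ let $$F_h(u_h,\lambda_h)[v_h,\mu_h]=\int_I u_h''\cdot v_h''+\mathcal I_{h,2}(\lambda_h\,u_h'\cdot v_h')+\tfrac12\,\mathcal I_{h,2}\big(\mu_h(|u_h'|^2-1)\big)\,dx .$$ **Theorem.** Let $u\in H^4(I)^d\cap(u_D+H^2_D(I)^d)$ and $\lambda\in H^2(I)$ satisfy $F(u,\lambda)[v,\mu]=0$ for all $v\in H^2_D(I)^d$ and $\mu\in H^{-1}(I)$, and assume that $a_\lambda$ is coercive on $\ker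 B_u$, i.e. there is $\alpha>0$ with $a_\lambda(v,v)\ge\alpha\|v\|_{H^2(I)^d}^2$ for all $v\in\ker B_u$. Then for every $\sigma>0$ there are $h_0>0$ and $c>0$ such that for every decomposition $\mathcal T_h$ with $h\le\sigma h_i$ for all $i$ and $h\le h_0$ there exist $u_h\in\mathcal I_{h,3}u_D+(\mathcal S^{3,1}_D)^d$ and $\lambda_h\in\mathcal S^{2,0}_0$ with $F_h(u_h,\lambda_h)[v_h,\mu_h]=0$ for all $v_h\in(\mathcal S^{3,1}_D)^d$ and $\mu_h\in\mathcal S^{2,0}_0$, and $$\|u-u_h\|_{H^2(I)^d}\le c\,h^2 .$$ -/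

import Mathlib

open MeasureTheory Set
open scoped ContDiff RealInnerProductSpace

noncomputable section

namespace InextensibleCurve

/-! ### Sobolev spaces on the interval `I = (a, b)` -/

section Sobolev

variable {E : Type*} [NormedAddCommGroup E] [InnerProductSpace ℝ E]

/-- `f ∈ L²(a, b; E)`. -/
def MemL2 (a b : ℝ) (f : ℝ → E) : Prop :=
  MemLp f 2 (volume.restrict (Ioo a b))

/-- `f, g ∈ L²(a, b; E)` and `g` is a weak derivative of `f`:
`∫ φ' f = - ∫ φ g` for every test function `φ ∈ C_c^∞(a, b)`. -/
def HasWeakDeriv (a b : ℝ) (f g : ℝ → E) : Prop :=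
  MemL2 a b f ∧ MemL2 a b g ∧
    ∀ φ : ℝ → ℝ, ContDiff ℝ ∞ φ → HasCompactSupport φ → tsupport φ ⊆ Ioo a b →
      ∫ x in a..b, deriv φ x • f x = -∫ x in a..b, φ x • g x

/-- The (class of the) function `f` belongs to `H^m(a, b; E)`. -/
def MemH (a b : ℝ) : ℕ → (ℝ → E) → Prop
  | 0, f => MemL2 a b f
  | m + 1, f => ∃ g, HasWeakDeriv a b f g ∧ MemH a b m g

/-- `H^m(a, b; E)` for `m ≥ 1`, every class being represented by its continuous representative on
`[a, b]` (values outside of `[a, b]` never matter). -/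
def H (a b : ℝ) (m : ℕ) : Set (ℝ → E) :=
  {f | MemH a b m f ∧ ContinuousOn f (Icc a b)}

open Classical in
/-- The weak derivative of `f`. It is the representative that is continuous on `[a, b]` whenever
there is one (in particular for `f ∈ H^2`), so that it then has well-defined values at all points
of `[a, b]`; otherwise it is any representative of the class in `L²`. -/
def D (a b : ℝ) (f : ℝ → E) : ℝ → E :=
  if h : ∃ g, HasWeakDeriv a b f g ∧ ContinuousOn g (Icc a b) then h.choose
  else if h : ∃ g, HasWeakDeriv a b f g then h.choose
  else 0

/-- The norm of `H^m(a, b; E)`, `‖f‖² = ∑_{j ≤ m} ∫ |f^{(j)}|²`. -/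
def normH (a b : ℝ) (m : ℕ) (f : ℝ → E) : ℝ :=
  √(∑ j ∈ Finset.range (m + 1), ∫ x in a..b, ‖((D a b)^[j] f) x‖ ^ 2)

/-- `H^2_D(I)`: functions `v ∈ H^2(I)` with `v(a) = 0` and `v' = 0` on `∂I`. -/
def H2D (a b : ℝ) : Set (ℝ → E) :=
  {v | v ∈ H a b 2 ∧ v a = 0 ∧ D a b v a = 0 ∧ D a b v b = 0}

theorem HasWeakDeriv.add {a b : ℝ} (hab : a ≤ b) {f g f' g' : ℝ → E}
    (hf : HasWeakDeriv a b f f') (hg : HasWeakDeriv a b g g') :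
    HasWeakDeriv a b (f + g) (f' + g') := by
  refine ⟨hf.1.add hg.1, hf.2.1.add hg.2.1, fun φ h1 h2 h3 => ?_⟩
  have key : ∀ (ψ : ℝ → ℝ) (k : ℝ → E), Continuous ψ → MemL2 a b k →
      IntervalIntegrable (fun x => ψ x • k x) volume a b := by
    intro ψ k hψ hk
    have hk' : IntervalIntegrable k volume a b := by
      rw [intervalIntegrable_iff_integrableOn_Ioo_of_le hab]
      exact hk.integrable (by norm_num)
    exact hk'.continuousOn_smul hψ.continuousOn
  have hd : Continuous (deriv φ) := h1.continuous_deriv (by simp)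
  have hc : Continuous φ := h1.continuous
  simp only [Pi.add_apply, smul_add]
  rw [intervalIntegral.integral_add (key _ _ hd hf.1) (key _ _ hd hg.1),
    intervalIntegral.integral_add (key _ _ hc hf.2.1) (key _ _ hc hg.2.1),
    hf.2.2 φ h1 h2 h3, hg.2.2 φ h1 h2 h3]
  abel

theorem HasWeakDeriv.smul {a b : ℝ} (c : ℝ) {f f' : ℝ → E} (hf : HasWeakDeriv a b f f') :
    HasWeakDeriv a b (c • f) (c • f') := by
  refine ⟨hf.1.const_smul c, hf.2.1.const_smul c, fun φ h1 h2 h3 => ?_⟩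
  simp only [Pi.smul_apply, smul_comm _ c, intervalIntegral.integral_smul, hf.2.2 φ h1 h2 h3,
    smul_neg]

end Sobolev

/-! ### The space `H^1_0(I)` and its dual `H^{-1}(I)` -/

/-- `H^1_0(I)`, for `a < b`. -/
def H10 (a b : ℝ) (hab : a < b) : Submodule ℝ (ℝ → ℝ) where
  carrier := {w | w ∈ H a b 1 ∧ w a = 0 ∧ w b = 0}
  add_mem' := by
    rintro f g ⟨⟨⟨f', hf, hf2⟩, hfc⟩, hfa, hfb⟩ ⟨⟨⟨g', hg, hg2⟩, hgc⟩, hga, hgb⟩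
    refine ⟨⟨⟨f' + g', hf.add hab.le hg, ?_⟩, hfc.add hgc⟩, by simp [hfa, hga], by simp [hfb, hgb]⟩
    exact MemLp.add hf2 hg2
  zero_mem' := by
    refine ⟨⟨⟨0, ⟨MemLp.zero', MemLp.zero', fun φ _ _ _ => by simp⟩, MemLp.zero'⟩,
      continuousOn_const⟩, rfl, rfl⟩
  smul_mem' := by
    rintro c f ⟨⟨⟨f', hf, hf2⟩, hfc⟩, hfa, hfb⟩
    refine ⟨⟨⟨c • f', hf.smul c, ?_⟩, hfc.const_smul c⟩, by simp [hfa], by simp [hfb]⟩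
    exact MemLp.const_smul hf2 c

/-- `H^{-1}(I)`: the linear functionals on `H^1_0(I)` that are bounded for the `H^1`-norm. -/
def HMinusOne (a b : ℝ) (hab : a < b) : Type :=
  {μ : H10 a b hab →ₗ[ℝ] ℝ // ∃ C : ℝ, ∀ w : H10 a b hab, |μ w| ≤ C * normH a b 1 (w : ℝ → ℝ)}

open Classical in
/-- The duality pairing `⟨μ, w⟩` for `μ ∈ H^{-1}(I)` and a function `w ∈ H^1_0(I)`. -/
def pair {a b : ℝ} {hab : a < b} (μ : HMinusOne a b hab) (w : ℝ → ℝ) : ℝ :=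
  if hw : w ∈ H10 a b hab then μ.1 ⟨w, hw⟩ else 0

theorem MemL2.integrable_mul {a b : ℝ} {f g : ℝ → ℝ} (hab : a ≤ b)
    (hf : MemL2 a b f) (hg : MemL2 a b g) :
    IntervalIntegrable (fun x => f x * g x) volume a b := by
  rw [intervalIntegrable_iff_integrableOn_Ioo_of_le hab]
  exact MemLp.integrable_mul hf hg

/-- The embedding `L²(I) → H^{-1}(I)`, `⟨f, w⟩ = ∫ f w`. -/
def ofL2 {a b : ℝ} (hab : a < b) (f : ℝ → ℝ) (hf : MemL2 a b f) : HMinusOne a b hab :=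
  ⟨{ toFun := fun w => ∫ x in a..b, f x * (w : ℝ → ℝ) x
     map_add' := by
      rintro ⟨w, ⟨⟨w', hw, _⟩, _⟩, _⟩ ⟨z, ⟨⟨z', hz, _⟩, _⟩, _⟩
      simp only [Submodule.coe_add, Pi.add_apply, mul_add]
      exact intervalIntegral.integral_add (hf.integrable_mul hab.le hw.1)
        (hf.integrable_mul hab.le hz.1)
     map_smul' := by
      intro c w
      simp only [Submodule.coe_smul, Pi.smul_apply, smul_eq_mul, RingHom.id_apply]
      rw [← intervalIntegral.integral_const_mul]
      congr 1; ext x; ring },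
   by
    refine ⟨√(∫ x in a..b, ‖f x‖ ^ 2), ?_⟩
    rintro ⟨w, ⟨⟨w', hw, _⟩, _⟩, _⟩
    have hw2 := hw.1
    show |∫ x in a..b, f x * w x| ≤ _ * normH a b 1 w
    have h1 : √(∫ x in a..b, ‖w x‖ ^ 2) ≤ normH a b 1 w := by
      apply Real.sqrt_le_sqrt
      rw [Finset.sum_range_succ, Finset.sum_range_one]
      exact le_add_of_nonneg_right
        (intervalIntegral.integral_nonneg hab.le fun x _ => by positivity)
    refine le_trans ?_ (mul_le_mul_of_nonneg_left h1 (Real.sqrt_nonneg _))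
    have h2 : |∫ x in a..b, f x * w x| ≤ ∫ x in a..b, ‖f x‖ * ‖w x‖ := by
      refine (intervalIntegral.abs_integral_le_integral_abs hab.le).trans (le_of_eq ?_)
      simp [abs_mul]
    refine h2.trans ?_
    simp only [intervalIntegral.integral_of_le hab.le, integral_Ioc_eq_integral_Ioo]
    have h3 := integral_mul_norm_le_Lp_mul_Lq (μ := volume.restrict (Ioo a b)) (f := f) (g := w)
      Real.HolderConjugate.two_two
      (by simpa [MemL2] using hf) (by simpa [MemL2] using hw2)
    simpa [Real.sqrt_eq_rpow] using h3⟩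

/-! ### The continuous saddle-point problem -/

/-- `ℝ^d`. -/
abbrev Vec (d : ℕ) := EuclideanSpace ℝ (Fin d)

section Continuous

variable {d : ℕ} {a b : ℝ} {hab : a < b}

/-- `F(u, λ)[v, μ] = ∫ u'' · v'' + ⟨λ, u' · v'⟩ + ½ ⟨μ, |u'|² - 1⟩`. -/
def F (u : ℝ → Vec d) (lam : HMinusOne a b hab) (v : ℝ → Vec d) (μ : HMinusOne a b hab) : ℝ :=
  (∫ x in a..b, ⟪D a b (D a b u) x, D a b (D a b v) x⟫)
    + pair lam (fun x => ⟪D a b u x, D a b v x⟫)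
    + (1 / 2) * pair μ (fun x => ‖D a b u x‖ ^ 2 - 1)

/-- `a_λ(v, w) = (v'', w'') + ⟨λ, v' · w'⟩`. -/
def aForm (lam : HMinusOne a b hab) (v w : ℝ → Vec d) : ℝ :=
  (∫ x in a..b, ⟪D a b (D a b v) x, D a b (D a b w) x⟫)
    + pair lam (fun x => ⟪D a b v x, D a b w x⟫)

/-- `b_u(v, μ) = ⟨μ, u' · v'⟩`. -/
def bForm (u v : ℝ → Vec d) (μ : HMinusOne a b hab) : ℝ :=
  pair μ (fun x => ⟪D a b u x, D a b v x⟫)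

/-- The kernel of `B_u : H^2_D(I)^d → H^{-1}(I)'`, `B_u(v)[μ] = b_u(v, μ)`. -/
def kerB (hab : a < b) (u : ℝ → Vec d) : Set (ℝ → Vec d) :=
  {v | v ∈ H2D a b ∧ ∀ μ : HMinusOne a b hab, bForm u v μ = 0}

/-- `a_λ` is coercive on `ker B_u` with respect to the norm of `H^2(I)^d`. -/
def CoerciveOnKer (u : ℝ → Vec d) (lam : HMinusOne a b hab) : Prop :=
  ∃ α : ℝ, 0 < α ∧ ∀ v ∈ kerB hab u, α * normH a b 2 v ^ 2 ≤ aForm lam v v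

end Continuous

/-! ### Finite element spaces and interpolation -/

/-- A decomposition `a = x_0 < x_1 < ⋯ < x_M = b`. -/
structure Mesh (a b : ℝ) where
  M : ℕ
  x : Fin (M + 1) → ℝ
  strictMono : StrictMono x
  left : x 0 = a
  right : x (Fin.last M) = b

namespace Mesh

variable {a b : ℝ} (T : Mesh a b) {E : Type*} [NormedAddCommGroup E] [InnerProductSpace ℝ E]

/-- The length `h_i` of the `i`-th element. -/
def len (i : Fin T.M) : ℝ := T.x i.succ - T.x i.castSucc

/-- The mesh size `h = max_i h_i`. -/
def h : ℝ := ⨆ i, T.len i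

/-- Quasi-uniformity: `h ≤ σ h_i` for all `i`. -/
def QuasiUniform (σ : ℝ) : Prop := ∀ i, T.h ≤ σ * T.len i

/-- The midpoint of the `i`-th element. -/
def mid (i : Fin T.M) : ℝ := (T.x i.castSucc + T.x i.succ) / 2

/-- The nodes of the linear elements. -/
def nodes1 : Set ℝ := range T.x

/-- The nodes and midpoints. -/
def nodes2 : Set ℝ := range T.x ∪ range T.mid

/-- `S^{k,l}`: functions of class `C^l` on `[a, b]` that are polynomials of degree at most `k` on
every element. -/
def S (k l : ℕ) : Set (ℝ → E) :=
  {v | ContDiffOn ℝ l v (Icc a b) ∧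
    ∀ i : Fin T.M, ∃ c : Fin (k + 1) → E,
      ∀ x ∈ Icc (T.x i.castSucc) (T.x i.succ), v x = ∑ j : Fin (k + 1), x ^ (j : ℕ) • c j}

/-- `S^{3,1}_D = S^{3,1} ∩ H^2_D`. -/
def S31D : Set (ℝ → E) := T.S 3 1 ∩ H2D a b

/-- `S^{2,0}_0 = S^{2,0} ∩ H^1_0`. -/
def S200 (hab : a < b) : Set (ℝ → ℝ) := T.S 2 0 ∩ (H10 a b hab : Set (ℝ → ℝ))

open Classical in
/-- The nodal interpolant `I_{h,2} w ∈ S^{2,0}`: it has the values of `w` at all nodes and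
midpoints. -/
def I2 (w : ℝ → ℝ) : ℝ → ℝ :=
  if h : ∃ p ∈ T.S 2 0, ∀ z ∈ T.nodes2, p z = w z then h.choose else 0

open Classical in
/-- The cubic `C^1` interpolant `I_{h,3} v ∈ S^{3,1}`: it has the values and the derivatives of
`v` at all nodes. -/
def I3 (v : ℝ → E) : ℝ → E :=
  if h : ∃ p ∈ T.S 3 1, ∀ z ∈ T.nodes1, p z = v z ∧ D a b p z = D a b v z then h.choose else 0

/-- `F_h(u_h, λ_h)[v_h, μ_h]
= ∫ u_h'' · v_h'' + I_{h,2}(λ_h u_h' · v_h') + ½ I_{h,2}(μ_h (|u_h'|² - 1))`. -/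
def Fh {d : ℕ} (u : ℝ → Vec d) (lam : ℝ → ℝ) (v : ℝ → Vec d) (μ : ℝ → ℝ) : ℝ :=
  (∫ x in a..b, ⟪D a b (D a b u) x, D a b (D a b v) x⟫)
    + (∫ x in a..b, T.I2 (fun y => lam y * ⟪D a b u y, D a b v y⟫) x)
    + (1 / 2) * ∫ x in a..b, T.I2 (fun y => μ y * (‖D a b u y‖ ^ 2 - 1)) x

end Mesh

theorem MemH.memL2 {E : Type*} [NormedAddCommGroup E] [InnerProductSpace ℝ E] {a b : ℝ} {m : ℕ}
    {f : ℝ → E} (hf : MemH a b m f) : MemL2 a b f := by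
  cases m with
  | zero => exact hf
  | succ m => obtain ⟨g, hg, _⟩ := hf; exact hg.1

end InextensibleCurve

end

open InextensibleCurve

noncomputable section

namespace InextensibleCurve

set_option linter.unusedSectionVars false

/-! ### Weak derivatives on an interval and their continuous representatives. -/

section WeakDerivatives

variable {E : Type*} [NormedAddCommGroup E] [InnerProductSpace ℝ E] {a b : ℝ}

/-! Test functions are free at `b`, so the derivative of an admissible `v` is an arbitrary field
vanishing at both ends, and the problem is really one for the tangent `q = u'`. Stationarity says
`|q| = 1` and `q'' = λ q`; differentiating the constraint twice gives `λ = -|q'|²`, and this is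
constant. Hence `q` is a great circle `Q` of speed `κ` and `λ = -κ²`
(`exists_isGreatCircle_of_stationary`). Coercivity of `a_λ` on `ker B_u` then bounds from below the
second variation of the Dirichlet energy at `Q` on tangential fields.

On the discrete side the derivative of a `C¹` cubic spline is a continuous piecewise quadratic,
given by its values `P` at nodes and midpoints, and integrating `I_{h,2}` is Simpson's rule, whose
weights are positive. The constraint becomes `|P z| = 1` node by node, and the multiplier can be
solved for node by node (`exists_multiplier`). So a critical point of the Dirichlet energy on a
product of spheres, with fixed end values, yields a discrete stationary pair. It is found by
minimising over an energy ball around the nodal values of `Q`: compactness gives a minimiser, and an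
a priori bound keeps it off the boundary of the ball (`exists_constrained_critical`).

That bound is `exists_apriori_bound`. Let `R = P - Q` be the nodal error and `E` the Dirichlet form.
If `P` has no more energy than the interpolant of `Q`, then `E(R,R) + 2 E(Q,R) ≤ 0`. The equation
`Q'' = -κ² Q` replaces `E(Q,R)` by `κ² ∫ R·Q` up to `O(h²)√E(R,R)`. At the nodes `R·Q = -|R|²/2`,
since both vectors are unit, and Simpson's rule, exact for cubics, transfers this to the integral.
Thus `E(R,R) - κ² ∫ |R|²` is small. By `exists_garding` it controls `E(R,R)` up to the normal
component `R·Q`, which is of higher order. Absorption gives `√E(R,R) = O(h²)`; with the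
interpolation error of `Q` and integration this is the `H²` estimate. -/

theorem MemL2.intervalIntegrable (hab : a ≤ b) {f : ℝ → E} (hf : MemL2 a b f) :
    IntervalIntegrable f volume a b := by
  rw [intervalIntegrable_iff_integrableOn_Ioo_of_le hab]
  exact hf.integrable (by norm_num)

theorem ae_uIoc_of_ae_Ioo (hab : a ≤ b) {P : ℝ → Prop}
    (h : ∀ᵐ x ∂volume.restrict (Ioo a b), P x) : ∀ᵐ x, x ∈ uIoc a b → P x := by
  rw [uIoc_of_le hab, ← ae_restrict_iff' measurableSet_Ioc, ← Measure.restrict_congr_set Ioo_ae_eq_Ioc]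
  exact h

theorem integral_congr_ae_Ioo (hab : a ≤ b) {f g : ℝ → E}
    (h : f =ᵐ[volume.restrict (Ioo a b)] g) : ∫ x in a..b, f x = ∫ x in a..b, g x :=
  intervalIntegral.integral_congr_ae (ae_uIoc_of_ae_Ioo hab h)

theorem ae_Ioo_of_eqOn {f g : ℝ → E} (h : EqOn f g (Icc a b)) :
    f =ᵐ[volume.restrict (Ioo a b)] g :=
  (ae_restrict_iff' measurableSet_Ioo).2 (Filter.Eventually.of_forall fun _ hx =>
    h (Ioo_subset_Icc_self hx))

theorem memL2_of_continuousOn {f : ℝ → E} (hf : ContinuousOn f (Icc a b)) : MemL2 a b f := by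
  obtain ⟨C, hC⟩ := isCompact_Icc.exists_bound_of_continuousOn hf
  refine MemLp.of_bound ((hf.mono Ioo_subset_Icc_self).aestronglyMeasurable measurableSet_Ioo) C ?_
  exact (ae_restrict_iff' measurableSet_Ioo).2 (Filter.Eventually.of_forall fun x hx =>
    hC x (Ioo_subset_Icc_self hx))

theorem HasWeakDeriv.congr (hab : a ≤ b) {f g f' g' : ℝ → E} (h : HasWeakDeriv a b f g)
    (hf : f =ᵐ[volume.restrict (Ioo a b)] f') (hg : g =ᵐ[volume.restrict (Ioo a b)] g') :
    HasWeakDeriv a b f' g' := by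
  refine ⟨(memLp_congr_ae hf).1 h.1, (memLp_congr_ae hg).1 h.2.1, fun φ h1 h2 h3 => ?_⟩
  have e1 : ∫ x in a..b, deriv φ x • f x = ∫ x in a..b, deriv φ x • f' x :=
    integral_congr_ae_Ioo hab (hf.mono fun x hx => by simp only [hx])
  have e2 : ∫ x in a..b, φ x • g x = ∫ x in a..b, φ x • g' x :=
    integral_congr_ae_Ioo hab (hg.mono fun x hx => by simp only [hx])
  rw [← e1, ← e2]
  exact h.2.2 φ h1 h2 h3

theorem HasWeakDeriv.sub (hab : a ≤ b) {f g f' g' : ℝ → E}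
    (hf : HasWeakDeriv a b f f') (hg : HasWeakDeriv a b g g') :
    HasWeakDeriv a b (f - g) (f' - g') := by
  have := hf.add hab (hg.smul (-1))
  simpa [sub_eq_add_neg] using this

variable [CompleteSpace E]

theorem ae_eq_zero_of_forall_integral_smul_eq_zero (hab : a ≤ b) {f : ℝ → E} (hf : MemL2 a b f)
    (h : ∀ φ : ℝ → ℝ, ContDiff ℝ ∞ φ → HasCompactSupport φ → tsupport φ ⊆ Ioo a b →
      ∫ x in a..b, φ x • f x = 0) : f =ᵐ[volume.restrict (Ioo a b)] 0 := by
  have hi : IntegrableOn f (Ioo a b) :=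
    (intervalIntegrable_iff_integrableOn_Ioo_of_le hab).1 (hf.intervalIntegrable hab)
  refine (ae_restrict_iff' measurableSet_Ioo).2
    (isOpen_Ioo.ae_eq_zero_of_integral_contDiff_smul_eq_zero hi.locallyIntegrableOn
      fun φ h1 h2 h3 => ?_)
  rw [← h φ h1 h2 h3, intervalIntegral.integral_of_le hab, integral_Ioc_eq_integral_Ioo,
    setIntegral_eq_integral_of_forall_compl_eq_zero]
  intro x hx
  rw [image_eq_zero_of_notMem_tsupport fun hx' => hx (h3 hx'), zero_smul]

theorem HasWeakDeriv.ae_unique (hab : a ≤ b) {f g g' : ℝ → E} (h : HasWeakDeriv a b f g)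
    (h' : HasWeakDeriv a b f g') : g =ᵐ[volume.restrict (Ioo a b)] g' := by
  have h0 := h.sub hab h'
  have := ae_eq_zero_of_forall_integral_smul_eq_zero hab h0.2.1 fun φ h1 h2 h3 => by
    have := h0.2.2 φ h1 h2 h3
    simpa using this
  filter_upwards [this] with x hx
  simpa [sub_eq_zero] using hx

/-- A test function with vanishing mean has a primitive that is a test function. -/
theorem exists_testFunction_deriv_eq (hab : a < b) {θ : ℝ → ℝ} (h1 : ContDiff ℝ ∞ θ)
    (h2 : HasCompactSupport θ) (h3 : tsupport θ ⊆ Ioo a b) (h0 : ∫ x in a..b, θ x = 0) :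
    ∃ φ : ℝ → ℝ, ContDiff ℝ ∞ φ ∧ HasCompactSupport φ ∧ tsupport φ ⊆ Ioo a b ∧ deriv φ = θ := by
  obtain ⟨c, d, hac, hcd, hdb, hK⟩ : ∃ c d, a < c ∧ c ≤ d ∧ d < b ∧ tsupport θ ⊆ Icc c d := by
    rcases (tsupport θ).eq_empty_or_nonempty with he | hne
    · exact ⟨(a + b) / 2, (a + b) / 2, by linarith, le_rfl, by linarith, by simp [he]⟩
    · obtain ⟨c, hc⟩ := h2.isCompact.exists_isLeast hne
      obtain ⟨d, hd⟩ := h2.isCompact.exists_isGreatest hne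
      exact ⟨c, d, (h3 hc.1).1, hc.2 hd.1, (h3 hd.1).2, fun x hx => ⟨hc.2 hx, hd.2 hx⟩⟩
  have hz : ∀ x, x ∉ Icc c d → θ x = 0 := fun x hx =>
    image_eq_zero_of_notMem_tsupport fun hx' => hx (hK hx')
  have hc := h1.continuous
  have hder : deriv (fun x => ∫ t in a..x, θ t) = θ := by
    funext x; exact hc.deriv_integral _ _ _
  have hsupp : tsupport (fun x => ∫ t in a..x, θ t) ⊆ Icc c d := by
    refine closure_minimal (fun x hx => ?_) isClosed_Icc
    by_contra hx'
    apply hx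
    rcases lt_or_ge x c with hxc | hxc
    · refine intervalIntegral.integral_zero_ae (Filter.Eventually.of_forall fun t ht => hz t ?_)
      intro ht'
      have : t ≤ max a x := by rcases le_total a x with h | h <;> simp_all [uIoc]
      have := ht'.1
      grind
    -- To the right of the support the primitive equals the full integral of `θ`, which is where the
    -- vanishing mean enters.
    · have hxd : d < x := by by_contra h; exact hx' ⟨hxc, not_lt.1 h⟩
      have e1 := intervalIntegral.integral_add_adjacent_intervals (μ := volume)
        (hc.intervalIntegrable a b) (hc.intervalIntegrable b x)
      have e2 : ∫ t in b..x, θ t = 0 := by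
        refine intervalIntegral.integral_zero_ae (Filter.Eventually.of_forall fun t ht => hz t ?_)
        intro ht'
        have := ht'.2
        rcases ht with ⟨ht, _⟩
        grind
      show ∫ t in a..x, θ t = 0
      rw [← e1, h0, e2, add_zero]
  refine ⟨fun x => ∫ t in a..x, θ t, ?_, ?_, ?_, hder⟩
  · rw [contDiff_infty_iff_deriv, hder]
    exact ⟨fun x => (hc.integral_hasStrictDerivAt a x).hasDerivAt.differentiableAt, h1⟩
  · exact isCompact_Icc.of_isClosed_subset (isClosed_tsupport _) hsupp
  · exact hsupp.trans fun x hx => ⟨hac.trans_le hx.1, hx.2.trans_lt hdb⟩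

/-- The lemma of du Bois-Reymond. -/
theorem HasWeakDeriv.ae_const (hab : a < b) {f : ℝ → E} (h : HasWeakDeriv a b f 0) :
    ∃ c, f =ᵐ[volume.restrict (Ioo a b)] fun _ => c := by
  let B : ContDiffBump ((a + b) / 2) := ⟨(b - a) / 8, (b - a) / 4, by linarith, by linarith⟩
  set ψ : ℝ → ℝ := B.normed volume with hψ
  have p1 : ContDiff ℝ ∞ ψ := B.contDiff_normed
  have p2 : HasCompactSupport ψ := B.hasCompactSupport_normed
  have p3 : tsupport ψ ⊆ Ioo a b := by
    rw [hψ, B.tsupport_normed_eq]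
    intro x hx
    rw [Metric.mem_closedBall, Real.dist_eq, abs_le] at hx
    have e : B.rOut = (b - a) / 4 := rfl
    rw [e] at hx
    constructor <;> linarith [hx.1, hx.2]
  have p4 : ∫ x in a..b, ψ x = 1 := by
    rw [intervalIntegral.integral_of_le hab.le, integral_Ioc_eq_integral_Ioo,
      setIntegral_eq_integral_of_forall_compl_eq_zero, B.integral_normed]
    exact fun x hx => image_eq_zero_of_notMem_tsupport fun hx' => hx (p3 hx')
  have hfi := h.1.intervalIntegrable hab.le
  have hint : ∀ χ : ℝ → ℝ, Continuous χ → IntervalIntegrable (fun x => χ x • f x) volume a b :=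
    fun χ hχ => hfi.continuousOn_smul hχ.continuousOn
  refine ⟨∫ x in a..b, ψ x • f x, ?_⟩
  set c := ∫ x in a..b, ψ x • f x
  have key := ae_eq_zero_of_forall_integral_smul_eq_zero hab.le (f := fun x => f x - c)
    (h.1.sub (memL2_of_continuousOn continuousOn_const)) fun η h1 h2 h3 => by
    -- Subtracting `m ψ` from `η` leaves a test function of mean zero, hence a derivative `φ'`.
    -- Testing with `φ` gives `∫ η f = m ∫ ψ f = ∫ η c`.
    set m := ∫ x in a..b, η x
    obtain ⟨φ, k1, k2, k3, k4⟩ := exists_testFunction_deriv_eq hab (θ := fun x => η x - m * ψ x)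
      (h1.sub (contDiff_const.mul p1)) (h2.sub (p2.mul_left (f := fun _ => m)))
      ((tsupport_sub _ _).trans (union_subset h3 ((tsupport_mul_subset_right).trans p3))) (by
        have i : IntervalIntegrable (fun x => m * ψ x) volume a b :=
          (continuous_const.mul p1.continuous).intervalIntegrable _ _
        rw [intervalIntegral.integral_sub (h1.continuous.intervalIntegrable _ _) i,
          intervalIntegral.integral_const_mul, p4]
        simp [m])
    have := h.2.2 φ k1 k2 k3
    rw [k4] at this
    simp only [sub_smul, mul_smul, Pi.zero_apply, smul_zero, intervalIntegral.integral_zero,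
      neg_zero] at this
    have i : IntervalIntegrable (fun x => m • ψ x • f x) volume a b :=
      (hint _ p1.continuous).smul m
    rw [intervalIntegral.integral_sub (hint _ h1.continuous) i,
      intervalIntegral.integral_smul] at this
    simp only [smul_sub]
    have i' : IntervalIntegrable (fun x => η x • c) volume a b :=
      (h1.continuous.smul continuous_const).intervalIntegrable _ _
    rw [intervalIntegral.integral_sub (hint _ h1.continuous) i',
      intervalIntegral.integral_smul_const]
    exact this
  filter_upwards [key] with x hx
  simpa [sub_eq_zero] using hx

theorem continuousOn_integral (hab : a ≤ b) {g : ℝ → E} (hg : MemL2 a b g) :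
    ContinuousOn (fun x => ∫ y in a..x, g y) (Icc a b) := by
  have h := intervalIntegral.continuousOn_primitive_interval'
    (hg.intervalIntegrable hab) (left_mem_uIcc (a := a) (b := b))
  rwa [uIcc_of_le hab] at h

theorem hasWeakDeriv_integral (hab : a ≤ b) {g : ℝ → E} (hg : MemL2 a b g) :
    HasWeakDeriv a b (fun x => ∫ y in a..x, g y) g := by
  have hgi := hg.intervalIntegrable hab
  have hGc := continuousOn_integral hab hg
  refine ⟨memL2_of_continuousOn hGc, hg, fun φ h1 h2 h3 => ?_⟩
  have ha : φ a = 0 := image_eq_zero_of_notMem_tsupport fun h => lt_irrefl _ (h3 h).1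
  have hb : φ b = 0 := image_eq_zero_of_notMem_tsupport fun h => lt_irrefl _ (h3 h).2
  have hd : Continuous (deriv φ) := h1.continuous_deriv (by simp)
  have i1 : IntervalIntegrable (fun x => deriv φ x • ∫ y in a..x, g y) volume a b :=
    (hd.continuousOn.smul (by rwa [uIcc_of_le hab])).intervalIntegrable
  have i2 : IntervalIntegrable (fun x => φ x • g x) volume a b :=
    hgi.continuousOn_smul h1.continuous.continuousOn
  -- Pairing with a fixed vector reduces the claim to integration by parts for scalar absolutely
  -- continuous functions.
  refine ext_inner_left ℝ fun e => ?_
  let L := innerSL ℝ e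
  have hL : ∀ v, inner ℝ e v = L v := fun v => rfl
  rw [hL, hL, map_neg, ← L.intervalIntegral_comp_comm i1, ← L.intervalIntegral_comp_comm i2]
  have hLg : IntervalIntegrable (fun x => L (g x)) volume a b := by
    rw [intervalIntegrable_iff] at hgi ⊢
    exact L.integrable_comp hgi
  have hac := hLg.absolutelyContinuousOnInterval_intervalIntegral (c := a) left_mem_uIcc
  have hφ : AbsolutelyContinuousOnInterval φ a b :=
    (h1.of_le (by simp)).contDiffOn.absolutelyContinuousOnInterval
  have := hac.integral_mul_deriv_eq_deriv_mul hφ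
  simp only [ha, hb, mul_zero, sub_zero, zero_sub, intervalIntegral.integral_same] at this
  have e1 : ∫ x in a..b, L (deriv φ x • ∫ y in a..x, g y)
      = ∫ x in a..b, (∫ y in a..x, L (g y)) * deriv φ x := by
    refine intervalIntegral.integral_congr fun x hx => ?_
    have : IntervalIntegrable g volume a x := hgi.mono_set (uIcc_subset_uIcc_left hx)
    simp only [map_smul, smul_eq_mul, L.intervalIntegral_comp_comm this, mul_comm]
  have e2 : ∫ x in a..b, L (φ x • g x)
      = ∫ x in a..b, deriv (fun x => ∫ y in a..x, L (g y)) x * φ x := by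
    refine intervalIntegral.integral_congr_ae ?_
    filter_upwards [hLg.ae_hasDerivAt_integral] with x hx hx'
    rw [(hx (uIoc_subset_uIcc hx') a left_mem_uIcc).deriv]
    simp [mul_comm]
  rw [e1, e2, this]

theorem HasWeakDeriv.exists_ae_eq_integral (hab : a < b) {f g : ℝ → E} (h : HasWeakDeriv a b f g) :
    ∃ c, f =ᵐ[volume.restrict (Ioo a b)] fun x => c + ∫ y in a..x, g y := by
  have h' := h.sub hab.le (hasWeakDeriv_integral hab.le h.2.1)
  rw [sub_self] at h'
  obtain ⟨c, hc⟩ := h'.ae_const hab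
  refine ⟨c, hc.mono fun x hx => ?_⟩
  simp only [Pi.sub_apply] at hx
  simp only [← hx, sub_add_cancel]

theorem eqOn_Icc_of_ae_eq (hab : a < b) {f g : ℝ → E} (hf : ContinuousOn f (Icc a b))
    (hg : ContinuousOn g (Icc a b)) (h : f =ᵐ[volume.restrict (Ioo a b)] g) :
    EqOn f g (Icc a b) := by
  have h' := Measure.eqOn_Ioo_of_ae_eq (μ := volume) (a := a) (b := b) h
    (hf.mono Ioo_subset_Icc_self) (hg.mono Ioo_subset_Icc_self)
  have hcl : closure (Ioo a b) = Icc a b := closure_Ioo hab.ne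
  exact h'.of_subset_closure hf hg Ioo_subset_Icc_self hcl.ge

theorem HasWeakDeriv.eq_integral (hab : a < b) {f g : ℝ → E} (h : HasWeakDeriv a b f g)
    (hf : ContinuousOn f (Icc a b)) :
    ∀ x ∈ Icc a b, f x = f a + ∫ y in a..x, g y := by
  obtain ⟨c, hc⟩ := h.exists_ae_eq_integral hab
  have := eqOn_Icc_of_ae_eq hab hf
    (continuousOn_const.add (continuousOn_integral hab.le h.2.1)) hc
  have ha : f a = c := by simpa using this (left_mem_Icc.2 hab.le)
  intro x hx
  rw [this hx, ha]
  rfl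

theorem hasWeakDeriv_of_eq_integral (hab : a < b) {f g : ℝ → E} (hg : MemL2 a b g)
    (h : ∀ x ∈ Icc a b, f x = f a + ∫ y in a..x, g y) : HasWeakDeriv a b f g := by
  have hc : HasWeakDeriv a b (fun _ => f a) (0 : ℝ → E) := by
    refine ⟨memL2_of_continuousOn continuousOn_const, MemLp.zero', fun φ h1 h2 h3 => ?_⟩
    have ha : φ a = 0 := image_eq_zero_of_notMem_tsupport fun h => lt_irrefl _ (h3 h).1
    have hb : φ b = 0 := image_eq_zero_of_notMem_tsupport fun h => lt_irrefl _ (h3 h).2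
    have hd : Continuous (deriv φ) := h1.continuous_deriv (by simp)
    rw [intervalIntegral.integral_smul_const, intervalIntegral.integral_deriv_eq_sub
      (fun x _ => (h1.differentiable (by simp)).differentiableAt) (hd.intervalIntegrable _ _)]
    simp [ha, hb]
  refine (hc.add hab.le (hasWeakDeriv_integral hab.le hg)).congr hab.le ?_ (by simp)
  exact ae_Ioo_of_eqOn fun x hx => (h x hx).symm

/-- The weak derivative of an `H²` function has a continuous representative. -/
theorem MemH.exists_continuousOn_weakDeriv (hab : a < b) {f : ℝ → E} (h : MemH a b 2 f) :
    ∃ g g', HasWeakDeriv a b f g ∧ ContinuousOn g (Icc a b) ∧ HasWeakDeriv a b g g' := by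
  obtain ⟨g, hg, g', hg', _⟩ := h
  obtain ⟨c, hc⟩ := hg'.exists_ae_eq_integral hab
  exact ⟨fun x => c + ∫ y in a..x, g' y, g', hg.congr hab.le (by rfl) hc,
    continuousOn_const.add (continuousOn_integral hab.le hg'.2.1),
    hg'.congr hab.le hc (by rfl)⟩

/-- Continuous functions that agree almost everywhere agree on the closed interval. So the choice
hidden in `D` is harmless, and its values at the end points and at the nodes are meaningful. -/
theorem D_eqOn (hab : a < b) {f g : ℝ → E} (h : HasWeakDeriv a b f g)
    (hg : ContinuousOn g (Icc a b)) : EqOn (D a b f) g (Icc a b) := by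
  have hex : ∃ g, HasWeakDeriv a b f g ∧ ContinuousOn g (Icc a b) := ⟨g, h, hg⟩
  rw [D, dif_pos hex]
  exact eqOn_Icc_of_ae_eq hab hex.choose_spec.2 hg (hex.choose_spec.1.ae_unique hab.le h)

theorem HasWeakDeriv.hasWeakDeriv_D {f g : ℝ → E} (h : HasWeakDeriv a b f g) :
    HasWeakDeriv a b f (D a b f) := by
  have hex : ∃ g, HasWeakDeriv a b f g := ⟨g, h⟩
  rw [D]
  split_ifs with h1
  · exact h1.choose_spec.1
  · exact hex.choose_spec

theorem D_ae_eq (hab : a < b) {f g : ℝ → E} (h : HasWeakDeriv a b f g) :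
    D a b f =ᵐ[volume.restrict (Ioo a b)] g :=
  h.hasWeakDeriv_D.ae_unique hab.le h

theorem MemH.continuousOn_D (hab : a < b) {f : ℝ → E} (h : MemH a b 2 f) :
    ContinuousOn (D a b f) (Icc a b) := by
  obtain ⟨g, g', h1, h2, h3⟩ := h.exists_continuousOn_weakDeriv hab
  exact h2.congr (D_eqOn hab h1 h2)

theorem MemH.hasWeakDeriv_D {m : ℕ} {f : ℝ → E} (h : MemH a b (m + 1) f) :
    HasWeakDeriv a b f (D a b f) := by
  obtain ⟨g, h1, _⟩ := h
  exact h1.hasWeakDeriv_D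

/-- If `f' = g` with `g` continuous and `g' = k`, then `f ∈ H²` and `D f`, `D (D f)` are
represented by `g` and `k`. -/
theorem mem_H_two {f g k : ℝ → E} (hf : ContinuousOn f (Icc a b))
    (hfg : HasWeakDeriv a b f g) (hgk : HasWeakDeriv a b g k) : f ∈ H a b 2 :=
  ⟨⟨g, hfg, k, hgk, hgk.2.1⟩, hf⟩

theorem DD_ae_eq (hab : a < b) {f g k : ℝ → E} (hg : ContinuousOn g (Icc a b))
    (hfg : HasWeakDeriv a b f g) (hgk : HasWeakDeriv a b g k) :
    D a b (D a b f) =ᵐ[volume.restrict (Ioo a b)] k :=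
  D_ae_eq hab (hgk.congr hab.le (ae_Ioo_of_eqOn (D_eqOn hab hfg hg)).symm (by rfl))

end WeakDerivatives

/-! ### Piecewise smooth functions: a class containing splines and smooth curves, stable under
products. -/

/-- `f` is continuous on `[a, b]` and differentiable with bounded derivative off a countable set. -/
def PiecewiseC1 {E : Type*} [NormedAddCommGroup E] [NormedSpace ℝ E] (a b : ℝ) (f : ℝ → E) : Prop :=
  ContinuousOn f (Icc a b) ∧ ∃ s : Set ℝ, s.Countable ∧ (∀ x ∈ Ioo a b \ s, DifferentiableAt ℝ f x) ∧
    ∃ C, ∀ x ∈ Ioo a b \ s, ‖deriv f x‖ ≤ C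

namespace PiecewiseC1

variable {E : Type*} [NormedAddCommGroup E] [InnerProductSpace ℝ E] {a b : ℝ}

theorem ae_differentiableAt {f : ℝ → E} (hf : PiecewiseC1 a b f) :
    ∀ᵐ x ∂volume.restrict (Ioo a b), DifferentiableAt ℝ f x := by
  obtain ⟨_, s, hs, h1, _⟩ := hf
  refine (ae_restrict_iff' measurableSet_Ioo).2 ?_
  filter_upwards [hs.ae_notMem volume] with x hx hx'
  exact h1 x ⟨hx', hx⟩

theorem of_hasDerivAt {f f' : ℝ → E} (h : ∀ x, HasDerivAt f (f' x) x) (hc : Continuous f') :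
    PiecewiseC1 a b f := by
  obtain ⟨C, hC⟩ := isCompact_Icc.exists_bound_of_continuousOn (s := Icc a b) hc.continuousOn
  refine ⟨fun x _ => (h x).continuousAt.continuousWithinAt, ∅, countable_empty,
    fun x _ => (h x).differentiableAt, C, fun x hx => ?_⟩
  rw [(h x).deriv]
  exact hC x (Ioo_subset_Icc_self hx.1)

theorem smul {φ : ℝ → ℝ} {f : ℝ → E} (hφ : PiecewiseC1 a b φ) (hf : PiecewiseC1 a b f) :
    PiecewiseC1 a b (fun x => φ x • f x) := by
  obtain ⟨c1, s, hs, h1, C, hC⟩ := hφ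
  obtain ⟨c2, t, ht, h2, K, hK⟩ := hf
  obtain ⟨A, hA⟩ := isCompact_Icc.exists_bound_of_continuousOn c1
  obtain ⟨B, hB⟩ := isCompact_Icc.exists_bound_of_continuousOn c2
  have hd : ∀ x ∈ Ioo a b \ (s ∪ t),
      HasDerivAt (fun x => φ x • f x) (φ x • deriv f x + deriv φ x • f x) x := fun x hx =>
    (h1 x ⟨hx.1, fun h => hx.2 (.inl h)⟩).hasDerivAt.smul
      (h2 x ⟨hx.1, fun h => hx.2 (.inr h)⟩).hasDerivAt
  refine ⟨c1.smul c2, s ∪ t, hs.union ht, fun x hx => (hd x hx).differentiableAt, A * K + C * B,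
    fun x hx => ?_⟩
  rw [(hd x hx).deriv]
  have i1 := hA x (Ioo_subset_Icc_self hx.1)
  have i2 := hB x (Ioo_subset_Icc_self hx.1)
  have i3 := hC x ⟨hx.1, fun h => hx.2 (.inl h)⟩
  have i4 := hK x ⟨hx.1, fun h => hx.2 (.inr h)⟩
  refine (norm_add_le _ _).trans ?_
  rw [norm_smul, norm_smul]
  exact add_le_add (mul_le_mul i1 i4 (norm_nonneg _) ((norm_nonneg _).trans i1))
    (mul_le_mul i3 i2 (norm_nonneg _) ((norm_nonneg _).trans i3))

theorem inner {f g : ℝ → E} (hf : PiecewiseC1 a b f) (hg : PiecewiseC1 a b g) :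
    PiecewiseC1 a b (fun x => ⟪f x, g x⟫) := by
  obtain ⟨c1, s, hs, h1, C, hC⟩ := hf
  obtain ⟨c2, t, ht, h2, K, hK⟩ := hg
  obtain ⟨A, hA⟩ := isCompact_Icc.exists_bound_of_continuousOn c1
  obtain ⟨B, hB⟩ := isCompact_Icc.exists_bound_of_continuousOn c2
  have hd : ∀ x ∈ Ioo a b \ (s ∪ t),
      HasDerivAt (fun x => ⟪f x, g x⟫) (⟪f x, deriv g x⟫ + ⟪deriv f x, g x⟫) x := fun x hx =>
    (h1 x ⟨hx.1, fun h => hx.2 (.inl h)⟩).hasDerivAt.inner ℝ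
      (h2 x ⟨hx.1, fun h => hx.2 (.inr h)⟩).hasDerivAt
  refine ⟨c1.inner c2, s ∪ t, hs.union ht, fun x hx => (hd x hx).differentiableAt, A * K + C * B,
    fun x hx => ?_⟩
  rw [(hd x hx).deriv]
  have i1 := hA x (Ioo_subset_Icc_self hx.1)
  have i2 := hB x (Ioo_subset_Icc_self hx.1)
  have i3 := hC x ⟨hx.1, fun h => hx.2 (.inl h)⟩
  have i4 := hK x ⟨hx.1, fun h => hx.2 (.inr h)⟩
  refine (norm_add_le _ _).trans (add_le_add ((norm_inner_le_norm _ _).trans ?_)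
    ((norm_inner_le_norm _ _).trans ?_))
  · exact mul_le_mul i1 i4 (norm_nonneg _) ((norm_nonneg _).trans i1)
  · exact mul_le_mul i3 i2 (norm_nonneg _) ((norm_nonneg _).trans i3)

theorem sub {f g : ℝ → E} (hf : PiecewiseC1 a b f) (hg : PiecewiseC1 a b g) :
    PiecewiseC1 a b (fun x => f x - g x) := by
  obtain ⟨c1, s, hs, h1, C, hC⟩ := hf
  obtain ⟨c2, t, ht, h2, K, hK⟩ := hg
  have hd : ∀ x ∈ Ioo a b \ (s ∪ t),
      HasDerivAt (fun x => f x - g x) (deriv f x - deriv g x) x := fun x hx =>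
    (h1 x ⟨hx.1, fun h => hx.2 (.inl h)⟩).hasDerivAt.sub
      (h2 x ⟨hx.1, fun h => hx.2 (.inr h)⟩).hasDerivAt
  refine ⟨c1.sub c2, s ∪ t, hs.union ht, fun x hx => (hd x hx).differentiableAt, C + K,
    fun x hx => ?_⟩
  rw [(hd x hx).deriv]
  exact (norm_sub_le _ _).trans (add_le_add (hC x ⟨hx.1, fun h => hx.2 (.inl h)⟩)
    (hK x ⟨hx.1, fun h => hx.2 (.inr h)⟩))

variable [CompleteSpace E]

theorem memL2_deriv {f : ℝ → E} (hf : PiecewiseC1 a b f) : MemL2 a b (deriv f) := by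
  obtain ⟨_, s, hs, h1, C, hC⟩ := hf
  refine MemLp.of_bound (aestronglyMeasurable_deriv _ _) C
    ((ae_restrict_iff' measurableSet_Ioo).2 ?_)
  filter_upwards [hs.ae_notMem volume] with x hx hx'
  exact hC x ⟨hx', hx⟩

theorem mono {c d : ℝ} {f : ℝ → E} (hf : PiecewiseC1 a b f) (hac : a ≤ c) (hdb : d ≤ b) :
    PiecewiseC1 c d f := by
  obtain ⟨c1, s, hs, h1, C, hC⟩ := hf
  have hsub : Ioo c d \ s ⊆ Ioo a b \ s := sdiff_subset_sdiff_left (Ioo_subset_Ioo hac hdb)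
  exact ⟨c1.mono (Icc_subset_Icc hac hdb), s, hs, fun x hx => h1 x (hsub hx), C,
    fun x hx => hC x (hsub hx)⟩

theorem integral_deriv {f : ℝ → E} (hf : PiecewiseC1 a b f) (hab : a ≤ b) :
    ∫ x in a..b, deriv f x = f b - f a := by
  have hi := hf.memL2_deriv.intervalIntegrable hab
  obtain ⟨c1, s, hs, h1, C, hC⟩ := hf
  exact integral_eq_of_hasDerivAt_off_countable_of_le f (deriv f) hab hs c1
    (fun x hx => (h1 x hx).hasDerivAt) hi

theorem eq_integral {f : ℝ → E} (hf : PiecewiseC1 a b f) :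
    ∀ x ∈ Icc a b, f x = f a + ∫ y in a..x, deriv f y := by
  intro x hx
  rw [(hf.mono le_rfl hx.2).integral_deriv hx.1]; abel

theorem hasWeakDeriv (hab : a < b) {f : ℝ → E} (hf : PiecewiseC1 a b f) :
    HasWeakDeriv a b f (deriv f) :=
  hasWeakDeriv_of_eq_integral hab hf.memL2_deriv hf.eq_integral

end PiecewiseC1

theorem MemL2.integrable_inner {E : Type*} [NormedAddCommGroup E] [InnerProductSpace ℝ E]
    {a b : ℝ} (hab : a ≤ b) {f g : ℝ → E} (hf : MemL2 a b f) (hg : MemL2 a b g) :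
    IntervalIntegrable (fun x => ⟪f x, g x⟫) volume a b := by
  rw [intervalIntegrable_iff_integrableOn_Ioo_of_le hab]
  have := MemLp.integrable_mul hf.norm hg.norm
  exact Integrable.mono' this (hf.1.inner hg.1)
    (Filter.Eventually.of_forall fun x => norm_inner_le_norm _ _)

theorem MemL2.integrable_norm_sq {E : Type*} [NormedAddCommGroup E] [InnerProductSpace ℝ E]
    {a b : ℝ} (hab : a ≤ b) {f : ℝ → E} (hf : MemL2 a b f) :
    IntervalIntegrable (fun x => ‖f x‖ ^ 2) volume a b := by
  simpa only [real_inner_self_eq_norm_sq] using hf.integrable_inner hab hf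

/-! ### Duality with `H^1_0`, and test functions built as primitives. -/

section Pairing

variable {a b : ℝ} {hab : a < b}

theorem mem_H10_of_piecewiseC1 (hab : a < b) {w : ℝ → ℝ} (hw : PiecewiseC1 a b w) (ha : w a = 0)
    (hb : w b = 0) : w ∈ H10 a b hab :=
  ⟨⟨⟨deriv w, hw.hasWeakDeriv hab, hw.memL2_deriv⟩, hw.1⟩, ha, hb⟩

theorem mem_H10_congr {w w' : ℝ → ℝ} (hw : w ∈ H10 a b hab) (h : EqOn w w' (Icc a b)) :
    w' ∈ H10 a b hab := by
  obtain ⟨⟨⟨g, hg, hg2⟩, hc⟩, h1, h2⟩ := hw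
  exact ⟨⟨⟨g, hg.congr hab.le (ae_Ioo_of_eqOn h) (by rfl), hg2⟩, hc.congr h.symm⟩,
    (h (left_mem_Icc.2 hab.le)).symm.trans h1, (h (right_mem_Icc.2 hab.le)).symm.trans h2⟩

theorem pair_ofL2 {f : ℝ → ℝ} (hf : MemL2 a b f) {w : ℝ → ℝ} (hw : w ∈ H10 a b hab) :
    pair (ofL2 hab f hf) w = ∫ x in a..b, f x * w x := by
  rw [pair, dif_pos hw]; rfl

/-- Elements of `H10` are functions on the whole line, so one vanishing on `[a, b]` need not be the
zero vector. Its `H¹` norm is zero, however, and `μ` is bounded by that norm. -/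
theorem pair_eq_zero (μ : HMinusOne a b hab) {w : ℝ → ℝ} (h : ∀ x ∈ Icc a b, w x = 0) :
    pair μ w = 0 := by
  have h0 : EqOn (0 : ℝ → ℝ) w (Icc a b) := fun x hx => (h x hx).symm
  have hw : w ∈ H10 a b hab := mem_H10_congr (Submodule.zero_mem _) h0
  rw [pair, dif_pos hw]
  obtain ⟨C, hC⟩ := μ.2
  have hz : HasWeakDeriv a b w 0 :=
    (HasWeakDeriv.congr hab.le (f := 0) (g := 0) ⟨MemLp.zero', MemLp.zero', by simp⟩
      (ae_Ioo_of_eqOn h0) (by rfl))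
  have hn : normH a b 1 w = 0 := by
    have e0 : ∫ x in a..b, ‖w x‖ ^ 2 = 0 := by
      rw [integral_congr_ae_Ioo hab.le (g := fun _ => 0)
        ((ae_Ioo_of_eqOn h0).symm.mono fun x hx => by simp [hx])]
      simp
    have e1 : ∫ x in a..b, ‖D a b w x‖ ^ 2 = 0 := by
      rw [integral_congr_ae_Ioo hab.le (g := fun _ => 0)
        ((D_ae_eq hab hz).mono fun x hx => by simp [hx])]
      simp
    simp only [normH, Finset.sum_range_succ, Finset.sum_range_zero, Function.iterate_zero,
      Function.iterate_one, id_eq, e0, e1]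
    simp
  have := hC ⟨w, hw⟩
  simp only [hn, mul_zero] at this
  exact abs_nonpos_iff.1 this

end Pairing

section Primitive

variable {E : Type*} [NormedAddCommGroup E] [InnerProductSpace ℝ E] [CompleteSpace E] {a b : ℝ}

/-- The data of the primitive of a function `p` with weak derivative `k`. -/
theorem primitive_spec (hab : a < b) {v p k : ℝ → E} (hp : ContinuousOn p (Icc a b))
    (hpk : HasWeakDeriv a b p k) (hv : ∀ x ∈ Icc a b, v x = v a + ∫ y in a..x, p y) :
    v ∈ H a b 2 ∧ EqOn (D a b v) p (Icc a b) ∧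
      D a b (D a b v) =ᵐ[volume.restrict (Ioo a b)] k := by
  have h := hasWeakDeriv_of_eq_integral hab (memL2_of_continuousOn hp) hv
  have hc : ContinuousOn v (Icc a b) :=
    (continuousOn_const.add (continuousOn_integral hab.le (memL2_of_continuousOn hp))).congr hv
  exact ⟨mem_H_two hc h hpk, D_eqOn hab h hp, DD_ae_eq hab hp h hpk⟩

/-- `H2D` leaves `v b` free, so `p` need not have mean zero. This is what reduces the problem to the
tangent field. -/
theorem primitive_mem_H2D (hab : a < b) {v p k : ℝ → E} (hp : ContinuousOn p (Icc a b))
    (hpk : HasWeakDeriv a b p k) (hv : ∀ x ∈ Icc a b, v x = v a + ∫ y in a..x, p y)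
    (hva : v a = 0) (ha : p a = 0) (hb : p b = 0) : v ∈ H2D a b := by
  obtain ⟨h1, h2, -⟩ := primitive_spec hab hp hpk hv
  exact ⟨h1, hva, (h2 (left_mem_Icc.2 hab.le)).trans ha, (h2 (right_mem_Icc.2 hab.le)).trans hb⟩

theorem hasDerivAt_of_weak (hab : a < b) {f g : ℝ → E} (h : HasWeakDeriv a b f g)
    (hf : ContinuousOn f (Icc a b)) (hg : ContinuousOn g (Icc a b)) {x : ℝ} (hx : x ∈ Ioo a b) :
    HasDerivAt f (g x) x := by
  have hgx : ContinuousAt g x := hg.continuousAt (Icc_mem_nhds hx.1 hx.2)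
  have h1 : HasDerivAt (fun x => f a + ∫ y in a..x, g y) (g x) x := by
    refine (intervalIntegral.integral_hasDerivAt_right ?_ ?_ hgx).const_add _
    · exact (hg.mono (by rw [uIcc_of_le hx.1.le]; exact Icc_subset_Icc_right hx.2.le)).intervalIntegrable
    · exact (hg.mono Ioo_subset_Icc_self).stronglyMeasurableAtFilter isOpen_Ioo x hx
  refine h1.congr_of_eventuallyEq ?_
  filter_upwards [Icc_mem_nhds hx.1 hx.2] with y hy using h.eq_integral hab hf y hy

theorem piecewiseC1_of_hasDerivAt {f g : ℝ → E} (hf : ContinuousOn f (Icc a b))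
    (hg : ContinuousOn g (Icc a b)) (h : ∀ x ∈ Ioo a b, HasDerivAt f (g x) x) :
    PiecewiseC1 a b f := by
  obtain ⟨C, hC⟩ := isCompact_Icc.exists_bound_of_continuousOn hg
  refine ⟨hf, ∅, countable_empty, fun x hx => (h x hx.1).differentiableAt, C, fun x hx => ?_⟩
  rw [(h x hx.1).deriv]
  exact hC x (Ioo_subset_Icc_self hx.1)

theorem eq_left_of_hasDerivAt_zero {f : ℝ → E} (hf : ContinuousOn f (Icc a b))
    (h : ∀ x ∈ Ioo a b, HasDerivAt f 0 x) {x : ℝ} (hx : x ∈ Icc a b) : f x = f a := by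
  have := integral_eq_of_hasDerivAt_off_countable_of_le f (fun _ => 0) hx.1 countable_empty
    (hf.mono (Icc_subset_Icc_right hx.2)) (fun y hy => h y ⟨hy.1.1, hy.1.2.trans_le hx.2⟩)
    (by simp)
  simpa [sub_eq_zero, eq_comm] using this

end Primitive

/-! ### Great circles and the ordinary differential equation of the tangent. -/

/-- `Q` is a unit speed reparametrised great circle of the unit sphere: `Q'' = -κ² Q`, `|Q| = 1` and
`|Q'| = κ`. -/
structure IsGreatCircle {E : Type*} [NormedAddCommGroup E] [InnerProductSpace ℝ E]
    (κ : ℝ) (Q Q' : ℝ → E) : Prop where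
  nonneg : 0 ≤ κ
  hasDerivAt : ∀ x, HasDerivAt Q (Q' x) x
  hasDerivAt' : ∀ x, HasDerivAt Q' (-κ ^ 2 • Q x) x
  norm_eq : ∀ x, ‖Q x‖ = 1
  norm_eq' : ∀ x, ‖Q' x‖ = κ

section GreatCircle

variable {E : Type*} [NormedAddCommGroup E] [InnerProductSpace ℝ E] {a b : ℝ}

theorem exists_isGreatCircle {κ : ℝ} (hκ : 0 ≤ κ) {A G : E} (hA : ‖A‖ = 1) (hG : ‖G‖ = κ)
    (hAG : ⟪A, G⟫ = 0) (a : ℝ) : ∃ Q Q' : ℝ → E, IsGreatCircle κ Q Q' ∧ Q a = A ∧ Q' a = G := by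
  -- For `κ = 0` this holds because `G = 0`. Then `B = 0` is not a unit vector and the curve is the
  -- constant `A`, so `⟪B, B⟫ = 1` is only used multiplied by `κ²` or by the squared sine.
  have hB : κ • (κ⁻¹ • G) = G := by
    rcases hκ.eq_or_lt with h | h
    · have : G = 0 := norm_eq_zero.1 (hG.trans h.symm)
      simp [this]
    · rw [smul_inv_smul₀ h.ne']
  set B := κ⁻¹ • G with hBdef
  have hAB : ⟪A, B⟫ = 0 := by rw [hBdef, inner_smul_right, hAG, mul_zero]
  have hBA : ⟪B, A⟫ = 0 := by rw [real_inner_comm, hAB]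
  have hAA : ⟪A, A⟫ = 1 := by rw [real_inner_self_eq_norm_sq, hA, one_pow]
  have hBB : κ ^ 2 * ⟪B, B⟫ = κ ^ 2 := by
    have : ⟪κ • B, κ • B⟫ = κ ^ 2 := by rw [hB, real_inner_self_eq_norm_sq, hG]
    rw [inner_smul_left, inner_smul_right, conj_trivial] at this
    linarith
  have hBs : ∀ x, Real.sin (κ * (x - a)) ^ 2 * ⟪B, B⟫ = Real.sin (κ * (x - a)) ^ 2 := by
    intro x
    rcases hκ.eq_or_lt with h | h
    · simp [← h]
    · have : ⟪B, B⟫ = 1 := by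
        have h2 : κ ^ 2 ≠ 0 := by positivity
        exact mul_left_cancel₀ h2 (by rw [hBB, mul_one])
      rw [this, mul_one]
  refine ⟨fun x => Real.cos (κ * (x - a)) • A + Real.sin (κ * (x - a)) • B,
    fun x => (-κ * Real.sin (κ * (x - a))) • A + (κ * Real.cos (κ * (x - a))) • B,
    ⟨hκ, fun x => ?_, fun x => ?_, fun x => ?_, fun x => ?_⟩, by simp, by simp [hB]⟩
  · have h1 : HasDerivAt (fun x => κ * (x - a)) κ x := by
      simpa using ((hasDerivAt_id x).sub_const a).const_mul κ
    exact ((h1.cos.smul_const A).add (h1.sin.smul_const B)).congr_deriv (by module)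
  · have h1 : HasDerivAt (fun x => κ * (x - a)) κ x := by
      simpa using ((hasDerivAt_id x).sub_const a).const_mul κ
    exact (((h1.sin.const_mul (-κ)).smul_const A).add
      ((h1.cos.const_mul κ).smul_const B)).congr_deriv (by module)
  · have h : ‖Real.cos (κ * (x - a)) • A + Real.sin (κ * (x - a)) • B‖ ^ 2 = 1 := by
      rw [← real_inner_self_eq_norm_sq]
      simp only [inner_add_left, inner_add_right, inner_smul_left, inner_smul_right, hAA, hAB, hBA,
        conj_trivial]
      linear_combination hBs x + Real.sin_sq_add_cos_sq (κ * (x - a))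
    exact (sq_eq_sq₀ (norm_nonneg _) zero_le_one).1 (h.trans (one_pow 2).symm)
  · refine (sq_eq_sq₀ (norm_nonneg _) hκ).1 ?_
    rw [← real_inner_self_eq_norm_sq]
    simp only [inner_add_left, inner_add_right, inner_smul_left, inner_smul_right, hAA, hAB, hBA,
      conj_trivial]
    linear_combination Real.cos (κ * (x - a)) ^ 2 * hBB +
      κ ^ 2 * Real.sin_sq_add_cos_sq (κ * (x - a))

end GreatCircle

/-- The pointwise inequality behind the coercivity of the Dirichlet form on vector fields that are
only approximately tangential. -/
theorem pointwise_garding {E : Type*} [NormedAddCommGroup E] [InnerProductSpace ℝ E]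
    {α κ : ℝ} (hα : 0 < α) (hα1 : α ≤ 1) {Q Q' e e' p p' : E} (hQ : ‖Q‖ = 1)
    (hQ' : ‖Q'‖ = κ) (hQQ : ⟪Q, Q'⟫ = 0)
    (hp : p = e - ⟪e, Q⟫ • Q)
    (hp' : p' = e' - (⟪e, Q⟫ • Q' + (⟪e, Q'⟫ + ⟪e', Q⟫) • Q)) :
    (1 - α) * ‖p'‖ ^ 2 - κ ^ 2 * ‖p‖ ^ 2 ≤
      (1 - α / 6) * ‖e'‖ ^ 2 - κ ^ 2 * ‖e‖ ^ 2 + (8 * κ ^ 2 / α + α / 2 * κ ^ 2) * ⟪e, Q⟫ ^ 2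
        + 2 * (⟪e, Q⟫ * (⟪e, -κ ^ 2 • Q⟫ + ⟪e', Q'⟫) + (⟪e, Q'⟫ + ⟪e', Q⟫) * ⟪e, Q'⟫) := by
  set g := ⟪e, Q⟫ with hg
  set m := ⟪e, Q'⟫ with hm
  set s := ⟪e', Q⟫ with hs
  set t := ⟪e', Q'⟫ with ht
  have hQ2 : ⟪Q, Q⟫ = 1 := by rw [real_inner_self_eq_norm_sq, hQ, one_pow]
  have hQ'2 : ⟪Q', Q'⟫ = κ ^ 2 := by rw [real_inner_self_eq_norm_sq, hQ']
  have hQQ' : ⟪Q', Q⟫ = 0 := by rw [real_inner_comm, hQQ]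
  have c1 : ⟪Q, e⟫ = g := real_inner_comm _ _
  have c2 : ⟪Q', e⟫ = m := real_inner_comm _ _
  have c3 : ⟪Q, e'⟫ = s := real_inner_comm _ _
  have c4 : ⟪Q', e'⟫ = t := real_inner_comm _ _
  have n1 : ‖p‖ ^ 2 = ‖e‖ ^ 2 - g ^ 2 := by
    rw [hp, ← real_inner_self_eq_norm_sq, ← real_inner_self_eq_norm_sq]
    simp only [inner_sub_left, inner_sub_right, inner_smul_left, inner_smul_right, c1, hQ2, ← hg,
      conj_trivial]
    ring
  have n2 : ‖p'‖ ^ 2 = ‖e'‖ ^ 2 + m ^ 2 - s ^ 2 + κ ^ 2 * g ^ 2 - 2 * g * t := by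
    rw [hp', ← real_inner_self_eq_norm_sq, ← real_inner_self_eq_norm_sq]
    simp only [inner_sub_left, inner_sub_right, inner_add_left, inner_add_right, inner_smul_left,
      inner_smul_right, c3, c4, hQ2, hQ'2, hQQ, hQQ', ← hs, ← ht, conj_trivial]
    ring
  have n3 : ⟪p', Q'⟫ = t - g * κ ^ 2 := by
    rw [hp']
    simp only [inner_sub_left, inner_add_left, inner_smul_left, hQ'2, hQQ, ← ht, conj_trivial]
    ring
  have n4 : ⟪e, -κ ^ 2 • Q⟫ = -κ ^ 2 * g := by rw [inner_smul_right]
  have b1 : |⟪p', Q'⟫| ≤ ‖p'‖ * κ := by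
    have := abs_real_inner_le_norm p' Q'
    rwa [hQ'] at this
  -- The right side minus the left side equals `α‖p'‖² - (α/6)‖e'‖² + (8κ²/α + ακ²/2) g² + (m + s)²
  -- + 4g⟪p', Q'⟫`. Half of `α‖p'‖²` absorbs the mixed term by Young's inequality; the other half
  -- absorbs `(α/6)‖e'‖²` through `b3`, and `α ≤ 1` keeps the coefficient of `(m + s)²` nonnegative.
  have b2 : -(4 * (g * ⟪p', Q'⟫)) ≤ α / 2 * ‖p'‖ ^ 2 + 8 * κ ^ 2 / α * g ^ 2 := by
    have i1 : -(g * ⟪p', Q'⟫) ≤ |g| * (‖p'‖ * κ) := by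
      refine (neg_le_abs _).trans ?_
      rw [abs_mul]
      exact mul_le_mul_of_nonneg_left b1 (abs_nonneg _)
    have i2 : 0 ≤ (α * ‖p'‖ - 4 * κ * |g|) ^ 2 / (2 * α) := by positivity
    have i3 : (α * ‖p'‖ - 4 * κ * |g|) ^ 2 / (2 * α)
        = α / 2 * ‖p'‖ ^ 2 + 8 * κ ^ 2 / α * |g| ^ 2 - 4 * (|g| * (‖p'‖ * κ)) := by
      field_simp; ring
    rw [sq_abs] at i3
    linarith
  have b3 : ‖e'‖ ^ 2 ≤ 3 * (‖p'‖ ^ 2 + (m + s) ^ 2 + κ ^ 2 * g ^ 2) := by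
    have i0 : e' = p' + ((m + s) • Q + g • Q') := by rw [hp']; abel
    have i1 : ‖e'‖ ≤ ‖p'‖ + (|m + s| + |g| * κ) := by
      rw [i0]
      refine (norm_add_le _ _).trans (add_le_add le_rfl ((norm_add_le _ _).trans ?_))
      rw [norm_smul, norm_smul, hQ, hQ', mul_one, Real.norm_eq_abs, Real.norm_eq_abs]
    have i2 : ‖e'‖ ^ 2 ≤ (‖p'‖ + (|m + s| + |g| * κ)) ^ 2 :=
      pow_le_pow_left₀ (norm_nonneg _) i1 2
    have i3 := sq_abs (m + s)
    have i4 := sq_abs g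
    have i5 : (|g| * κ) ^ 2 = κ ^ 2 * g ^ 2 := by rw [mul_pow, i4]; ring
    nlinarith [sq_nonneg (‖p'‖ - |m + s|), sq_nonneg (‖p'‖ - |g| * κ),
      sq_nonneg (|m + s| - |g| * κ)]
  have b5 : 0 ≤ (1 - α / 2) * (m + s) ^ 2 := mul_nonneg (by linarith) (sq_nonneg _)
  rw [n4]
  rw [n3] at b2
  have b4 := mul_le_mul_of_nonneg_left b3 (show 0 ≤ α / 6 by positivity)
  rw [n1]
  rw [n2] at b2 b4 ⊢
  linarith

section GreatCircle

variable {E : Type*} [NormedAddCommGroup E] [InnerProductSpace ℝ E] {a b : ℝ}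

namespace IsGreatCircle

variable {κ : ℝ} {Q Q' : ℝ → E}

theorem inner_eq_zero (h : IsGreatCircle κ Q Q') (x : ℝ) : ⟪Q x, Q' x⟫ = 0 := by
  have h1 := (h.hasDerivAt x).norm_sq
  have h2 : (fun x => ‖Q x‖ ^ 2) = fun _ => 1 := by funext y; rw [h.norm_eq, one_pow]
  rw [h2] at h1
  have := h1.unique (hasDerivAt_const x 1)
  linarith

theorem continuous (h : IsGreatCircle κ Q Q') : Continuous Q :=
  continuous_iff_continuousAt.2 fun x => (h.hasDerivAt x).continuousAt

theorem continuous' (h : IsGreatCircle κ Q Q') : Continuous Q' :=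
  continuous_iff_continuousAt.2 fun x => (h.hasDerivAt' x).continuousAt

theorem piecewiseC1 (h : IsGreatCircle κ Q Q') : PiecewiseC1 a b Q :=
  .of_hasDerivAt h.hasDerivAt h.continuous'

theorem piecewiseC1' (h : IsGreatCircle κ Q Q') : PiecewiseC1 a b Q' :=
  .of_hasDerivAt h.hasDerivAt' (h.continuous.const_smul _)

end IsGreatCircle

variable [CompleteSpace E]

/-- A curve `q` on the unit sphere with `q'' = λ q` is a great circle. -/
theorem exists_isGreatCircle_of_ode (hab : a < b) {q g : ℝ → E} {lam : ℝ → ℝ}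
    (hq : ContinuousOn q (Icc a b)) (hg : ContinuousOn g (Icc a b))
    (hl : ContinuousOn lam (Icc a b)) (hqg : ∀ x ∈ Ioo a b, HasDerivAt q (g x) x)
    (hgl : ∀ x ∈ Ioo a b, HasDerivAt g (lam x • q x) x) (hn : ∀ x ∈ Icc a b, ‖q x‖ = 1) :
    ∃ κ Q Q', IsGreatCircle κ Q Q' ∧ EqOn q Q (Icc a b) ∧ EqOn g Q' (Icc a b) ∧
      ∀ x ∈ Icc a b, lam x = -κ ^ 2 := by
  have hcl : closure (Ioo a b) = Icc a b := closure_Ioo hab.ne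
  have ha : a ∈ Icc a b := left_mem_Icc.2 hab.le
  have ext : ∀ f f' : ℝ → ℝ, ContinuousOn f (Icc a b) → ContinuousOn f' (Icc a b) →
      (∀ x ∈ Ioo a b, f x = f' x) → ∀ x ∈ Icc a b, f x = f' x := fun f f' h1 h2 h3 x hx =>
    (show EqOn f f' (Ioo a b) from h3).of_subset_closure h1 h2 Ioo_subset_Icc_self hcl.ge hx
  -- Differentiating `|q|² = 1` once gives `q ⟂ g`, and once more gives `λ = -|g|²`. Then `(|g|²)' =
  -- 2λ⟪q, g⟫ = 0`, so `λ` is constant.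
  have hqg0 : ∀ x ∈ Ioo a b, ⟪q x, g x⟫ = 0 := by
    intro x hx
    have h1 := (hqg x hx).norm_sq
    have h2 : (fun x => ‖q x‖ ^ 2) =ᶠ[nhds x] fun _ => 1 := by
      filter_upwards [Icc_mem_nhds hx.1 hx.2] with y hy
      rw [hn y hy, one_pow]
    have := (h1.congr_of_eventuallyEq h2.symm).unique (hasDerivAt_const x 1)
    linarith
  have hlam0 : ∀ x ∈ Ioo a b, lam x = -‖g x‖ ^ 2 := by
    intro x hx
    have h1 := (hqg x hx).inner ℝ (hgl x hx)
    have h2 : (fun x => ⟪q x, g x⟫) =ᶠ[nhds x] fun _ => 0 := by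
      filter_upwards [Ioo_mem_nhds hx.1 hx.2] with y hy using hqg0 y hy
    have := (h1.congr_of_eventuallyEq h2.symm).unique (hasDerivAt_const x 0)
    rw [inner_smul_right, real_inner_self_eq_norm_sq, real_inner_self_eq_norm_sq,
      hn x (Ioo_subset_Icc_self hx)] at this
    linarith
  have hlam : ∀ x ∈ Icc a b, lam x = -‖g x‖ ^ 2 := ext _ _ hl (hg.norm.pow 2).neg hlam0
  have hgn : ∀ x ∈ Icc a b, ‖g x‖ ^ 2 = ‖g a‖ ^ 2 := fun x hx =>
    eq_left_of_hasDerivAt_zero (f := fun x => ‖g x‖ ^ 2) (hg.norm.pow 2) (fun y hy => by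
      have h1 := (hgl y hy).norm_sq
      rw [inner_smul_right, real_inner_comm, hqg0 y hy, mul_zero, mul_zero] at h1
      exact h1) hx
  have hl2 : ∀ x ∈ Icc a b, lam x = -‖g a‖ ^ 2 := fun x hx => by rw [hlam x hx, hgn x hx]
  obtain ⟨Q, Q', hQ, hQa, hQ'a⟩ := exists_isGreatCircle (norm_nonneg (g a)) (hn a ha) rfl
    (ext (fun x => ⟪q x, g x⟫) (fun _ => 0) (hq.inner hg) continuousOn_const hqg0 a ha) a
  set κ := ‖g a‖
  have c1 : ContinuousOn (fun x => q x - Q x) (Icc a b) := hq.sub hQ.continuous.continuousOn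
  have c2 : ContinuousOn (fun x => g x - Q' x) (Icc a b) := hg.sub hQ.continuous'.continuousOn
  -- The difference from the great circle with the same initial data solves `y'' = -κ² y`, whose
  -- energy is conserved and starts at zero. Only `g = Q'` is read off, since for `κ = 0` the energy
  -- does not see `q - Q`; a further integration gives `q = Q`.
  have energy : ∀ x ∈ Icc a b, ‖g x - Q' x‖ ^ 2 + κ ^ 2 * ‖q x - Q x‖ ^ 2 = 0 := by
    intro x hx
    have := eq_left_of_hasDerivAt_zero
      (f := fun x => ‖g x - Q' x‖ ^ 2 + κ ^ 2 * ‖q x - Q x‖ ^ 2)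
      ((c2.norm.pow 2).add ((c1.norm.pow 2).const_mul _)) (fun y hy => by
        have h1 := ((hgl y hy).sub (hQ.hasDerivAt' y)).norm_sq
        have h2 := ((hqg y hy).sub (hQ.hasDerivAt y)).norm_sq
        refine (h1.add (h2.const_mul (κ ^ 2))).congr_deriv ?_
        rw [hl2 y (Ioo_subset_Icc_self hy), ← smul_sub, inner_smul_right, real_inner_comm]
        simp only [Pi.sub_apply]
        ring) hx
    rw [this]
    simp [hQa, hQ'a]
  have e2 : ∀ x ∈ Icc a b, g x = Q' x := fun x hx => by
    have := energy x hx
    have h3 : ‖g x - Q' x‖ ^ 2 = 0 := by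
      nlinarith [sq_nonneg ‖g x - Q' x‖, mul_nonneg (sq_nonneg κ) (sq_nonneg ‖q x - Q x‖)]
    exact sub_eq_zero.1 (norm_eq_zero.1 (pow_eq_zero_iff (two_ne_zero)|>.1 h3))
  refine ⟨κ, Q, Q', hQ, fun x hx => ?_, e2, hl2⟩
  have := eq_left_of_hasDerivAt_zero c1 (fun y hy => by
    have h2 := (hqg y hy).sub (hQ.hasDerivAt y)
    rw [e2 y (Ioo_subset_Icc_self hy), sub_self] at h2
    exact h2) hx
  rw [hQa, sub_self] at this
  exact sub_eq_zero.1 this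

end GreatCircle

/-! ### The stationary pair: Euler-Lagrange equations and the second variation. -/

section ContinuousProblem

variable {d : ℕ} {a b : ℝ}

/-- The constraint `|u'|² = 1`. -/
theorem norm_D_eq_one_of_stationary (hab : a < b) {u : ℝ → Vec d} {lam : HMinusOne a b hab}
    (hq : PiecewiseC1 a b (D a b u)) (hua : ‖D a b u a‖ = 1) (hub : ‖D a b u b‖ = 1)
    (hF : ∀ v ∈ H2D a b, ∀ μ : HMinusOne a b hab, F u lam v μ = 0) :
    ∀ x ∈ Icc a b, ‖D a b u x‖ = 1 := by
  set w : ℝ → ℝ := fun x => ‖D a b u x‖ ^ 2 - 1 with hw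
  have hwp : PiecewiseC1 a b w := by
    have := (hq.inner hq).sub
      (PiecewiseC1.of_hasDerivAt (f := fun _ => (1 : ℝ)) (fun x => hasDerivAt_const x 1)
        continuous_const)
    simpa only [real_inner_self_eq_norm_sq] using this
  have hwH : w ∈ H10 a b hab := mem_H10_of_piecewiseC1 hab hwp (by simp [hw, hua]) (by simp [hw, hub])
  have hwL : MemL2 a b w := memL2_of_continuousOn hwp.1
  have hz : HasWeakDeriv a b (0 : ℝ → Vec d) 0 :=
    ⟨MemLp.zero', MemLp.zero', fun φ _ _ _ => by simp⟩
  have hv : (fun _ => 0 : ℝ → Vec d) ∈ H2D a b :=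
    primitive_mem_H2D hab (p := 0) (k := 0) continuousOn_const hz (by simp) rfl rfl rfl
  have h0L : MemL2 a b (0 : ℝ → ℝ) := MemLp.zero'
  -- The constraint defect `w` serves as its own multiplier: it lies in `H^1_0` because the end
  -- tangents are unit. The difference of the equations for `μ = w` and `μ = 0` is `½ ∫ w² = 0`.
  have e1 := hF _ hv (ofL2 hab w hwL)
  have e2 := hF _ hv (ofL2 hab 0 h0L)
  rw [F, ← hw, pair_ofL2 _ hwH] at e1 e2
  have e3 : ∫ x in a..b, w x * w x = 0 := by
    simp only [Pi.zero_apply, zero_mul, intervalIntegral.integral_zero] at e2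
    linarith
  rw [intervalIntegral.integral_eq_zero_iff_of_nonneg_ae
    (Filter.Eventually.of_forall fun x => mul_self_nonneg _)
    ((hwL.integrable_mul hab.le hwL))] at e3
  rw [Ioc_eq_empty (not_lt.2 hab.le), union_empty, ← Measure.restrict_congr_set Ioo_ae_eq_Ioc] at e3
  have e4 := eqOn_Icc_of_ae_eq hab (hwp.1.mul hwp.1) continuousOn_const e3
  intro x hx
  have e5 : w x = 0 := mul_self_eq_zero.1 (e4 hx)
  have e6 : ‖D a b u x‖ ^ 2 = 1 ^ 2 := by rw [one_pow]; exact sub_eq_zero.1 e5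
  exact (sq_eq_sq₀ (norm_nonneg _) zero_le_one).1 e6

/-- The Euler-Lagrange equation `u''' = λ u'`. -/
theorem hasWeakDeriv_DD_of_stationary (hab : a < b) {u : ℝ → Vec d} {lam : ℝ → ℝ}
    (hlam : MemL2 a b lam) (hlc : ContinuousOn lam (Icc a b))
    (hq : PiecewiseC1 a b (D a b u)) (hqd : MemL2 a b (D a b (D a b u)))
    (hF : ∀ v ∈ H2D a b, ∀ μ : HMinusOne a b hab, F u (ofL2 hab lam hlam) v μ = 0) :
    HasWeakDeriv a b (D a b (D a b u)) (fun x => lam x • D a b u x) := by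
  have hlq : MemL2 a b (fun x => lam x • D a b u x) := memL2_of_continuousOn (hlc.smul hq.1)
  refine ⟨hqd, hlq, fun φ h1 h2 h3 => ?_⟩
  have hd : Continuous (deriv φ) := h1.continuous_deriv (by simp)
  have ha : φ a = 0 := image_eq_zero_of_notMem_tsupport fun h => lt_irrefl _ (h3 h).1
  have hb : φ b = 0 := image_eq_zero_of_notMem_tsupport fun h => lt_irrefl _ (h3 h).2
  have hφd : ∀ x, HasDerivAt φ (deriv φ x) x := fun x =>
    ((h1.differentiable (by simp)) x).hasDerivAt
  have i1 : IntervalIntegrable (fun x => deriv φ x • D a b (D a b u) x) volume a b :=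
    (hqd.intervalIntegrable hab.le).continuousOn_smul hd.continuousOn
  have i2 : IntervalIntegrable (fun x => φ x • lam x • D a b u x) volume a b :=
    (hlq.intervalIntegrable hab.le).continuousOn_smul h1.continuous.continuousOn
  rw [eq_neg_iff_add_eq_zero]
  refine ext_inner_left ℝ fun e => ?_
  have hpd : ∀ x, HasDerivAt (fun x => φ x • e) (deriv φ x • e) x := fun x => (hφd x).smul_const e
  have hp : PiecewiseC1 a b (fun x => φ x • e) :=
    .of_hasDerivAt hpd (hd.smul continuous_const)
  have hpw : HasWeakDeriv a b (fun x => φ x • e) (fun x => deriv φ x • e) := by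
    have := hp.hasWeakDeriv hab
    rwa [show deriv (fun x => φ x • e) = fun x => deriv φ x • e from
      funext fun x => (hpd x).deriv] at this
  -- Since `v b` is free, `φ` need not have mean zero, and no constant of integration enters the
  -- equation `u''' = λ u'`.
  set v : ℝ → Vec d := fun x => ∫ y in a..x, φ y • e
  have hv : ∀ x ∈ Icc a b, v x = v a + ∫ y in a..x, φ y • e := by simp [v]
  have hvD : v ∈ H2D a b := primitive_mem_H2D hab hp.1 hpw hv (by simp [v]) (by simp [ha])
    (by simp [hb])
  obtain ⟨-, s2, s3⟩ := primitive_spec hab hp.1 hpw hv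
  have hw : (fun x => ⟪D a b u x, φ x • e⟫) ∈ H10 a b hab :=
    mem_H10_of_piecewiseC1 hab (hq.inner hp) (by simp [ha]) (by simp [hb])
  have hw' : (fun x => ⟪D a b u x, D a b v x⟫) ∈ H10 a b hab :=
    mem_H10_congr hw fun x hx => by simp only [s2 hx]
  have h0L : MemL2 a b (0 : ℝ → ℝ) := MemLp.zero'
  have e0 := hF v hvD (ofL2 hab 0 h0L)
  have ez : pair (ofL2 hab 0 h0L) (fun x => ‖D a b u x‖ ^ 2 - 1) = 0 := by
    rw [pair]
    split_ifs
    · show ∫ x in a..b, (0 : ℝ → ℝ) x * _ = 0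
      simp
    · rfl
  rw [F, ez, pair_ofL2 _ hw', mul_zero, add_zero] at e0
  have e1 : ∫ x in a..b, ⟪D a b (D a b u) x, D a b (D a b v) x⟫
      = ⟪e, ∫ x in a..b, deriv φ x • D a b (D a b u) x⟫ := by
    have := (innerSL ℝ e).intervalIntegral_comp_comm i1
    simp only [innerSL_apply_apply] at this
    rw [← this]
    refine integral_congr_ae_Ioo hab.le (s3.mono fun x hx => ?_)
    simp only [hx, inner_smul_right, real_inner_comm]
  have e2 : ∫ x in a..b, lam x * ⟪D a b u x, D a b v x⟫
      = ⟪e, ∫ x in a..b, φ x • lam x • D a b u x⟫ := by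
    have := (innerSL ℝ e).intervalIntegral_comp_comm i2
    simp only [innerSL_apply_apply] at this
    rw [← this]
    refine integral_congr_ae_Ioo hab.le (ae_Ioo_of_eqOn fun x hx => ?_)
    simp only [s2 hx, inner_smul_right, real_inner_comm]
    ring
  rw [inner_add_right, ← e1, ← e2, e0, inner_zero_right]

/-- The regularity of `u` makes `u''` continuous, and `λ` is continuous too. The weak equation is
therefore a classical second order equation for `u'` on the sphere, to which
`exists_isGreatCircle_of_ode` applies. -/
theorem exists_isGreatCircle_of_stationary (hab : a < b) {u : ℝ → Vec d} (hu : u ∈ H a b 4)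
    {lam : ℝ → ℝ} (hlam : lam ∈ H a b 2) (hua : ‖D a b u a‖ = 1) (hub : ‖D a b u b‖ = 1)
    (hF : ∀ v ∈ H2D a b, ∀ μ : HMinusOne a b hab, F u (ofL2 hab lam hlam.1.memL2) v μ = 0) :
    ∃ κ Q Q', IsGreatCircle κ Q Q' ∧ EqOn (D a b u) Q (Icc a b) ∧
      ∀ x ∈ Icc a b, lam x = -κ ^ 2 := by
  obtain ⟨⟨g, h1, g1, h2, h3⟩, -⟩ := hu
  have hu2 : MemH a b 2 u := ⟨g, h1, g1, h2, h2.2.1⟩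
  have hqc := hu2.continuousOn_D hab
  obtain ⟨c, hc⟩ : ∃ c, g1 =ᵐ[volume.restrict (Ioo a b)] c ∧ ContinuousOn c (Icc a b) := by
    obtain ⟨g2, h4, -⟩ := h3
    obtain ⟨k, hk⟩ := h4.exists_ae_eq_integral hab
    exact ⟨_, hk, continuousOn_const.add (continuousOn_integral hab.le h4.2.1)⟩
  obtain ⟨hc1, hc2⟩ := hc
  have hw : HasWeakDeriv a b (D a b u) c := h2.congr hab.le (D_ae_eq hab h1).symm hc1
  have hder : ∀ x ∈ Ioo a b, HasDerivAt (D a b u) (c x) x := fun x hx =>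
    hasDerivAt_of_weak hab hw hqc hc2 hx
  have hq : PiecewiseC1 a b (D a b u) := piecewiseC1_of_hasDerivAt hqc hc2 hder
  have hn := norm_D_eq_one_of_stationary hab hq hua hub hF
  have hEL := hasWeakDeriv_DD_of_stationary hab hlam.1.memL2 hlam.2 hq
    (hw.hasWeakDeriv_D).2.1 hF
  have hEL' := hEL.congr hab.le (D_ae_eq hab hw) (by rfl)
  obtain ⟨κ, Q, Q', r1, r2, -, r4⟩ := exists_isGreatCircle_of_ode hab hqc hc2 hlam.2 hder
    (fun x hx => hasDerivAt_of_weak hab hEL' hc2 (hlam.2.smul hqc) hx) hn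
  exact ⟨κ, Q, Q', r1, r2, r4⟩

/-- Coercivity of the second variation of the Dirichlet energy on tangential fields. -/
theorem coercive_tangential (hab : a < b) {u : ℝ → Vec d} {lam : ℝ → ℝ} (hlam : MemL2 a b lam)
    {κ : ℝ} {Q : ℝ → Vec d} (hu : EqOn (D a b u) Q (Icc a b))
    (hl : ∀ x ∈ Icc a b, lam x = -κ ^ 2) {α : ℝ} (hα : 0 ≤ α)
    (hc : ∀ v ∈ kerB hab u, α * normH a b 2 v ^ 2 ≤ aForm (ofL2 hab lam hlam) v v)
    {p : ℝ → Vec d} (hp : PiecewiseC1 a b p) (ha : p a = 0) (hb : p b = 0)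
    (ht : ∀ x ∈ Icc a b, ⟪Q x, p x⟫ = 0) :
    α * ∫ x in a..b, ‖deriv p x‖ ^ 2
      ≤ (∫ x in a..b, ‖deriv p x‖ ^ 2) - κ ^ 2 * ∫ x in a..b, ‖p x‖ ^ 2 := by
  set v : ℝ → Vec d := fun x => ∫ y in a..x, p y
  have hv : ∀ x ∈ Icc a b, v x = v a + ∫ y in a..x, p y := by simp [v]
  have hpw := hp.hasWeakDeriv hab
  have hvD : v ∈ H2D a b := primitive_mem_H2D hab hp.1 hpw hv (by simp [v]) ha hb
  obtain ⟨-, s2, s3⟩ := primitive_spec hab hp.1 hpw hv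
  -- Tangentiality is a pointwise identity on `[a, b]`, so every functional `μ` annihilates it, not
  -- only those coming from `L²`.
  have hk : v ∈ kerB hab u := ⟨hvD, fun μ => pair_eq_zero μ fun x hx => by
    rw [hu hx, s2 hx, ht x hx]⟩
  have h0 := hc v hk
  have hw : (fun x => ⟪D a b v x, D a b v x⟫) ∈ H10 a b hab :=
    mem_H10_congr (mem_H10_of_piecewiseC1 hab (hp.inner hp) (by simp [ha]) (by simp [hb]))
      fun x hx => by simp only [s2 hx]
  have e1 : ∫ x in a..b, ⟪D a b (D a b v) x, D a b (D a b v) x⟫ = ∫ x in a..b, ‖deriv p x‖ ^ 2 :=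
    integral_congr_ae_Ioo hab.le (s3.mono fun x hx => by
      simp only [hx, real_inner_self_eq_norm_sq])
  have e2 : ∫ x in a..b, lam x * ⟪D a b v x, D a b v x⟫ = -κ ^ 2 * ∫ x in a..b, ‖p x‖ ^ 2 := by
    rw [← intervalIntegral.integral_const_mul]
    refine integral_congr_ae_Ioo hab.le (ae_Ioo_of_eqOn fun x hx => ?_)
    simp only [s2 hx, hl x hx, real_inner_self_eq_norm_sq]
  rw [aForm, pair_ofL2 _ hw, e1, e2] at h0
  have e3 : ∫ x in a..b, ‖deriv p x‖ ^ 2 ≤ normH a b 2 v ^ 2 := by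
    rw [normH, Real.sq_sqrt (Finset.sum_nonneg fun i _ =>
      intervalIntegral.integral_nonneg hab.le fun x _ => by positivity)]
    rw [Finset.sum_range_succ]
    have e4 : ∫ x in a..b, ‖((D a b)^[2] v) x‖ ^ 2 = ∫ x in a..b, ‖deriv p x‖ ^ 2 :=
      integral_congr_ae_Ioo hab.le (s3.mono fun x hx => by
        simp only [Function.iterate_succ, Function.iterate_zero, Function.comp, id, hx])
    rw [e4]
    exact le_add_of_nonneg_left (Finset.sum_nonneg fun i _ =>
      intervalIntegral.integral_nonneg hab.le fun x _ => by positivity)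
  have := mul_le_mul_of_nonneg_left e3 hα
  linarith

/-- The Gårding inequality for fields that need not be tangential. -/
theorem exists_garding (hab : a < b) {u : ℝ → Vec d} {lam : ℝ → ℝ} (hlam : MemL2 a b lam)
    {κ : ℝ} {Q Q' : ℝ → Vec d} (hQ : IsGreatCircle κ Q Q') (hu : EqOn (D a b u) Q (Icc a b))
    (hl : ∀ x ∈ Icc a b, lam x = -κ ^ 2) (hc : CoerciveOnKer u (ofL2 hab lam hlam)) :
    ∃ c C : ℝ, 0 < c ∧ 0 ≤ C ∧ ∀ e : ℝ → Vec d, PiecewiseC1 a b e → e a = 0 → e b = 0 →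
      c * (∫ x in a..b, ‖deriv e x‖ ^ 2) ≤ (∫ x in a..b, ‖deriv e x‖ ^ 2)
        - κ ^ 2 * (∫ x in a..b, ‖e x‖ ^ 2) + C * ∫ x in a..b, ⟪e x, Q x⟫ ^ 2 := by
  obtain ⟨α₀, hα₀, hc₀⟩ := hc
  -- `pointwise_garding` needs a coercivity constant at most `1`; lowering it is harmless.
  set α := min α₀ 1
  have hα : 0 < α := lt_min hα₀ one_pos
  have hα1 : α ≤ 1 := min_le_right _ _
  have hc' : ∀ v ∈ kerB hab u, α * normH a b 2 v ^ 2 ≤ aForm (ofL2 hab lam hlam) v v :=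
    fun v hv => (mul_le_mul_of_nonneg_right (min_le_left _ _) (sq_nonneg _)).trans (hc₀ v hv)
  set C := 8 * κ ^ 2 / α + α / 2 * κ ^ 2
  refine ⟨α / 6, C, by positivity, by positivity, fun e he ha hb => ?_⟩
  have hg := he.inner (hQ.piecewiseC1 (a := a) (b := b))
  have hm := he.inner (hQ.piecewiseC1' (a := a) (b := b))
  have hp := he.sub (hg.smul hQ.piecewiseC1)
  have hS := hg.inner hm
  set p : ℝ → Vec d := fun x => e x - ⟪e x, Q x⟫ • Q x with hpdef
  have hco := coercive_tangential hab hlam hu hl hα.le hc' hp (by simp [hpdef, ha])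
    (by simp [hpdef, hb]) (fun x _ => by
      simp only [hpdef, inner_sub_right, inner_smul_right, real_inner_self_eq_norm_sq, hQ.norm_eq,
        real_inner_comm]
      ring)
  -- The pointwise inequality holds only after adding the derivative of `2⟪e, Q⟫⟪e, Q'⟫`, whose
  -- integral vanishes because `e` is zero at both ends.
  have hS0 : ∫ x in a..b, deriv (fun x => ⟪⟪e x, Q x⟫, ⟪e x, Q' x⟫⟫) x = 0 := by
    rw [hS.integral_deriv hab.le]; simp [ha, hb]
  have ip' := hp.memL2_deriv.integrable_norm_sq hab.le
  have ip := (memL2_of_continuousOn hp.1).integrable_norm_sq hab.le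
  have ie' := he.memL2_deriv.integrable_norm_sq hab.le
  have ie := (memL2_of_continuousOn he.1).integrable_norm_sq hab.le
  have ig := (memL2_of_continuousOn hg.1).integrable_norm_sq hab.le
  simp only [Real.norm_eq_abs, sq_abs] at ig
  have iS := hS.memL2_deriv.intervalIntegrable hab.le
  have key : ∫ x in a..b, ((1 - α) * ‖deriv p x‖ ^ 2 - κ ^ 2 * ‖p x‖ ^ 2)
      ≤ ∫ x in a..b, ((1 - α / 6) * ‖deriv e x‖ ^ 2 - κ ^ 2 * ‖e x‖ ^ 2 + C * ⟪e x, Q x⟫ ^ 2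
        + 2 * deriv (fun x => ⟪⟪e x, Q x⟫, ⟪e x, Q' x⟫⟫) x) := by
    refine intervalIntegral.integral_mono_ae_restrict hab.le
      ((ip'.const_mul _).sub (ip.const_mul _))
      ((((ie'.const_mul _).sub (ie.const_mul _)).add (ig.const_mul _)).add (iS.const_mul _)) ?_
    rw [← Measure.restrict_congr_set Ioo_ae_eq_Icc]
    filter_upwards [he.ae_differentiableAt] with x hx
    have d1 := hx.hasDerivAt.inner ℝ (hQ.hasDerivAt x)
    have d2 := hx.hasDerivAt.inner ℝ (hQ.hasDerivAt' x)
    have d3 := hx.hasDerivAt.sub (d1.smul (hQ.hasDerivAt x))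
    have d4 := d1.inner ℝ d2
    have f3 : deriv p x = _ := d3.deriv
    rw [d4.deriv]
    have := pointwise_garding hα hα1 (hQ.norm_eq x) (hQ.norm_eq' x) (hQ.inner_eq_zero x)
      (e := e x) (p := p x) rfl f3
    refine this.trans (le_of_eq ?_)
    simp only [Real.inner_apply, C]
  have a1 : ∫ x in a..b, ((1 - α) * ‖deriv p x‖ ^ 2 - κ ^ 2 * ‖p x‖ ^ 2)
      = (1 - α) * (∫ x in a..b, ‖deriv p x‖ ^ 2) - κ ^ 2 * ∫ x in a..b, ‖p x‖ ^ 2 := by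
    rw [intervalIntegral.integral_sub (ip'.const_mul _) (ip.const_mul _)]
    simp only [intervalIntegral.integral_const_mul]
  have a2 : ∫ x in a..b, ((1 - α / 6) * ‖deriv e x‖ ^ 2 - κ ^ 2 * ‖e x‖ ^ 2 + C * ⟪e x, Q x⟫ ^ 2
        + 2 * deriv (fun x => ⟪⟪e x, Q x⟫, ⟪e x, Q' x⟫⟫) x)
      = (1 - α / 6) * (∫ x in a..b, ‖deriv e x‖ ^ 2) - κ ^ 2 * (∫ x in a..b, ‖e x‖ ^ 2)
        + C * (∫ x in a..b, ⟪e x, Q x⟫ ^ 2) := by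
    rw [intervalIntegral.integral_add
      (((ie'.const_mul _).sub (ie.const_mul _)).add (ig.const_mul _)) (iS.const_mul _),
      intervalIntegral.integral_add ((ie'.const_mul _).sub (ie.const_mul _)) (ig.const_mul _),
      intervalIntegral.integral_sub (ie'.const_mul _) (ie.const_mul _)]
    simp only [intervalIntegral.integral_const_mul, hS0]
    ring
  rw [a1, a2] at key
  linarith

end ContinuousProblem

/-! ### Geometry of the mesh. -/

namespace Mesh

section Geometry

variable {a b : ℝ} (T : Mesh a b)

theorem len_pos (i : Fin T.M) : 0 < T.len i :=
  sub_pos.2 (T.strictMono (Fin.castSucc_lt_succ))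

theorem x_succ (i : Fin T.M) : T.x i.succ = T.x i.castSucc + T.len i := by
  rw [len]; ring

theorem x_lt (i : Fin T.M) : T.x i.castSucc < T.x i.succ :=
  T.strictMono (Fin.castSucc_lt_succ)

theorem mid_eq (i : Fin T.M) : T.mid i = T.x i.castSucc + T.len i / 2 := by
  rw [mid, len]; ring

theorem x_mem (j : Fin (T.M + 1)) : T.x j ∈ Icc a b := by
  constructor
  · exact T.left.symm.trans_le (T.strictMono.monotone (Fin.zero_le j))
  · exact (T.strictMono.monotone (Fin.le_last j)).trans_eq T.right

theorem Icc_subset (i : Fin T.M) : Icc (T.x i.castSucc) (T.x i.succ) ⊆ Icc a b :=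
  Icc_subset_Icc (T.x_mem _).1 (T.x_mem _).2

theorem Ioo_subset (i : Fin T.M) : Ioo (T.x i.castSucc) (T.x i.succ) ⊆ Ioo a b :=
  Ioo_subset_Ioo (T.x_mem _).1 (T.x_mem _).2

theorem mid_mem (i : Fin T.M) : T.mid i ∈ Ioo (T.x i.castSucc) (T.x i.succ) := by
  have := T.len_pos i
  rw [mid_eq, x_succ]
  constructor <;> linarith

theorem len_le_h (i : Fin T.M) : T.len i ≤ T.h :=
  le_ciSup (f := T.len) (Set.finite_range _).bddAbove i

theorem exists_mem_Icc (hab : a < b) {y : ℝ} (hy : y ∈ Icc a b) :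
    ∃ i : Fin T.M, y ∈ Icc (T.x i.castSucc) (T.x i.succ) := by
  have key : ∀ j : Fin (T.M + 1), T.x j < y ∨ y = a ∨
      ∃ i : Fin T.M, y ∈ Icc (T.x i.castSucc) (T.x i.succ) := by
    intro j
    induction j using Fin.induction with
    | zero => rw [T.left]; exact hy.1.lt_or_eq.imp id fun h => Or.inl h.symm
    | succ i ih =>
      rcases ih with h | h
      · rcases lt_or_ge (T.x i.succ) y with h' | h'
        · exact Or.inl h'
        · exact Or.inr (Or.inr ⟨i, h.le, h'⟩)
      · exact Or.inr h
  rcases key (Fin.last _) with h | h | h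
  · rw [T.right] at h; exact absurd h (not_lt.2 hy.2)
  · have hM : 0 < T.M := by
      by_contra h0
      have h1 : (Fin.last T.M) = 0 := Fin.ext (by simp; omega)
      have := T.right
      rw [h1, T.left] at this
      exact hab.ne this
    refine ⟨⟨0, hM⟩, ?_⟩
    have h0 : (Fin.castSucc ⟨0, hM⟩ : Fin (T.M + 1)) = 0 := rfl
    have h2 := (T.x_lt ⟨0, hM⟩).le
    rw [h0, T.left] at h2 ⊢
    rw [h]
    exact ⟨le_rfl, h2⟩
  · exact h

theorem exists_elem (hab : a < b) : ∃ _ : Fin T.M, True :=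
  let ⟨i, _⟩ := T.exists_mem_Icc hab (left_mem_Icc.2 hab.le)
  ⟨i, trivial⟩

theorem h_pos (hab : a < b) : 0 < T.h :=
  let ⟨i, _⟩ := T.exists_elem hab
  (T.len_pos i).trans_le (T.len_le_h i)

theorem exists_mem_Ioo (hab : a < b) {y : ℝ} (hy : y ∈ Ioo a b \ range T.x) :
    ∃ i : Fin T.M, y ∈ Ioo (T.x i.castSucc) (T.x i.succ) := by
  obtain ⟨i, hi⟩ := T.exists_mem_Icc hab (Ioo_subset_Icc_self hy.1)
  exact ⟨i, hi.1.lt_of_ne fun h => hy.2 ⟨_, h⟩, hi.2.lt_of_ne fun h => hy.2 ⟨_, h.symm⟩⟩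

theorem sum_integral {E : Type*} [NormedAddCommGroup E] [NormedSpace ℝ E] {f : ℝ → E}
    (hab : a ≤ b) (hf : IntervalIntegrable f volume a b) :
    ∑ i : Fin T.M, ∫ y in T.x i.castSucc..T.x i.succ, f y = ∫ y in a..b, f y := by
  let X : ℕ → ℝ := fun k => if h : k < T.M + 1 then T.x ⟨k, h⟩ else b
  have h1 : ∀ i : Fin T.M, X i = T.x i.castSucc := fun i => by
    simp only [X, dif_pos (Nat.lt_succ_of_lt i.2)]; rfl
  have h2 : ∀ i : Fin T.M, X (i + 1) = T.x i.succ := fun i => by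
    simp only [X, dif_pos (Nat.succ_lt_succ i.2)]; rfl
  have h3 : X 0 = a := by simp only [X, Nat.zero_lt_succ, dif_pos]; exact T.left
  have h4 : X T.M = b := by simp only [X, Nat.lt_succ_self, dif_pos]; exact T.right
  have := intervalIntegral.sum_integral_adjacent_intervals (f := f) (μ := volume) (a := X)
    (n := T.M) fun k hk => by
      have e1 := h1 ⟨k, hk⟩
      have e2 := h2 ⟨k, hk⟩
      simp only at e1 e2
      rw [e1, e2]
      refine hf.mono_set ?_
      rw [uIcc_of_le (T.x_lt _).le, uIcc_of_le hab]
      exact T.Icc_subset _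
  rw [h3, h4, Finset.sum_range] at this
  rw [← this]
  exact Finset.sum_congr rfl fun i _ => by rw [h1, h2]

theorem sum_len (hab : a ≤ b) : ∑ i : Fin T.M, T.len i = b - a := by
  have := T.sum_integral (f := fun _ => (1 : ℝ)) hab (by simp)
  simpa [len] using this

end Geometry

/-! ### Piecewise quadratics in terms of nodal values, Simpson's rule and the Dirichlet form. -/

/-- The index set of the nodes and midpoints. -/
abbrev Idx {a b : ℝ} (T : Mesh a b) : Type := Fin (T.M + 1) ⊕ Fin T.M

/-- The nodes and midpoints. -/
def node {a b : ℝ} (T : Mesh a b) : T.Idx → ℝ := Sum.elim T.x T.mid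

section Interpolation

variable {a b : ℝ} (T : Mesh a b) {E : Type*} [NormedAddCommGroup E] [InnerProductSpace ℝ E]

/-- The increment of nodal values over an element. -/
def inc (P : T.Idx → E) (i : Fin T.M) : E := P (.inl i.succ) - P (.inl i.castSucc)

/-- The second difference of nodal values on an element. -/
def sdiff2 (P : T.Idx → E) (i : Fin T.M) : E :=
  P (.inl i.castSucc) - (2 : ℝ) • P (.inr i) + P (.inl i.succ)

/-- The affine coordinate of an element, truncated to `[0, 1]`. -/
def coord (i : Fin T.M) (y : ℝ) : ℝ := max 0 (min 1 ((T.len i)⁻¹ * (y - T.x i.castSucc)))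

/-- The quadratic with given values at the nodes and the midpoint of an element. -/
def quad (P : T.Idx → E) (i : Fin T.M) (y : ℝ) : E :=
  P (.inl i.castSucc) + ((T.len i)⁻¹ * (y - T.x i.castSucc)) • (T.inc P i - (2 : ℝ) • T.sdiff2 P i)
    + (2 * ((T.len i)⁻¹ * (y - T.x i.castSucc)) ^ 2) • T.sdiff2 P i

/-- The derivative of `quad`. -/
def quadDeriv (P : T.Idx → E) (i : Fin T.M) (y : ℝ) : E :=
  (T.len i)⁻¹ • (T.inc P i - (2 : ℝ) • T.sdiff2 P i
    + (4 * ((T.len i)⁻¹ * (y - T.x i.castSucc))) • T.sdiff2 P i)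

/-- The continuous piecewise quadratic function with given nodal values. -/
def interp (P : T.Idx → E) (y : ℝ) : E :=
  P (.inl 0) + ∑ i : Fin T.M, (T.coord i y • T.inc P i
    - (2 * (T.coord i y * (1 - T.coord i y))) • T.sdiff2 P i)

theorem continuous_interp (P : T.Idx → E) : Continuous (T.interp P) := by
  unfold interp coord
  fun_prop

theorem sum_inc (P : T.Idx → E) (j : Fin (T.M + 1)) :
    P (.inl 0) + ∑ i : Fin T.M, (if i.castSucc < j then T.inc P i else 0) = P (.inl j) := by
  induction j using Fin.induction with
  | zero => simp
  | succ k ih =>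
    have : ∀ i : Fin T.M, (if i.castSucc < k.succ then T.inc P i else 0)
        = (if i.castSucc < k.castSucc then T.inc P i else 0) + (if i = k then T.inc P i else 0) := by
      intro i
      rcases lt_trichotomy i k with h | h | h
      · simp [Fin.castSucc_lt_succ_iff, h.le, h, h.ne]
      · simp [Fin.castSucc_lt_succ_iff, h]
      · simp [Fin.castSucc_lt_succ_iff, h.not_ge, h.not_gt, h.ne']
    rw [Finset.sum_congr rfl fun i _ => this i, Finset.sum_add_distrib, ← add_assoc, ih,
      Finset.sum_ite_eq' Finset.univ k]
    simp [inc]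

/-- The truncated coordinate is `1` for elements to the left of `y` and `0` for those to the right,
and the bubble `t(1 - t)` vanishes at both values. The increments telescope to the left nodal value,
and only the element containing `y` contributes more. -/
theorem interp_eq_quad (P : T.Idx → E) {i : Fin T.M} {y : ℝ}
    (hy : y ∈ Icc (T.x i.castSucc) (T.x i.succ)) : T.interp P y = T.quad P i y := by
  have hl := T.len_pos i
  have c0 : ∀ j, i < j → T.coord j y = 0 := fun j hj => by
    have h1 : T.x i.succ ≤ T.x j.castSucc := T.strictMono.monotone (Fin.succ_le_castSucc_iff.2 hj)
    have : (T.len j)⁻¹ * (y - T.x j.castSucc) ≤ 0 :=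
      mul_nonpos_of_nonneg_of_nonpos (inv_nonneg.2 (T.len_pos j).le) (by linarith [hy.2])
    rw [coord, max_eq_left ((min_le_right _ _).trans this)]
  have c1 : ∀ j, j < i → T.coord j y = 1 := fun j hj => by
    have h1 : T.x j.succ ≤ T.x i.castSucc := T.strictMono.monotone (Fin.succ_le_castSucc_iff.2 hj)
    have : 1 ≤ (T.len j)⁻¹ * (y - T.x j.castSucc) := by
      rw [inv_mul_eq_div, le_div_iff₀ (T.len_pos j), one_mul, len]
      linarith [hy.1]
    rw [coord, min_eq_left this, max_eq_right zero_le_one]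
  have c2 : T.coord i y = (T.len i)⁻¹ * (y - T.x i.castSucc) := by
    rw [coord, min_eq_right, max_eq_right]
    · exact mul_nonneg (inv_nonneg.2 hl.le) (by linarith [hy.1])
    · rw [inv_mul_eq_div, div_le_one hl, len]; linarith [hy.2]
  have key : ∀ j, T.coord j y • T.inc P j - (2 * (T.coord j y * (1 - T.coord j y))) • T.sdiff2 P j
      = (if j.castSucc < i.castSucc then T.inc P j else 0) + (if j = i then
        (T.coord j y • T.inc P j - (2 * (T.coord j y * (1 - T.coord j y))) • T.sdiff2 P j) else 0) := by
    intro j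
    rcases lt_trichotomy j i with h | h | h
    · simp [c1 j h, h, h.ne]
    · simp [h]
    · simp [c0 j h, h.not_gt, h.ne']
  rw [interp, Finset.sum_congr rfl fun j _ => key j, Finset.sum_add_distrib, ← add_assoc,
    sum_inc, Finset.sum_ite_eq' Finset.univ i, if_pos (Finset.mem_univ _), c2, quad]
  module

theorem quad_left (P : T.Idx → E) (i : Fin T.M) :
    T.quad P i (T.x i.castSucc) = P (.inl i.castSucc) := by
  simp [quad]

theorem quad_right (P : T.Idx → E) (i : Fin T.M) :
    T.quad P i (T.x i.succ) = P (.inl i.succ) := by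
  have : (T.len i)⁻¹ * (T.x i.succ - T.x i.castSucc) = 1 := by
    rw [x_succ, add_sub_cancel_left, inv_mul_cancel₀ (T.len_pos i).ne']
  rw [quad, this, inc]
  module

theorem quad_mid (P : T.Idx → E) (i : Fin T.M) : T.quad P i (T.mid i) = P (.inr i) := by
  have : (T.len i)⁻¹ * (T.mid i - T.x i.castSucc) = 1 / 2 := by
    have := (T.len_pos i).ne'
    rw [mid_eq, add_sub_cancel_left]; field_simp
  rw [quad, this, inc, sdiff2]
  module

theorem interp_node (hab : a < b) (P : T.Idx → E) (z : T.Idx) : T.interp P (T.node z) = P z := by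
  rcases z with j | i
  · show T.interp P (T.x j) = _
    rcases Fin.eq_castSucc_or_eq_last j with ⟨i, rfl⟩ | h
    · rw [T.interp_eq_quad P (left_mem_Icc.2 (T.x_lt i).le), quad_left]
    · rcases Fin.eq_zero_or_eq_succ j with h0 | ⟨i, rfl⟩
      · exfalso
        have e1 := T.left
        have e2 := T.right
        rw [← h, h0, e1] at e2
        exact hab.ne e2
      · rw [T.interp_eq_quad P (right_mem_Icc.2 (T.x_lt i).le), quad_right]
  · show T.interp P (T.mid i) = _
    rw [T.interp_eq_quad P (Ioo_subset_Icc_self (T.mid_mem i)), quad_mid]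

theorem hasDerivAt_quad (P : T.Idx → E) (i : Fin T.M) (y : ℝ) :
    HasDerivAt (T.quad P i) (T.quadDeriv P i y) y := by
  have h1 : HasDerivAt (fun y => (T.len i)⁻¹ * (y - T.x i.castSucc)) (T.len i)⁻¹ y := by
    simpa using ((hasDerivAt_id y).sub_const (T.x i.castSucc)).const_mul (T.len i)⁻¹
  exact (((h1.smul_const _).const_add _).add (((h1.pow 2).const_mul 2).smul_const _)).congr_deriv
    (by rw [quadDeriv]; simp only [Nat.cast_ofNat, Nat.add_one_sub_one, pow_one]; module)

theorem hasDerivAt_interp (P : T.Idx → E) {i : Fin T.M} {y : ℝ}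
    (hy : y ∈ Ioo (T.x i.castSucc) (T.x i.succ)) :
    HasDerivAt (T.interp P) (T.quadDeriv P i y) y := by
  refine (T.hasDerivAt_quad P i y).congr_of_eventuallyEq ?_
  filter_upwards [Icc_mem_nhds hy.1 hy.2] with z hz using T.interp_eq_quad P hz

theorem continuous_quadDeriv (P : T.Idx → E) (i : Fin T.M) : Continuous (T.quadDeriv P i) := by
  unfold quadDeriv; fun_prop

theorem piecewiseC1_interp (hab : a < b) (P : T.Idx → E) : PiecewiseC1 a b (T.interp P) := by
  refine ⟨(T.continuous_interp P).continuousOn, range T.x, (finite_range _).countable,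
    fun y hy => ?_, ?_⟩
  · obtain ⟨i, hi⟩ := T.exists_mem_Ioo hab hy
    exact (T.hasDerivAt_interp P hi).differentiableAt
  · have : ∀ i, ∃ C, ∀ y ∈ Icc a b, ‖T.quadDeriv P i y‖ ≤ C := fun i =>
      isCompact_Icc.exists_bound_of_continuousOn (T.continuous_quadDeriv P i).continuousOn
    choose C hC using this
    refine ⟨∑ i, |C i|, fun y hy => ?_⟩
    obtain ⟨i, hi⟩ := T.exists_mem_Ioo hab hy
    rw [(T.hasDerivAt_interp P hi).deriv]
    refine (hC i y (Ioo_subset_Icc_self hy.1)).trans ((le_abs_self _).trans ?_)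
    exact Finset.single_le_sum (f := fun i => |C i|) (fun i _ => abs_nonneg _) (Finset.mem_univ i)

/-- Functions of `S^{2,0}` are determined by their nodal values. -/
theorem eqOn_interp {p : ℝ → E} (hab : a < b) (hp : p ∈ T.S 2 0) :
    EqOn p (T.interp fun z => p (T.node z)) (Icc a b) := by
  intro y hy
  obtain ⟨i, hi⟩ := T.exists_mem_Icc hab hy
  obtain ⟨c, hc⟩ := hp.2 i
  have hl := (T.len_pos i).ne'
  rw [T.interp_eq_quad _ hi, quad, inc, sdiff2]
  simp only [node, Sum.elim_inl, Sum.elim_inr]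
  rw [hc _ hi, hc _ (left_mem_Icc.2 (T.x_lt i).le), hc _ (right_mem_Icc.2 (T.x_lt i).le),
    hc _ (Ioo_subset_Icc_self (T.mid_mem i)), mid_eq, x_succ]
  obtain ⟨t, ht⟩ : ∃ t, y = T.x i.castSucc + T.len i * t :=
    ⟨(T.len i)⁻¹ * (y - T.x i.castSucc), by field_simp; ring⟩
  have ht' : (T.len i)⁻¹ * (T.x i.castSucc + T.len i * t - T.x i.castSucc) = t := by
    field_simp; ring
  rw [ht, ht']
  have h3 : ∀ y : ℝ, ∑ j : Fin (2 + 1), y ^ (j : ℕ) • c j = c 0 + y • c 1 + y ^ 2 • c 2 := fun y => by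
    rw [show ∑ j : Fin (2 + 1), y ^ (j : ℕ) • c j = ∑ j : Fin 3, y ^ (j : ℕ) • c j from rfl,
      Fin.sum_univ_three]
    simp
  simp only [h3]
  module

theorem sum_cubic (k l : ℝ) (c₀ c₁ c₂ c₃ : E) :
    ∃ c : Fin 4 → E, ∀ y : ℝ, c₀ + (k * (y - l)) • c₁ + (k * (y - l)) ^ 2 • c₂
      + (k * (y - l)) ^ 3 • c₃ = ∑ j : Fin 4, y ^ (j : ℕ) • c j := by
  refine ⟨![c₀ - (k * l) • c₁ + (k * l) ^ 2 • c₂ - (k * l) ^ 3 • c₃,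
    k • c₁ - (2 * k ^ 2 * l) • c₂ + (3 * k ^ 3 * l ^ 2) • c₃,
    k ^ 2 • c₂ - (3 * k ^ 3 * l) • c₃, k ^ 3 • c₃], fun y => ?_⟩
  simp only [Fin.sum_univ_four]
  simp
  module

theorem sum_quadratic (k l : ℝ) (c₀ c₁ c₂ : E) :
    ∃ c : Fin 3 → E, ∀ y : ℝ, c₀ + (k * (y - l)) • c₁ + (2 * (k * (y - l)) ^ 2) • c₂
      = ∑ j : Fin 3, y ^ (j : ℕ) • c j := by
  refine ⟨![c₀ - (k * l) • c₁ + (2 * (k * l) ^ 2) • c₂, k • c₁ - (4 * k ^ 2 * l) • c₂,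
    (2 * k ^ 2) • c₂], fun y => ?_⟩
  simp only [Fin.sum_univ_three]
  simp
  module

theorem interp_mem_S (P : T.Idx → E) : T.interp P ∈ T.S 2 0 := by
  refine ⟨?_, fun i => ?_⟩
  · simpa using (T.continuous_interp P).continuousOn
  · obtain ⟨c, hc⟩ := sum_quadratic (T.len i)⁻¹ (T.x i.castSucc) (P (.inl i.castSucc))
      (T.inc P i - (2 : ℝ) • T.sdiff2 P i) (T.sdiff2 P i)
    exact ⟨c, fun y hy => (T.interp_eq_quad P hy).trans (hc y)⟩

variable [CompleteSpace E]

/-- The integral over an element of a cubic in the affine coordinate. -/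
theorem integral_cubic (i : Fin T.M) {f : ℝ → E} {c₀ c₁ c₂ c₃ : E}
    (hf : ∀ y ∈ Ioo (T.x i.castSucc) (T.x i.succ), f y = c₀
      + ((T.len i)⁻¹ * (y - T.x i.castSucc)) • c₁ + ((T.len i)⁻¹ * (y - T.x i.castSucc)) ^ 2 • c₂
      + ((T.len i)⁻¹ * (y - T.x i.castSucc)) ^ 3 • c₃) {r : ℝ}
    (hr : r ∈ Icc (T.x i.castSucc) (T.x i.succ)) :
    ∫ y in T.x i.castSucc..r, f y =
      T.len i • (((T.len i)⁻¹ * (r - T.x i.castSucc)) • c₀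
        + (((T.len i)⁻¹ * (r - T.x i.castSucc)) ^ 2 / 2) • c₁
        + (((T.len i)⁻¹ * (r - T.x i.castSucc)) ^ 3 / 3) • c₂
        + (((T.len i)⁻¹ * (r - T.x i.castSucc)) ^ 4 / 4) • c₃) := by
  have hl := (T.len_pos i).ne'
  set k := (T.len i)⁻¹ with hk
  set l := T.x i.castSucc
  have hkl : T.len i * k = 1 := mul_inv_cancel₀ hl
  have h1 : ∀ y : ℝ, HasDerivAt (fun y => k * (y - l)) k y := fun y => by
    simpa using ((hasDerivAt_id y).sub_const l).const_mul k
  have h2 : ∀ y, HasDerivAt (fun y => T.len i • ((k * (y - l)) • c₀ + ((k * (y - l)) ^ 2 / 2) • c₁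
      + ((k * (y - l)) ^ 3 / 3) • c₂ + ((k * (y - l)) ^ 4 / 4) • c₃))
      (c₀ + (k * (y - l)) • c₁ + (k * (y - l)) ^ 2 • c₂ + (k * (y - l)) ^ 3 • c₃) y := by
    intro y
    refine ((((((h1 y).smul_const c₀).add ((((h1 y).pow 2).div_const 2).smul_const c₁)).add
      ((((h1 y).pow 3).div_const 3).smul_const c₂)).add
      ((((h1 y).pow 4).div_const 4).smul_const c₃)).const_smul (T.len i)).congr_deriv ?_
    trans (T.len i * k) • (c₀ + (k * (y - l)) • c₁ + (k * (y - l)) ^ 2 • c₂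
      + (k * (y - l)) ^ 3 • c₃)
    · simp only [Nat.cast_ofNat, Nat.add_one_sub_one, pow_one]
      module
    · rw [hkl, one_smul]
  have h3 : ∫ y in l..r, f y = ∫ y in l..r, (c₀ + (k * (y - l)) • c₁ + (k * (y - l)) ^ 2 • c₂
      + (k * (y - l)) ^ 3 • c₃) := by
    refine integral_congr_ae_Ioo hr.1 ((ae_restrict_iff' measurableSet_Ioo).2
      (Filter.Eventually.of_forall fun y hy => hf y ⟨hy.1, hy.2.trans_le hr.2⟩))
  rw [h3, intervalIntegral.integral_eq_sub_of_hasDerivAt (fun y _ => h2 y)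
    (Continuous.intervalIntegrable (by fun_prop) _ _)]
  simp

/-- Simpson's rule on an element. -/
def simpsonElem (i : Fin T.M) (g : T.Idx → E) : E :=
  (T.len i / 6) • (g (.inl i.castSucc) + (4 : ℝ) • g (.inr i) + g (.inl i.succ))

/-- Simpson's rule integrates cubics exactly, one degree beyond the quadratic interpolation behind
it. This extra degree lets a quadratic error be multiplied by a first order Taylor polynomial at no
cost. -/
theorem integral_eq_simpsonElem (i : Fin T.M) {f : ℝ → E} {c₀ c₁ c₂ c₃ : E}
    (hf : ∀ y ∈ Icc (T.x i.castSucc) (T.x i.succ), f y = c₀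
      + ((T.len i)⁻¹ * (y - T.x i.castSucc)) • c₁ + ((T.len i)⁻¹ * (y - T.x i.castSucc)) ^ 2 • c₂
      + ((T.len i)⁻¹ * (y - T.x i.castSucc)) ^ 3 • c₃) :
    ∫ y in T.x i.castSucc..T.x i.succ, f y = T.simpsonElem i fun z => f (T.node z) := by
  have hl := (T.len_pos i).ne'
  rw [T.integral_cubic i (fun y hy => hf y (Ioo_subset_Icc_self hy))
    (right_mem_Icc.2 (T.x_lt i).le), simpsonElem]
  simp only [node, Sum.elim_inl, Sum.elim_inr]
  rw [hf _ (left_mem_Icc.2 (T.x_lt i).le), hf _ (right_mem_Icc.2 (T.x_lt i).le),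
    hf _ (Ioo_subset_Icc_self (T.mid_mem i)), mid_eq, x_succ, add_sub_cancel_left,
    add_sub_cancel_left, sub_self, inv_mul_cancel₀ hl,
    show (T.len i)⁻¹ * (T.len i / 2) = 1 / 2 by field_simp]
  module

theorem integral_quad (P : T.Idx → E) (i : Fin T.M) :
    ∫ y in T.x i.castSucc..T.x i.succ, T.interp P y = T.simpsonElem i P := by
  have hl := (T.len_pos i).ne'
  rw [T.integral_cubic i (c₀ := P (.inl i.castSucc)) (c₁ := T.inc P i - (2 : ℝ) • T.sdiff2 P i)
    (c₂ := (2 : ℝ) • T.sdiff2 P i) (c₃ := 0) (fun y hy => ?_) (right_mem_Icc.2 (T.x_lt i).le),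
    simpsonElem, x_succ, add_sub_cancel_left, inv_mul_cancel₀ hl, inc, sdiff2]
  · module
  · rw [T.interp_eq_quad P (Ioo_subset_Icc_self hy), quad]
    module

/-- The composite Simpson rule. -/
def simpson (g : T.Idx → E) : E := ∑ i, T.simpsonElem i g

theorem integral_interp (hab : a < b) (P : T.Idx → E) :
    ∫ y in a..b, T.interp P y = T.simpson P := by
  rw [← T.sum_integral hab.le ((T.continuous_interp P).intervalIntegrable _ _), simpson]
  exact Finset.sum_congr rfl fun i _ => T.integral_quad P i

/-- The Dirichlet form in terms of nodal values. -/
def energy (P R : T.Idx → E) : ℝ :=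
  ∑ i, (T.len i)⁻¹ * (⟪T.inc P i, T.inc R i⟫ + 4 / 3 * ⟪T.sdiff2 P i, T.sdiff2 R i⟫)

/-- In the coordinate `t` of an element the derivative is `h_i⁻¹ (inc + (4t - 2) sdiff2)`. The
factor `4t - 2` has mean zero and mean square `4/3`. -/
theorem integral_inner_deriv_interp (hab : a < b) (P R : T.Idx → E) :
    ∫ y in a..b, ⟪deriv (T.interp P) y, deriv (T.interp R) y⟫ = T.energy P R := by
  rw [← T.sum_integral hab.le ((T.piecewiseC1_interp hab P).memL2_deriv.integrable_inner hab.le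
    (T.piecewiseC1_interp hab R).memL2_deriv), energy]
  refine Finset.sum_congr rfl fun i _ => ?_
  have hl := (T.len_pos i).ne'
  set A := T.inc P i - (2 : ℝ) • T.sdiff2 P i with hA
  set B := T.inc R i - (2 : ℝ) • T.sdiff2 R i with hB
  rw [T.integral_cubic i (c₀ := ((T.len i)⁻¹) ^ 2 * ⟪A, B⟫)
    (c₁ := ((T.len i)⁻¹) ^ 2 * (4 * (⟪A, T.sdiff2 R i⟫ + ⟪T.sdiff2 P i, B⟫)))
    (c₂ := ((T.len i)⁻¹) ^ 2 * (16 * ⟪T.sdiff2 P i, T.sdiff2 R i⟫)) (c₃ := 0) (fun y hy => ?_)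
    (right_mem_Icc.2 (T.x_lt i).le), x_succ, add_sub_cancel_left, inv_mul_cancel₀ hl]
  · simp only [hA, hB, inner_sub_left, inner_sub_right, inner_smul_left, inner_smul_right,
      smul_eq_mul, conj_trivial]
    field_simp
    ring
  · rw [(T.hasDerivAt_interp P hy).deriv, (T.hasDerivAt_interp R hy).deriv, quadDeriv, quadDeriv,
      ← hA, ← hB]
    simp only [inner_add_left, inner_add_right, inner_smul_left, inner_smul_right, smul_eq_mul,
      conj_trivial]
    ring

theorem energy_self_eq (hab : a < b) (P : T.Idx → E) :
    ∫ y in a..b, ‖deriv (T.interp P) y‖ ^ 2 = T.energy P P := by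
  rw [← T.integral_inner_deriv_interp hab]
  simp only [real_inner_self_eq_norm_sq]

end Interpolation

end Mesh

/-! ### Cubic splines, their derivatives and the discrete functional. -/

namespace Mesh

section Splines

variable {a b : ℝ} (T : Mesh a b) {E : Type*} [NormedAddCommGroup E] [InnerProductSpace ℝ E]
  [CompleteSpace E]

theorem node_mem (z : T.Idx) : T.node z ∈ Icc a b := by
  rcases z with j | i
  · exact T.x_mem j
  · exact T.Icc_subset i (Ioo_subset_Icc_self (T.mid_mem i))

theorem S_sub {k l : ℕ} {v w : ℝ → E} (hv : v ∈ T.S k l) (hw : w ∈ T.S k l) : v - w ∈ T.S k l := by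
  refine ⟨hv.1.sub hw.1, fun i => ?_⟩
  obtain ⟨c, hc⟩ := hv.2 i
  obtain ⟨c', hc'⟩ := hw.2 i
  refine ⟨c - c', fun y hy => ?_⟩
  simp only [Pi.sub_apply, hc y hy, hc' y hy, smul_sub, Finset.sum_sub_distrib]

theorem primitive_mem_S (P : T.Idx → E) {v : ℝ → E}
    (hv : ∀ y ∈ Icc a b, v y = v a + ∫ s in a..y, T.interp P s) : v ∈ T.S 3 1 := by
  have hc := T.continuous_interp P
  refine ⟨?_, fun i => ?_⟩
  · have hd : deriv (fun y => v a + ∫ s in a..y, T.interp P s) = T.interp P := by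
      funext y
      exact ((hc.integral_hasStrictDerivAt a y).hasDerivAt.const_add _).deriv
    have : ContDiff ℝ 1 (fun y => v a + ∫ s in a..y, T.interp P s) := by
      rw [contDiff_one_iff_deriv, hd]
      exact ⟨fun y => ((hc.integral_hasStrictDerivAt a y).hasDerivAt.const_add _).differentiableAt,
        hc⟩
    simpa using this.contDiffOn.congr hv
  · set l := T.x i.castSucc
    obtain ⟨c, hc'⟩ := sum_cubic (T.len i)⁻¹ l (v l) (T.len i • P (.inl i.castSucc))
      ((T.len i / 2) • (T.inc P i - (2 : ℝ) • T.sdiff2 P i)) ((T.len i * (2 / 3)) • T.sdiff2 P i)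
    refine ⟨c, fun y hy => ?_⟩
    rw [← hc' y]
    have h1 : v y = v l + ∫ s in l..y, T.interp P s := by
      rw [hv y (T.Icc_subset i hy), hv l (T.x_mem _), add_assoc,
        intervalIntegral.integral_add_adjacent_intervals (hc.intervalIntegrable _ _)
        (hc.intervalIntegrable _ _)]
    rw [h1, T.integral_cubic i (c₀ := P (.inl i.castSucc))
      (c₁ := T.inc P i - (2 : ℝ) • T.sdiff2 P i) (c₂ := (2 : ℝ) • T.sdiff2 P i) (c₃ := 0)
      (fun s hs => ?_) hy]
    · module
    · rw [T.interp_eq_quad P (Ioo_subset_Icc_self hs), quad]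
      module

/-- Inside an element the derivative of the cubic is an explicit quadratic; continuity of the
derivative extends the formula to the closed element. -/
theorem hasWeakDeriv_of_mem_S {v : ℝ → E} (hab : a < b) (hv : v ∈ T.S 3 1) :
    ∃ w ∈ T.S 2 0, ContinuousOn w (Icc a b) ∧ HasWeakDeriv a b v w := by
  have hv1 : ContDiffOn ℝ 1 v (Icc a b) := by simpa using hv.1
  set w := derivWithin v (Icc a b)
  have hw : ContinuousOn w (Icc a b) :=
    hv1.continuousOn_derivWithin (uniqueDiffOn_Icc hab) le_rfl
  have hd : ∀ y ∈ Ioo a b, HasDerivAt v (w y) y := fun y hy =>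
    (((hv1.differentiableOn (by simp)) y (Ioo_subset_Icc_self hy)).hasDerivWithinAt).hasDerivAt
      (Icc_mem_nhds hy.1 hy.2)
  have hp := piecewiseC1_of_hasDerivAt hv1.continuousOn hw hd
  refine ⟨w, ⟨by simpa using hw, fun i => ?_⟩, hw, (hp.hasWeakDeriv hab).congr hab.le (by rfl)
    ((ae_restrict_iff' measurableSet_Ioo).2 (Filter.Eventually.of_forall fun y hy =>
      (hd y hy).deriv))⟩
  obtain ⟨c, hc⟩ := hv.2 i
  refine ⟨![c 1, (2 : ℝ) • c 2, (3 : ℝ) • c 3], fun y hy => ?_⟩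
  have h4 : ∀ y : ℝ, ∑ j : Fin (3 + 1), y ^ (j : ℕ) • c j
      = c 0 + y • c 1 + y ^ 2 • c 2 + y ^ 3 • c 3 := fun y => by
    rw [show ∑ j : Fin (3 + 1), y ^ (j : ℕ) • c j = ∑ j : Fin 4, y ^ (j : ℕ) • c j from rfl,
      Fin.sum_univ_four]
    simp
  have h3 : ∀ y : ℝ, ∑ j : Fin (2 + 1), y ^ (j : ℕ) • (![c 1, (2 : ℝ) • c 2, (3 : ℝ) • c 3] j : E)
      = c 1 + (2 * y) • c 2 + (3 * y ^ 2) • c 3 := fun y => by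
    rw [show ∑ j : Fin (2 + 1), y ^ (j : ℕ) • (![c 1, (2 : ℝ) • c 2, (3 : ℝ) • c 3] j : E)
      = ∑ j : Fin 3, y ^ (j : ℕ) • (![c 1, (2 : ℝ) • c 2, (3 : ℝ) • c 3] j : E) from rfl,
      Fin.sum_univ_three]
    simp
    module
  rw [h3]
  have hO : EqOn w (fun y => c 1 + (2 * y) • c 2 + (3 * y ^ 2) • c 3)
      (Ioo (T.x i.castSucc) (T.x i.succ)) := by
    intro y hy
    have e1 : HasDerivAt (fun y : ℝ => c 0 + y • c 1 + y ^ 2 • c 2 + y ^ 3 • c 3)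
        (c 1 + (2 * y) • c 2 + (3 * y ^ 2) • c 3) y := by
      refine (((((hasDerivAt_id y).smul_const (c 1)).const_add (c 0)).add
        (((hasDerivAt_id y).pow 2).smul_const (c 2))).add
        (((hasDerivAt_id y).pow 3).smul_const (c 3))).congr_deriv ?_
      simp only [Nat.cast_ofNat, Nat.add_one_sub_one, pow_one, id, mul_one, one_smul]
    refine (hd y (T.Ioo_subset i hy)).unique (e1.congr_of_eventuallyEq ?_)
    filter_upwards [Icc_mem_nhds hy.1 hy.2] with s hs
    rw [hc s hs, h4]
  exact hO.of_subset_closure (hw.mono (T.Icc_subset i))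
    (Continuous.continuousOn (by fun_prop)) Ioo_subset_Icc_self (closure_Ioo (T.x_lt i).ne).ge hy

/-- The first two derivatives of a function in `S^{3,1}`. -/
theorem mem_S_spec {v : ℝ → E} (hab : a < b) (hv : v ∈ T.S 3 1) :
    v ∈ H a b 2 ∧ HasWeakDeriv a b v (T.interp fun z => D a b v (T.node z)) ∧
      EqOn (D a b v) (T.interp fun z => D a b v (T.node z)) (Icc a b) ∧
      D a b (D a b v) =ᵐ[volume.restrict (Ioo a b)]
        deriv (T.interp fun z => D a b v (T.node z)) := by
  obtain ⟨w, hwS, hwc, hvw⟩ := T.hasWeakDeriv_of_mem_S hab hv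
  have hvc : ContinuousOn v (Icc a b) := hv.1.continuousOn
  have h1 := D_eqOn hab hvw hwc
  have h2 : EqOn w (T.interp fun z => D a b v (T.node z)) (Icc a b) := by
    have : (fun z => D a b v (T.node z)) = fun z => w (T.node z) :=
      funext fun z => h1 (T.node_mem z)
    rw [this]
    exact T.eqOn_interp hab hwS
  set R := fun z => D a b v (T.node z)
  have h3 := (T.piecewiseC1_interp hab R).hasWeakDeriv hab
  have h4 : HasWeakDeriv a b v (T.interp R) := hvw.congr hab.le (by rfl) (ae_Ioo_of_eqOn h2)
  have h5 := (T.continuous_interp R).continuousOn (s := Icc a b)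
  exact ⟨mem_H_two hvc h4 h3, h4, D_eqOn hab h4 h5, DD_ae_eq hab h5 h4 h3⟩

/-- The integral of the quadratic over an element is its Simpson value, so prescribing the latter
prescribes the nodal increments of the primitive. -/
theorem primitive_node (P : T.Idx → E) {v u : ℝ → E} (h0 : v a = u a)
    (hv : ∀ y ∈ Icc a b, v y = v a + ∫ s in a..y, T.interp P s)
    (hP : ∀ i, T.simpsonElem i P = u (T.x i.succ) - u (T.x i.castSucc)) (j : Fin (T.M + 1)) :
    v (T.x j) = u (T.x j) := by
  have hc := T.continuous_interp P
  induction j using Fin.induction with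
  | zero => exact (congrArg v T.left).trans (h0.trans (congrArg u T.left).symm)
  | succ i ih =>
    rw [hv _ (T.x_mem _), ← intervalIntegral.integral_add_adjacent_intervals
      (hc.intervalIntegrable a (T.x i.castSucc)) (hc.intervalIntegrable _ _), ← add_assoc,
      ← hv _ (T.x_mem _), ih, T.integral_quad, hP]
    abel

theorem I3_spec {v : ℝ → E} (hab : a < b) :
    T.I3 v ∈ T.S 3 1 ∧ ∀ z ∈ T.nodes1, T.I3 v z = v z ∧ D a b (T.I3 v) z = D a b v z := by
  have hex : ∃ p ∈ T.S 3 1, ∀ z ∈ T.nodes1, p z = v z ∧ D a b p z = D a b v z := by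
    -- The nodal slopes are prescribed; the midpoint slope `m` is the solution of `(h_i / 6)(v'_l +
    -- 4m + v'_r) = v_r - v_l`, with `l` and `r` the ends of the element.
    let R : T.Idx → E := Sum.elim (fun j => D a b v (T.x j)) (fun i =>
      (4⁻¹ : ℝ) • ((6 * (T.len i)⁻¹) • (v (T.x i.succ) - v (T.x i.castSucc))
        - D a b v (T.x i.castSucc) - D a b v (T.x i.succ)))
    have hR : ∀ i, T.simpsonElem i R = v (T.x i.succ) - v (T.x i.castSucc) := fun i => by
      have hl := (T.len_pos i).ne'
      simp only [simpsonElem, R, Sum.elim_inl, Sum.elim_inr]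
      trans (T.len i * (T.len i)⁻¹) • (v (T.x i.succ) - v (T.x i.castSucc))
      · module
      · rw [mul_inv_cancel₀ hl, one_smul]
    let p : ℝ → E := fun y => v a + ∫ s in a..y, T.interp R s
    have hp : ∀ y ∈ Icc a b, p y = p a + ∫ s in a..y, T.interp R s := fun y _ => by simp [p]
    refine ⟨p, T.primitive_mem_S R hp, ?_⟩
    rintro _ ⟨j, rfl⟩
    refine ⟨T.primitive_node R (by simp [p]) hp hR j, ?_⟩
    have hc := (T.continuous_interp R).continuousOn (s := Icc a b)
    have h := hasWeakDeriv_of_eq_integral hab (memL2_of_continuousOn hc) hp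
    rw [D_eqOn hab h hc (T.x_mem j)]
    exact T.interp_node hab R (.inl j)
  rw [I3, dif_pos hex]
  exact hex.choose_spec

theorem node_mem_nodes2 (z : T.Idx) : T.node z ∈ T.nodes2 := by
  rcases z with j | i
  · exact Or.inl ⟨j, rfl⟩
  · exact Or.inr ⟨i, rfl⟩

/-- The integral of the nodal interpolant is Simpson's rule. -/
theorem integral_I2 (hab : a < b) (w : ℝ → ℝ) :
    ∫ y in a..b, T.I2 w y = T.simpson fun z => w (T.node z) := by
  have hex : ∃ p ∈ T.S 2 0, ∀ z ∈ T.nodes2, p z = w z := by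
    refine ⟨T.interp fun z => w (T.node z), T.interp_mem_S _, ?_⟩
    rintro _ (⟨j, rfl⟩ | ⟨i, rfl⟩)
    · exact T.interp_node hab (fun z => w (T.node z)) (.inl j)
    · exact T.interp_node hab (fun z => w (T.node z)) (.inr i)
  rw [I2, dif_pos hex]
  obtain ⟨h1, h2⟩ := hex.choose_spec
  set p := hex.choose
  have h3 : (fun z => w (T.node z)) = fun z => p (T.node z) :=
    funext fun z => (h2 _ (T.node_mem_nodes2 z)).symm
  rw [h3, ← T.integral_interp hab]
  exact integral_congr_ae_Ioo hab.le (ae_Ioo_of_eqOn (T.eqOn_interp hab h1))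

/-- The discrete functional in terms of nodal values. -/
theorem Fh_eq {d : ℕ} (hab : a < b) {u v : ℝ → Vec d} (lam μ : ℝ → ℝ) (hu : u ∈ T.S 3 1)
    (hv : v ∈ T.S 3 1) :
    T.Fh u lam v μ = T.energy (fun z => D a b u (T.node z)) (fun z => D a b v (T.node z))
      + T.simpson (fun z => lam (T.node z) * ⟪D a b u (T.node z), D a b v (T.node z)⟫)
      + (1 / 2) * T.simpson (fun z => μ (T.node z) * (‖D a b u (T.node z)‖ ^ 2 - 1)) := by
  obtain ⟨-, -, -, h1⟩ := T.mem_S_spec hab hu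
  obtain ⟨-, -, -, h2⟩ := T.mem_S_spec hab hv
  rw [Fh, T.integral_I2 hab, T.integral_I2 hab, ← T.integral_inner_deriv_interp hab]
  congr 2
  refine integral_congr_ae_Ioo hab.le ?_
  filter_upwards [h1, h2] with y h1 h2
  rw [h1, h2]

end Splines

end Mesh

/-! ### Minimising a quadratic form over a product of spheres. -/

section Minimisation

variable {Z E : Type*} [Fintype Z] [DecidableEq Z] [NormedAddCommGroup E] [InnerProductSpace ℝ E]

/-- First order condition for a local minimiser of a quadratic form among nodal values on the
sphere. -/
theorem form_eq_zero_of_isLocalMin (B : (Z → E) →ₗ[ℝ] (Z → E) →ₗ[ℝ] ℝ)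
    (hsymm : ∀ P R, B P R = B R P) {P : Z → E} {z : Z} {w : E}
    (hmin : IsLocalMin (fun t : ℝ => B
      (P + Pi.single z ((Real.cos t - 1) • P z + Real.sin t • w))
      (P + Pi.single z ((Real.cos t - 1) • P z + Real.sin t • w))) 0) :
    B P (Pi.single z w) = 0 := by
  have hexp : ∀ t : ℝ, B (P + Pi.single z ((Real.cos t - 1) • P z + Real.sin t • w))
      (P + Pi.single z ((Real.cos t - 1) • P z + Real.sin t • w))
      = B P P + 2 * ((Real.cos t - 1) * B P (Pi.single z (P z)) + Real.sin t * B P (Pi.single z w))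
        + ((Real.cos t - 1) ^ 2 * B (Pi.single z (P z)) (Pi.single z (P z))
        + 2 * ((Real.cos t - 1) * Real.sin t) * B (Pi.single z (P z)) (Pi.single z w)
        + Real.sin t ^ 2 * B (Pi.single z w) (Pi.single z w)) := by
    intro t
    rw [Pi.single_add, Pi.single_smul, Pi.single_smul]
    simp only [map_add, map_smul, LinearMap.add_apply, LinearMap.smul_apply, smul_eq_mul]
    rw [hsymm (Pi.single z (P z)) P, hsymm (Pi.single z w) P,
      hsymm (Pi.single z w) (Pi.single z (P z))]
    ring
  simp only [hexp] at hmin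
  -- Since `cos t - 1` vanishes to second order, only the term `2 sin t · B(P, w)` contributes to
  -- the derivative at `0`.
  have h1 : HasDerivAt (fun t => Real.cos t - 1) 0 (0 : ℝ) := by
    simpa using (Real.hasDerivAt_cos 0).sub_const 1
  have h2 : HasDerivAt Real.sin 1 (0 : ℝ) := by simpa using Real.hasDerivAt_sin 0
  have hd := ((((h1.mul_const (B P (Pi.single z (P z)))).add
    (h2.mul_const (B P (Pi.single z w)))).const_mul 2).const_add (B P P)).add
    ((((h1.pow 2).mul_const (B (Pi.single z (P z)) (Pi.single z (P z)))).add
    (((h1.mul h2).const_mul 2).mul_const (B (Pi.single z (P z)) (Pi.single z w)))).add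
    ((h2.pow 2).mul_const (B (Pi.single z w) (Pi.single z w))))
  have := hmin.hasDerivAt_eq_zero hd
  simpa using this

/-- Existence of a constrained critical point close to `P₀`, given an a priori bound. -/
theorem exists_constrained_critical [FiniteDimensional ℝ E] (B : (Z → E) →ₗ[ℝ] (Z → E) →ₗ[ℝ] ℝ)
    (hsymm : ∀ P R, B P R = B R P) (hcont : Continuous fun P => B P P) (S : Set Z) {P₀ : Z → E}
    (h₀ : ∀ z, ‖P₀ z‖ = 1) {ρ η : ℝ} (hρ : 0 ≤ ρ) (hη : η < ρ)
    (apriori : ∀ P : Z → E, (∀ z, ‖P z‖ = 1) → (∀ z ∈ S, P z = P₀ z) →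
      B (P - P₀) (P - P₀) ≤ ρ → B P P ≤ B P₀ P₀ → B (P - P₀) (P - P₀) ≤ η) :
    ∃ P : Z → E, (∀ z, ‖P z‖ = 1) ∧ (∀ z ∈ S, P z = P₀ z) ∧ B (P - P₀) (P - P₀) ≤ η ∧
      ∀ z ∉ S, ∀ w, ⟪P z, w⟫ = 0 → B P (Pi.single z w) = 0 := by
  have : ProperSpace E := FiniteDimensional.proper ℝ E
  have hcont' : Continuous fun P => B (P - P₀) (P - P₀) := hcont.comp (continuous_id.sub continuous_const)
  let K : Set (Z → E) := {P | (∀ z, ‖P z‖ = 1) ∧ (∀ z ∈ S, P z = P₀ z) ∧ B (P - P₀) (P - P₀) ≤ ρ}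
  have hK : IsCompact K := by
    refine Metric.isCompact_of_isClosed_isBounded ?_ ?_
    · have e : K = (⋂ z, {P | ‖P z‖ = 1}) ∩ ((⋂ z ∈ S, {P | P z = P₀ z})
          ∩ {P | B (P - P₀) (P - P₀) ≤ ρ}) := by
        ext P
        simp [K]
      rw [e]
      exact (isClosed_iInter fun z =>
          isClosed_eq (continuous_norm.comp (continuous_apply z)) continuous_const).inter
        ((isClosed_iInter fun z => isClosed_iInter fun _ =>
          isClosed_eq (continuous_apply z) continuous_const).inter
        (isClosed_le hcont' continuous_const))
    · refine (Metric.isBounded_closedBall (x := (0 : Z → E)) (r := 1)).subset fun P hP => ?_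
      rw [mem_closedBall_zero_iff, pi_norm_le_iff_of_nonneg zero_le_one]
      exact fun z => (hP.1 z).le
  have hne : P₀ ∈ K := ⟨h₀, fun _ _ => rfl, by simpa using hρ⟩
  obtain ⟨P, ⟨hP1, hP2, hP3⟩, hPmin⟩ := hK.exists_isMinOn ⟨P₀, hne⟩ hcont.continuousOn
  -- As `P₀` is a competitor, the a priori bound applies to the minimiser and puts it strictly
  -- inside the ball, because `η < ρ`. The ball constraint is then inactive along small variations.
  have hb := apriori P hP1 hP2 hP3 (hPmin hne)
  refine ⟨P, hP1, hP2, hb, fun z hz w hw => ?_⟩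
  -- The curve `cos t · P z + sin t · w` stays on the sphere only for unit `w` orthogonal to `P z`;
  -- other tangent vectors follow by scaling.
  have unit : ∀ w, ‖w‖ = 1 → ⟪P z, w⟫ = 0 → B P (Pi.single z w) = 0 := by
    intro w hw1 hw
    refine form_eq_zero_of_isLocalMin B hsymm ?_
    set c : ℝ → Z → E := fun t => P + Pi.single z ((Real.cos t - 1) • P z + Real.sin t • w)
    have hc : Continuous c := by
      refine continuous_const.add ((continuous_single z).comp ?_)
      fun_prop
    have hc0 : c 0 = P := by simp [c]
    have hev : ∀ᶠ t in nhds (0 : ℝ), B (c t - P₀) (c t - P₀) < ρ := by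
      refine (hcont'.comp hc).continuousAt.eventually_lt continuousAt_const ?_
      simp only [Function.comp, hc0]
      exact hb.trans_lt hη
    filter_upwards [hev] with t ht
    show B (c 0) (c 0) ≤ B (c t) (c t)
    rw [hc0]
    refine hPmin ⟨fun y => ?_, fun y hy => ?_, ht.le⟩
    · rcases eq_or_ne y z with rfl | hyz
      · have e : c t y = Real.cos t • P y + Real.sin t • w := by
          simp only [c, Pi.add_apply, Pi.single_eq_same]; module
        rw [e]
        refine (sq_eq_sq₀ (norm_nonneg _) zero_le_one).1 ?_
        rw [← real_inner_self_eq_norm_sq]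
        simp only [inner_add_left, inner_add_right, inner_smul_left, inner_smul_right, hw,
          real_inner_comm (P y) w, real_inner_self_eq_norm_sq, hP1, hw1, conj_trivial]
        linear_combination Real.sin_sq_add_cos_sq t
      · simp only [c, Pi.add_apply, Pi.single_eq_of_ne hyz, add_zero, hP1]
    · have hyz : y ≠ z := fun h => hz (h ▸ hy)
      simp only [c, Pi.add_apply, Pi.single_eq_of_ne hyz, add_zero, hP2 y hy]
  rcases eq_or_ne w 0 with rfl | hw0
  · simp
  · have h1 := unit (‖w‖⁻¹ • w) (norm_smul_inv_norm (𝕜 := ℝ) hw0) (by rw [inner_smul_right, hw, mul_zero])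
    rw [Pi.single_smul, map_smul, smul_eq_mul] at h1
    exact (mul_eq_zero.1 h1).resolve_left (inv_ne_zero (norm_ne_zero_iff.2 hw0))

end Minimisation

/-! ### The Dirichlet form as a bilinear form, quadrature weights and multipliers. -/

namespace Mesh

variable {a b : ℝ} (T : Mesh a b) {E : Type*} [NormedAddCommGroup E] [InnerProductSpace ℝ E]

theorem inc_add (P R : T.Idx → E) (i : Fin T.M) : T.inc (P + R) i = T.inc P i + T.inc R i := by
  simp only [inc, Pi.add_apply]; module

theorem inc_smul (c : ℝ) (P : T.Idx → E) (i : Fin T.M) : T.inc (c • P) i = c • T.inc P i := by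
  simp only [inc, Pi.smul_apply]; module

theorem sdiff2_add (P R : T.Idx → E) (i : Fin T.M) :
    T.sdiff2 (P + R) i = T.sdiff2 P i + T.sdiff2 R i := by
  simp only [sdiff2, Pi.add_apply]; module

theorem sdiff2_smul (c : ℝ) (P : T.Idx → E) (i : Fin T.M) :
    T.sdiff2 (c • P) i = c • T.sdiff2 P i := by
  simp only [sdiff2, Pi.smul_apply]; module

/-- The Dirichlet form as a bilinear map. -/
def energyForm : (T.Idx → E) →ₗ[ℝ] (T.Idx → E) →ₗ[ℝ] ℝ :=
  LinearMap.mk₂ ℝ T.energy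
    (fun P P' R => by
      simp only [energy, inc_add, sdiff2_add, inner_add_left, ← Finset.sum_add_distrib]
      exact Finset.sum_congr rfl fun i _ => by ring)
    (fun c P R => by
      simp only [energy, inc_smul, sdiff2_smul, inner_smul_left, smul_eq_mul, Finset.mul_sum,
        conj_trivial]
      exact Finset.sum_congr rfl fun i _ => by ring)
    (fun P R R' => by
      simp only [energy, inc_add, sdiff2_add, inner_add_right, ← Finset.sum_add_distrib]
      exact Finset.sum_congr rfl fun i _ => by ring)
    (fun c P R => by
      simp only [energy, inc_smul, sdiff2_smul, inner_smul_right, smul_eq_mul, Finset.mul_sum]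
      exact Finset.sum_congr rfl fun i _ => by ring)

theorem energyForm_apply (P R : T.Idx → E) : T.energyForm P R = T.energy P R := rfl

theorem energy_comm (P R : T.Idx → E) : T.energy P R = T.energy R P := by
  simp only [energy, real_inner_comm]

theorem continuous_energy : Continuous fun P : T.Idx → E => T.energy P P := by
  unfold energy inc sdiff2
  fun_prop

theorem interp_sub (P R : T.Idx → E) (y : ℝ) : T.interp (P - R) y = T.interp P y - T.interp R y := by
  simp only [interp, inc, sdiff2, Pi.sub_apply]
  rw [add_sub_add_comm, ← Finset.sum_sub_distrib]
  congr 1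
  exact Finset.sum_congr rfl fun i _ => by module

/-- Simpson's rule as a linear functional of the nodal values. -/
def simpsonForm : (T.Idx → ℝ) →ₗ[ℝ] ℝ where
  toFun := T.simpson
  map_add' g g' := by
    simp only [simpson, simpsonElem, Pi.add_apply, ← Finset.sum_add_distrib]
    exact Finset.sum_congr rfl fun i _ => by module
  map_smul' c g := by
    simp only [simpson, simpsonElem, Pi.smul_apply, Finset.smul_sum, RingHom.id_apply]
    exact Finset.sum_congr rfl fun i _ => by module

/-- The weights of Simpson's rule. -/
def weight (z : T.Idx) : ℝ := T.simpson (Pi.single z (1 : ℝ))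

theorem simpson_eq_sum (g : T.Idx → ℝ) : T.simpson g = ∑ z, T.weight z * g z := by
  have h := map_sum T.simpsonForm (fun z => Pi.single z (g z)) Finset.univ
  rw [Finset.univ_sum_single] at h
  refine h.trans (Finset.sum_congr rfl fun z _ => ?_)
  have : (Pi.single z (g z) : T.Idx → ℝ) = g z • Pi.single z (1 : ℝ) := by
    rw [← Pi.single_smul, smul_eq_mul, mul_one]
  rw [this, map_smul, smul_eq_mul, mul_comm]
  rfl

/-- Each index is an end point or the midpoint of some element, where Simpson's rule has a positive
coefficient. This makes the nodal multiplier equations solvable one at a time. -/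
theorem weight_pos (hab : a < b) (z : T.Idx) : 0 < T.weight z := by
  have h0 : ∀ y, 0 ≤ (Pi.single z (1 : ℝ) : T.Idx → ℝ) y := fun y => by
    rcases eq_or_ne y z with rfl | h <;> simp [*]
  have hnn : ∀ i, 0 ≤ T.simpsonElem i (Pi.single z (1 : ℝ)) := fun i => by
    have := T.len_pos i
    have h1 := h0 (.inl i.castSucc)
    have h2 := h0 (.inl i.succ)
    have h3 := h0 (.inr i)
    rw [simpsonElem, smul_eq_mul, smul_eq_mul]
    positivity
  have hlt : ∃ i, 0 < T.simpsonElem i (Pi.single z (1 : ℝ)) := by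
    have hi : ∃ i : Fin T.M, z = .inl i.castSucc ∨ z = .inl i.succ ∨ z = .inr i := by
      rcases z with j | i
      · rcases Fin.eq_castSucc_or_eq_last j with ⟨i, rfl⟩ | h
        · exact ⟨i, Or.inl rfl⟩
        · rcases Fin.eq_zero_or_eq_succ j with h0 | ⟨i, rfl⟩
          · obtain ⟨i, -⟩ := T.exists_elem hab
            have h1 : T.M = 0 := congrArg Fin.val (h.symm.trans h0)
            have h2 := i.2
            omega
          · exact ⟨i, Or.inr (Or.inl rfl)⟩
      · exact ⟨i, Or.inr (Or.inr rfl)⟩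
    obtain ⟨i, hi⟩ := hi
    refine ⟨i, ?_⟩
    have hl := T.len_pos i
    have h1 := h0 (.inl i.castSucc)
    have h2 := h0 (.inl i.succ)
    have h3 := h0 (.inr i)
    rw [simpsonElem, smul_eq_mul, smul_eq_mul]
    have key : 0 < (Pi.single z (1 : ℝ) : T.Idx → ℝ) (.inl i.castSucc)
        + 4 * (Pi.single z (1 : ℝ) : T.Idx → ℝ) (.inr i)
        + (Pi.single z (1 : ℝ) : T.Idx → ℝ) (.inl i.succ) := by
      rcases hi with rfl | rfl | rfl
      · rw [Pi.single_eq_same]; positivity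
      · rw [Pi.single_eq_same]; positivity
      · rw [Pi.single_eq_same]; positivity
    positivity
  obtain ⟨i, hi⟩ := hlt
  exact Finset.sum_pos' (fun i _ => hnn i) ⟨i, Finset.mem_univ i, hi⟩

/-- Lagrange multipliers of a constrained critical point. -/
theorem exists_multiplier (hab : a < b) (S : Set T.Idx) {P : T.Idx → E} (hP : ∀ z, ‖P z‖ = 1)
    (hcrit : ∀ z ∉ S, ∀ w, ⟪P z, w⟫ = 0 → T.energy P (Pi.single z w) = 0) :
    ∃ m : T.Idx → ℝ, (∀ z ∈ S, m z = 0) ∧ ∀ R : T.Idx → E, (∀ z ∈ S, R z = 0) →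
      T.energy P R + T.simpson (fun z => m z * ⟪P z, R z⟫) = 0 := by
  classical
  -- Criticality kills the component of `R z` orthogonal to `P z`. The multiplier is chosen to
  -- balance the radial component `⟪P z, R z⟫ • P z`, after division by the quadrature weight.
  refine ⟨fun z => if z ∈ S then 0 else -(T.weight z)⁻¹ * T.energy P (Pi.single z (P z)),
    fun z hz => if_pos hz, fun R hR => ?_⟩
  have h := map_sum (T.energyForm P) (fun z => Pi.single z (R z)) Finset.univ
  rw [Finset.univ_sum_single, energyForm_apply] at h
  rw [simpson_eq_sum, h, ← Finset.sum_add_distrib]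
  refine Finset.sum_eq_zero fun z _ => ?_
  beta_reduce
  rw [energyForm_apply]
  by_cases hz : z ∈ S
  · rw [hR z hz, Pi.single_zero, if_pos hz, ← energyForm_apply, map_zero]; ring
  · rw [if_neg hz]
    have hw := (T.weight_pos hab z).ne'
    have e := hcrit z hz (R z - ⟪P z, R z⟫ • P z) (by
      rw [inner_sub_right, inner_smul_right, real_inner_self_eq_norm_sq, hP]; ring)
    rw [Pi.single_sub, Pi.single_smul, ← energyForm_apply, map_sub, map_smul, energyForm_apply,
      energyForm_apply, smul_eq_mul] at e
    field_simp
    linarith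

end Mesh

/-! ### Elementary estimates for `H¹` functions and for great circles. -/

section Estimates

variable {E : Type*} [NormedAddCommGroup E] [InnerProductSpace ℝ E] {a b : ℝ}

/-- The integral of the squared deviation of `‖g‖` from its mean is nonnegative. -/
theorem sq_integral_norm_le (hab : a ≤ b) {g : ℝ → E} (hg : MemL2 a b g) :
    (∫ x in a..b, ‖g x‖) ^ 2 ≤ (b - a) * ∫ x in a..b, ‖g x‖ ^ 2 := by
  rcases hab.eq_or_lt with rfl | hlt
  · simp
  have i1 : IntervalIntegrable (fun x => ‖g x‖) volume a b := (hg.intervalIntegrable hab).norm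
  have i2 := hg.integrable_norm_sq hab
  set J := ∫ x in a..b, ‖g x‖
  have hδ : 0 < b - a := sub_pos.2 hlt
  have h0 : 0 ≤ ∫ x in a..b, (‖g x‖ ^ 2 - 2 * (J / (b - a)) * ‖g x‖ + (J / (b - a)) ^ 2) :=
    intervalIntegral.integral_nonneg hab fun x _ => by
      have : ‖g x‖ ^ 2 - 2 * (J / (b - a)) * ‖g x‖ + (J / (b - a)) ^ 2 = (‖g x‖ - J / (b - a)) ^ 2 := by
        ring
      rw [this]; positivity
  rw [intervalIntegral.integral_add (i2.sub (i1.const_mul _)) (by simp),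
    intervalIntegral.integral_sub i2 (i1.const_mul _), intervalIntegral.integral_const_mul,
    intervalIntegral.integral_const, smul_eq_mul] at h0
  have h1 : (b - a) * ((∫ x in a..b, ‖g x‖ ^ 2) - 2 * (J / (b - a)) * J
      + (b - a) * (J / (b - a)) ^ 2) = (b - a) * (∫ x in a..b, ‖g x‖ ^ 2) - J ^ 2 := by
    field_simp; ring
  have := mul_nonneg hδ.le h0
  rw [h1] at this
  linarith

theorem integral_norm_le_sqrt (hab : a ≤ b) {g : ℝ → E} (hg : MemL2 a b g) :
    ∫ x in a..b, ‖g x‖ ≤ √(b - a) * √(∫ x in a..b, ‖g x‖ ^ 2) := by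
  rw [← Real.sqrt_mul (sub_nonneg.2 hab)]
  exact Real.le_sqrt_of_sq_le (sq_integral_norm_le hab hg)

variable [CompleteSpace E]

/-- The embedding of `H¹` into Hölder functions of exponent `1/2`; the factors `√h` in the error
analysis come from here. -/
theorem PiecewiseC1.norm_sub_le {f : ℝ → E} (hf : PiecewiseC1 a b f) {x y : ℝ} (hax : a ≤ x)
    (hxy : x ≤ y) (hyb : y ≤ b) :
    ‖f y - f x‖ ≤ √(y - x) * √(∫ s in a..b, ‖deriv f s‖ ^ 2) := by
  have h := hf.mono hax hyb
  rw [← h.integral_deriv hxy]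
  refine (intervalIntegral.norm_integral_le_integral_norm hxy).trans
    ((integral_norm_le_sqrt hxy h.memL2_deriv).trans ?_)
  refine mul_le_mul_of_nonneg_left (Real.sqrt_le_sqrt ?_) (Real.sqrt_nonneg _)
  exact intervalIntegral.integral_mono_interval hax hxy hyb
    (Filter.Eventually.of_forall fun s => sq_nonneg _)
    (hf.memL2_deriv.integrable_norm_sq (hax.trans (hxy.trans hyb)))

/-- The derivative of a function with three zeros. -/
theorem norm_deriv_le_of_three_zeros {A A' A'' A''' : ℝ → E} (h0 : ∀ x, HasDerivAt A (A' x) x)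
    (h1 : ∀ x, HasDerivAt A' (A'' x) x) (h2 : ∀ x, HasDerivAt A'' (A''' x) x) {K : ℝ}
    (hK : ∀ x, ‖A''' x‖ ≤ K) {l m r : ℝ} (hlm : l < m) (hmr : m < r) (hl : A l = 0) (hm : A m = 0)
    (hr : A r = 0) {x : ℝ} (hx : x ∈ Icc l r) : ‖A' x‖ ≤ K * (r - l) ^ 2 := by
  have hK0 : 0 ≤ K := (norm_nonneg _).trans (hK 0)
  -- Rolle's theorem is scalar, so `A` is tested with the fixed vector `w = A' x`. The function `⟪w,
  -- A⟫` has three zeros, its derivative two, its second derivative one; integrating back from these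
  -- zeros bounds `⟪w, A' x⟫ = ‖w‖²`.
  set w := A' x with hw
  have inn : ∀ {f : ℝ → E} {f' : ℝ → E}, (∀ x, HasDerivAt f (f' x) x) →
      ∀ x, HasDerivAt (fun x => ⟪w, f x⟫) ⟪w, f' x⟫ x := fun h x => by
    simpa using (hasDerivAt_const x w).inner ℝ (h x)
  have k0 := inn h0
  have k1 := inn h1
  have k2 := inn h2
  have cont : ∀ {f : ℝ → E} {f' : ℝ → E}, (∀ x, HasDerivAt f (f' x) x) →
      ∀ s, ContinuousOn (fun x => ⟪w, f x⟫) s := fun h s x _ =>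
    (inn h x).continuousAt.continuousWithinAt
  obtain ⟨ξ, hξ, e1⟩ := exists_hasDerivAt_eq_zero hlm (cont h0 _) (by simp [hl, hm])
    (fun x _ => k0 x)
  obtain ⟨ζ, hζ, e2⟩ := exists_hasDerivAt_eq_zero hmr (cont h0 _) (by simp [hr, hm])
    (fun x _ => k0 x)
  obtain ⟨θ, hθ, e3⟩ := exists_hasDerivAt_eq_zero (hξ.2.trans hζ.1) (cont h1 _)
    (by rw [e1, e2]) (fun x _ => k1 x)
  have b2 : ∀ y ∈ Icc l r, ‖⟪w, A'' y⟫‖ ≤ ‖w‖ * K * (r - l) := by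
    intro y hy
    have := (convex_Icc l r).norm_image_sub_le_of_norm_hasDerivWithin_le
      (f := fun x => ⟪w, A'' x⟫) (f' := fun x => ⟪w, A''' x⟫) (C := ‖w‖ * K)
      (fun y _ => (k2 y).hasDerivWithinAt)
      (fun y _ => (norm_inner_le_norm _ _).trans
        (mul_le_mul_of_nonneg_left (hK y) (norm_nonneg _)))
      (x := θ) (y := y) ⟨by linarith [hξ.1, hθ.1], by linarith [hζ.2, hθ.2]⟩ hy
    simp only [e3, sub_zero] at this
    refine this.trans (mul_le_mul_of_nonneg_left ?_ (by positivity))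
    rw [Real.norm_eq_abs, abs_le]
    constructor <;> linarith [hξ.1, hθ.1, hζ.2, hθ.2, hy.1, hy.2]
  have b1 : ‖⟪w, A' x⟫‖ ≤ ‖w‖ * K * (r - l) * (r - l) := by
    have := (convex_Icc l r).norm_image_sub_le_of_norm_hasDerivWithin_le
      (f := fun x => ⟪w, A' x⟫) (f' := fun x => ⟪w, A'' x⟫) (C := ‖w‖ * K * (r - l))
      (fun y _ => (k1 y).hasDerivWithinAt) b2
      (x := ξ) (y := x) ⟨hξ.1.le, by linarith [hξ.2]⟩ hx
    simp only [e1, sub_zero] at this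
    refine this.trans (mul_le_mul_of_nonneg_left ?_
      (mul_nonneg (by positivity) (by linarith)))
    rw [Real.norm_eq_abs, abs_le]
    constructor <;> linarith [hξ.1, hξ.2, hx.1, hx.2]
  rw [← hw, real_inner_self_eq_norm_sq, Real.norm_of_nonneg (sq_nonneg _)] at b1
  rcases (norm_nonneg w).eq_or_lt with h | h
  · rw [← h]; positivity
  · refine le_of_mul_le_mul_left ?_ h
    nlinarith

variable {κ : ℝ} {Q Q' : ℝ → E}

theorem IsGreatCircle.norm_sub_le (hQ : IsGreatCircle κ Q Q') (x y : ℝ) :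
    ‖Q y - Q x‖ ≤ κ * |y - x| := by
  have := convex_univ.norm_image_sub_le_of_norm_hasDerivWithin_le (f := Q) (f' := Q') (C := κ)
    (fun y _ => (hQ.hasDerivAt y).hasDerivWithinAt) (fun y _ => (hQ.norm_eq' y).le)
    (mem_univ x) (mem_univ y)
  exact this

theorem IsGreatCircle.norm_sub_taylor_le (hQ : IsGreatCircle κ Q Q') {l r x : ℝ}
    (hx : x ∈ Icc l r) : ‖Q x - (Q l + (x - l) • Q' l)‖ ≤ κ ^ 2 * (r - l) ^ 2 := by
  have hκ := hQ.nonneg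
  have hl : l ∈ Icc l r := ⟨le_rfl, hx.1.trans hx.2⟩
  have h1 : ∀ y ∈ Icc l r, ‖Q' y - Q' l‖ ≤ κ ^ 2 * (r - l) := by
    intro y hy
    have := convex_univ.norm_image_sub_le_of_norm_hasDerivWithin_le (f := Q')
      (f' := fun x => -κ ^ 2 • Q x) (C := κ ^ 2)
      (fun y _ => (hQ.hasDerivAt' y).hasDerivWithinAt)
      (fun y _ => by rw [norm_smul, hQ.norm_eq, mul_one, norm_neg, Real.norm_of_nonneg (sq_nonneg _)])
      (mem_univ l) (mem_univ y)
    refine this.trans (mul_le_mul_of_nonneg_left ?_ (sq_nonneg _))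
    rw [Real.norm_of_nonneg (by linarith [hy.1])]
    linarith [hy.2]
  have hd : ∀ y, HasDerivAt (fun y => Q y - (y - l) • Q' l) (Q' y - Q' l) y := fun y =>
    ((hQ.hasDerivAt y).sub (((hasDerivAt_id y).sub_const l).smul_const (Q' l))).congr_deriv (by simp)
  have h2 := (convex_Icc l r).norm_image_sub_le_of_norm_hasDerivWithin_le
    (f := fun y => Q y - (y - l) • Q' l) (C := κ ^ 2 * (r - l))
    (fun y _ => (hd y).hasDerivWithinAt) h1 hl hx
  have e : Q x - (x - l) • Q' l - (Q l - (l - l) • Q' l) = Q x - (Q l + (x - l) • Q' l) := by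
    rw [sub_self, zero_smul]; abel
  simp only [e] at h2
  refine h2.trans ?_
  rw [pow_two (r - l), ← mul_assoc]
  refine mul_le_mul_of_nonneg_left ?_ (mul_nonneg (sq_nonneg _) (by linarith [hl.2]))
  rw [Real.norm_of_nonneg (by linarith [hx.1])]
  linarith [hx.2]

end Estimates

namespace Mesh

variable {a b : ℝ} (T : Mesh a b) {E : Type*} [NormedAddCommGroup E] [InnerProductSpace ℝ E]
  [CompleteSpace E]

/-- Both the integral and Simpson's rule have positive weights of total `b - a`, and they agree on
cubics. Replacing `f` by a cubic on each element thus costs at most `(b - a) η` in either; the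
cubics need not match across elements. -/
theorem simpson_error (hab : a < b) {f : ℝ → ℝ} (hf : ContinuousOn f (Icc a b)) {η : ℝ}
    (h : ∀ i : Fin T.M, ∃ c₀ c₁ c₂ c₃ : ℝ, ∀ y ∈ Icc (T.x i.castSucc) (T.x i.succ),
      |f y - (c₀ + ((T.len i)⁻¹ * (y - T.x i.castSucc)) • c₁
        + ((T.len i)⁻¹ * (y - T.x i.castSucc)) ^ 2 • c₂
        + ((T.len i)⁻¹ * (y - T.x i.castSucc)) ^ 3 • c₃)| ≤ η) :
    |(∫ y in a..b, f y) - T.simpson fun z => f (T.node z)| ≤ 2 * (b - a) * η := by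
  have hfi : IntervalIntegrable f volume a b :=
    ContinuousOn.intervalIntegrable (by rwa [uIcc_of_le hab.le])
  rw [← T.sum_integral hab.le hfi, simpson, ← Finset.sum_sub_distrib, ← T.sum_len hab.le,
    mul_assoc, Finset.sum_mul, Finset.mul_sum]
  refine (Finset.abs_sum_le_sum_abs _ _).trans (Finset.sum_le_sum fun i _ => ?_)
  obtain ⟨c₀, c₁, c₂, c₃, hc⟩ := h i
  set g : ℝ → ℝ := fun y => c₀ + ((T.len i)⁻¹ * (y - T.x i.castSucc)) • c₁
        + ((T.len i)⁻¹ * (y - T.x i.castSucc)) ^ 2 • c₂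
        + ((T.len i)⁻¹ * (y - T.x i.castSucc)) ^ 3 • c₃ with hg
  have e1 := T.integral_eq_simpsonElem i (f := g) (fun y _ => rfl)
  have hgc : Continuous g := by rw [hg]; fun_prop
  have hfe : IntervalIntegrable f volume (T.x i.castSucc) (T.x i.succ) :=
    hfi.mono_set (by
      rw [uIcc_of_le (T.x_lt _).le, uIcc_of_le hab.le]; exact T.Icc_subset _)
  have e2 : |∫ y in T.x i.castSucc..T.x i.succ, (f y - g y)| ≤ η * T.len i := by
    have := intervalIntegral.norm_integral_le_of_norm_le_const (f := fun y => f y - g y) (C := η)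
      (a := T.x i.castSucc) (b := T.x i.succ) (fun y hy => by
        rw [uIoc_of_le (T.x_lt i).le] at hy
        exact hc y (Ioc_subset_Icc_self hy))
    rwa [Real.norm_eq_abs, ← len, abs_of_pos (T.len_pos i)] at this
  rw [intervalIntegral.integral_sub hfe (hgc.intervalIntegrable _ _), e1] at e2
  have a1 := hc _ (left_mem_Icc.2 (T.x_lt i).le)
  have a2 := hc _ (right_mem_Icc.2 (T.x_lt i).le)
  have a3 := hc _ (Ioo_subset_Icc_self (T.mid_mem i))
  have hl := T.len_pos i
  have e3 : |T.simpsonElem i (fun z => g (T.node z)) - T.simpsonElem i fun z => f (T.node z)|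
      ≤ η * T.len i := by
    have : T.simpsonElem i (fun z => g (T.node z)) - T.simpsonElem i (fun z => f (T.node z))
        = -(T.len i / 6 * ((f (T.x i.castSucc) - g (T.x i.castSucc))
          + 4 * (f (T.mid i) - g (T.mid i)) + (f (T.x i.succ) - g (T.x i.succ)))) := by
      simp only [simpsonElem, node, Sum.elim_inl, Sum.elim_inr, smul_eq_mul]
      ring
    rw [this, abs_neg, abs_mul, abs_of_pos (by positivity)]
    have : |(f (T.x i.castSucc) - g (T.x i.castSucc))
          + 4 * (f (T.mid i) - g (T.mid i)) + (f (T.x i.succ) - g (T.x i.succ))| ≤ 6 * η := by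
      rw [abs_le] at *
      constructor <;> linarith [a1.1, a1.2, a2.1, a2.2, a3.1, a3.2]
    calc _ ≤ T.len i / 6 * (6 * η) := mul_le_mul_of_nonneg_left this (by positivity)
      _ = _ := by ring
  rw [abs_le] at *
  constructor <;> linarith [e2.1, e2.2, e3.1, e3.2]

variable {κ : ℝ} {Q Q' : ℝ → E}

/-- The interpolation error of a great circle. -/
theorem norm_deriv_interp_sub_le (hQ : IsGreatCircle κ Q Q') {i : Fin T.M} {y : ℝ}
    (hy : y ∈ Ioo (T.x i.castSucc) (T.x i.succ)) :
    ‖deriv (T.interp fun z => Q (T.node z)) y - Q' y‖ ≤ κ ^ 3 * T.h ^ 2 := by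
  set P : T.Idx → E := fun z => Q (T.node z)
  rw [(T.hasDerivAt_interp P hy).deriv]
  have hκ := hQ.nonneg
  have d1 : ∀ x, HasDerivAt (fun x => T.quad P i x - Q x) (T.quadDeriv P i x - Q' x) x := fun x =>
    (T.hasDerivAt_quad P i x).sub (hQ.hasDerivAt x)
  have d2 : ∀ x, HasDerivAt (fun x => T.quadDeriv P i x - Q' x)
      (((T.len i)⁻¹ * (4 * (T.len i)⁻¹)) • T.sdiff2 P i - -κ ^ 2 • Q x) x := fun x => by
    refine HasDerivAt.sub ?_ (hQ.hasDerivAt' x)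
    have h1 : HasDerivAt (fun y => 4 * ((T.len i)⁻¹ * (y - T.x i.castSucc))) (4 * (T.len i)⁻¹) x := by
      simpa using (((hasDerivAt_id x).sub_const (T.x i.castSucc)).const_mul (T.len i)⁻¹).const_mul 4
    exact (((h1.smul_const (T.sdiff2 P i)).const_add _).const_smul (T.len i)⁻¹).congr_deriv (by module)
  have d3 : ∀ x, HasDerivAt (fun x => ((T.len i)⁻¹ * (4 * (T.len i)⁻¹)) • T.sdiff2 P i - -κ ^ 2 • Q x)
      (κ ^ 2 • Q' x) x := fun x =>
    (((hQ.hasDerivAt x).const_smul (-κ ^ 2)).const_sub _).congr_deriv (by module)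
  -- The error vanishes at the two nodes and the midpoint. The quadratic has no third derivative, so
  -- that of the error is `-Q''' = κ² Q'`, of norm `κ³`.
  have := norm_deriv_le_of_three_zeros d1 d2 d3 (K := κ ^ 3) (fun x => by
      rw [norm_smul, hQ.norm_eq', Real.norm_of_nonneg (sq_nonneg _)]; exact le_of_eq (by ring))
    (T.mid_mem i).1 (T.mid_mem i).2 (by rw [quad_left, sub_eq_zero]; rfl)
    (by rw [quad_mid, sub_eq_zero]; rfl) (by rw [quad_right, sub_eq_zero]; rfl)
    (Ioo_subset_Icc_self hy)
  refine this.trans (mul_le_mul_of_nonneg_left ?_ (by positivity))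
  exact pow_le_pow_left₀ (T.len_pos i).le (T.len_le_h i) 2

theorem ae_norm_deriv_interp_sub_le (hab : a < b) (hQ : IsGreatCircle κ Q Q') :
    ∀ᵐ y ∂volume.restrict (Ioo a b),
      ‖deriv (T.interp fun z => Q (T.node z)) y - Q' y‖ ≤ κ ^ 3 * T.h ^ 2 := by
  refine (ae_restrict_iff' measurableSet_Ioo).2 ?_
  filter_upwards [(finite_range T.x).countable.ae_notMem volume] with y hy hy'
  obtain ⟨i, hi⟩ := T.exists_mem_Ioo hab ⟨hy', hy⟩
  exact T.norm_deriv_interp_sub_le hQ hi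

end Mesh

/-! ### Error analysis of the discrete problem. -/

namespace Mesh

variable {a b : ℝ} (T : Mesh a b) {E : Type*} [NormedAddCommGroup E] [InnerProductSpace ℝ E]
  [CompleteSpace E]

/-- The indices of the two end points. -/
def bdry : Set T.Idx := {.inl 0, .inl (Fin.last T.M)}

theorem interp_left (hab : a < b) (P : T.Idx → E) : T.interp P a = P (.inl 0) := by
  have := T.interp_node hab P (.inl 0)
  rwa [show T.node (.inl 0) = a from T.left] at this

theorem interp_right (hab : a < b) (P : T.Idx → E) : T.interp P b = P (.inl (Fin.last T.M)) := by
  have := T.interp_node hab P (.inl (Fin.last T.M))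
  rwa [show T.node (.inl (Fin.last T.M)) = b from T.right] at this

theorem energy_self_nonneg (P : T.Idx → E) : 0 ≤ T.energy P P :=
  Finset.sum_nonneg fun i _ => mul_nonneg (inv_nonneg.2 (T.len_pos i).le)
    (add_nonneg real_inner_self_nonneg (mul_nonneg (by norm_num) real_inner_self_nonneg))

theorem norm_interp_le (hab : a < b) {R : T.Idx → E} (hR : R (.inl 0) = 0) {y : ℝ}
    (hy : y ∈ Icc a b) : ‖T.interp R y‖ ≤ √(b - a) * √(T.energy R R) := by
  have h := (T.piecewiseC1_interp hab R).norm_sub_le le_rfl hy.1 hy.2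
  rw [T.interp_left hab, hR, sub_zero, T.energy_self_eq hab] at h
  exact h.trans (mul_le_mul_of_nonneg_right (Real.sqrt_le_sqrt (by linarith [hy.2]))
    (Real.sqrt_nonneg _))

theorem norm_interp_sub_le (hab : a < b) (R : T.Idx → E) {i : Fin T.M} {y : ℝ}
    (hy : y ∈ Icc (T.x i.castSucc) (T.x i.succ)) :
    ‖T.interp R y - T.interp R (T.x i.castSucc)‖ ≤ √T.h * √(T.energy R R) := by
  have h := (T.piecewiseC1_interp hab R).norm_sub_le (T.x_mem _).1 hy.1 (T.Icc_subset i hy).2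
  rw [T.energy_self_eq hab] at h
  refine h.trans (mul_le_mul_of_nonneg_right (Real.sqrt_le_sqrt ?_) (Real.sqrt_nonneg _))
  have := T.len_le_h i
  rw [len] at this
  linarith [hy.2]

variable {κ : ℝ} {Q Q' : ℝ → E}

/-- For unit vectors `p, q` one has `|p - q|² = 2 - 2⟪p, q⟫`. The nodal constraint thus makes the
normal component of the error quadratic in the error. -/
theorem inner_node_sub {P : T.Idx → E} (hQ : IsGreatCircle κ Q Q') (hP : ∀ z, ‖P z‖ = 1)
    (z : T.Idx) : ⟪P z - Q (T.node z), Q (T.node z)⟫ = -(1 / 2) * ‖P z - Q (T.node z)‖ ^ 2 := by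
  rw [← real_inner_self_eq_norm_sq (P z - _)]
  simp only [inner_sub_left, inner_sub_right, real_inner_self_eq_norm_sq, hP, hQ.norm_eq,
    real_inner_comm (P z)]
  ring

/-- The normal component of the error at a point is of higher order. -/
theorem abs_inner_interp_le (hab : a < b) (hQ : IsGreatCircle κ Q Q') {P : T.Idx → E}
    (hP : ∀ z, ‖P z‖ = 1) {R : T.Idx → E} (hR : ∀ z, R z = P z - Q (T.node z))
    (hR0 : R (.inl 0) = 0) {y : ℝ} (hy : y ∈ Icc a b) :
    |⟪T.interp R y, Q y⟫| ≤ ((b - a) / 2 * √(T.energy R R) + √T.h + √(b - a) * κ * T.h)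
      * √(T.energy R R) := by
  obtain ⟨i, hi⟩ := T.exists_mem_Icc hab hy
  set l := T.x i.castSucc
  set w := √(T.energy R R)
  have hw : 0 ≤ w := Real.sqrt_nonneg _
  have hsL : √(b - a) ^ 2 = b - a := Real.sq_sqrt (by linarith)
  have n1 := T.norm_interp_le hab hR0 (T.x_mem i.castSucc)
  have n2 := T.norm_interp_sub_le hab R hi
  have n3 := hQ.norm_sub_le l y
  have n4 : |y - l| ≤ T.h := by
    have := T.len_le_h i
    rw [len] at this
    rw [abs_of_nonneg (by linarith [hi.1])]
    linarith [hi.2]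
  have e1 : ⟪T.interp R l, Q l⟫ = -(1 / 2) * ‖T.interp R l‖ ^ 2 := by
    have := T.interp_node hab R (.inl i.castSucc)
    rw [show T.node (.inl i.castSucc) = l from rfl] at this
    rw [this, hR]
    exact T.inner_node_sub hQ hP (.inl i.castSucc)
  -- The constraint is available only at nodes. Moving from `y` to the left node costs `√h` for the
  -- error, by Hölder continuity, and `κh` for `Q`.
  have e2 : ⟪T.interp R y, Q y⟫ = ⟪T.interp R y - T.interp R l, Q y⟫ + ⟪T.interp R l, Q y - Q l⟫
      + ⟪T.interp R l, Q l⟫ := by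
    rw [inner_sub_left, inner_sub_right]; ring
  have b1 : |⟪T.interp R y - T.interp R l, Q y⟫| ≤ √T.h * w := by
    refine (abs_real_inner_le_norm _ _).trans ?_
    rw [hQ.norm_eq, mul_one]; exact n2
  have b2 : |⟪T.interp R l, Q y - Q l⟫| ≤ √(b - a) * w * (κ * T.h) := by
    refine (abs_real_inner_le_norm _ _).trans (mul_le_mul n1 ?_ (norm_nonneg _) (by positivity))
    exact n3.trans (mul_le_mul_of_nonneg_left n4 hQ.nonneg)
  have b3 : |⟪T.interp R l, Q l⟫| ≤ 1 / 2 * ((b - a) * w ^ 2) := by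
    rw [e1, abs_mul, abs_of_nonneg (sq_nonneg ‖T.interp R l‖), abs_neg,
      abs_of_nonneg (by norm_num : (0 : ℝ) ≤ 1 / 2)]
    refine mul_le_mul_of_nonneg_left ?_ (by norm_num)
    calc _ ≤ (√(b - a) * w) ^ 2 := pow_le_pow_left₀ (norm_nonneg _) n1 2
      _ = _ := by rw [mul_pow, hsL]
  rw [e2]
  refine (abs_add_le _ _).trans ((add_le_add ((abs_add_le _ _).trans (add_le_add b1 b2)) b3).trans
    (le_of_eq ?_))
  ring

/-- Quadrature error for the squared norm. -/
theorem simpson_norm_sq_le (hab : a < b) {R : T.Idx → E} (hR0 : R (.inl 0) = 0) :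
    T.simpson (fun z => ‖R z‖ ^ 2) ≤ (∫ y in a..b, ‖T.interp R y‖ ^ 2)
      + 4 * (b - a) * √(b - a) * √T.h * T.energy R R := by
  set w := √(T.energy R R)
  have hw2 : w ^ 2 = T.energy R R := Real.sq_sqrt (T.energy_self_nonneg R)
  have h := T.simpson_error hab (f := fun y => ‖T.interp R y‖ ^ 2)
    ((T.continuous_interp R).norm.pow 2).continuousOn
    (η := 2 * (√(b - a) * w) * (√T.h * w)) fun i => by
      -- Comparison with a constant suffices: the loss `√h · E(R,R)` can be absorbed later.
      refine ⟨‖T.interp R (T.x i.castSucc)‖ ^ 2, 0, 0, 0, fun y hy => ?_⟩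
      have n1 := T.norm_interp_le hab hR0 (T.x_mem i.castSucc)
      have n2 := T.norm_interp_le hab hR0 (T.Icc_subset i hy)
      have n3 := (abs_norm_sub_norm_le _ _).trans (T.norm_interp_sub_le hab R hy)
      simp only [smul_zero, add_zero]
      rw [sq_sub_sq, abs_mul, abs_of_nonneg (by positivity)]
      exact mul_le_mul (by linarith) n3 (abs_nonneg _) (by positivity)
  simp only [T.interp_node hab] at h
  have := (abs_le.1 h).1
  have e : 2 * (b - a) * (2 * (√(b - a) * w) * (√T.h * w))
      = 4 * (b - a) * √(b - a) * √T.h * T.energy R R := by rw [← hw2]; ring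
  linarith

/-- Quadrature error for the product with a great circle. -/
theorem abs_integral_inner_sub_simpson_le (hab : a < b) (hQ : IsGreatCircle κ Q Q')
    {R : T.Idx → E} (hR0 : R (.inl 0) = 0) :
    |(∫ y in a..b, ⟪T.interp R y, Q y⟫) - T.simpson fun z => ⟪R z, Q (T.node z)⟫|
      ≤ 2 * (b - a) * (√(b - a) * √(T.energy R R) * (κ ^ 2 * T.h ^ 2)) := by
  have h := T.simpson_error hab (f := fun y => ⟪T.interp R y, Q y⟫)
    ((T.continuous_interp R).inner hQ.continuous).continuousOn
    (η := √(b - a) * √(T.energy R R) * (κ ^ 2 * T.h ^ 2)) fun i => by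
      set l := T.x i.castSucc
      set p := R (.inl i.castSucc)
      set q := T.inc R i - (2 : ℝ) • T.sdiff2 R i
      set s := (2 : ℝ) • T.sdiff2 R i
      have hl := (T.len_pos i).ne'
      -- These are the coefficients of the quadratic error times the first order Taylor polynomial
      -- of `Q` at the left node. The product is a cubic, so only the Taylor remainder of order `h²`
      -- is seen.
      refine ⟨⟪p, Q l⟫, ⟪q, Q l⟫ + T.len i * ⟪p, Q' l⟫, ⟪s, Q l⟫ + T.len i * ⟪q, Q' l⟫,
        T.len i * ⟪s, Q' l⟫, fun y hy => ?_⟩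
      have n2 := T.norm_interp_le hab hR0 (T.Icc_subset i hy)
      have n3 := hQ.norm_sub_taylor_le hy
      have e : ⟪p, Q l⟫ + ((T.len i)⁻¹ * (y - l)) • (⟪q, Q l⟫ + T.len i * ⟪p, Q' l⟫)
          + ((T.len i)⁻¹ * (y - l)) ^ 2 • (⟪s, Q l⟫ + T.len i * ⟪q, Q' l⟫)
          + ((T.len i)⁻¹ * (y - l)) ^ 3 • (T.len i * ⟪s, Q' l⟫)
          = ⟪T.interp R y, Q l + (y - l) • Q' l⟫ := by
        have e0 : T.interp R y
            = p + ((T.len i)⁻¹ * (y - l)) • q + ((T.len i)⁻¹ * (y - l)) ^ 2 • s := by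
          rw [T.interp_eq_quad R hy, quad]; module
        rw [e0]
        simp only [inner_add_left, inner_add_right, inner_smul_left, inner_smul_right, smul_eq_mul,
          conj_trivial]
        field_simp
        ring
      rw [e, ← inner_sub_right]
      refine (abs_real_inner_le_norm _ _).trans (mul_le_mul n2 (n3.trans ?_) (norm_nonneg _)
        (by positivity))
      exact mul_le_mul_of_nonneg_left (pow_le_pow_left₀ (T.len_pos i).le (T.len_le_h i) 2)
        (sq_nonneg _)
  simpa only [T.interp_node hab] using h

/-- Consistency: the interpolant of a great circle is almost critical. -/
theorem energy_interp_ge (hab : a < b) (hQ : IsGreatCircle κ Q Q') {R : T.Idx → E}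
    (hR0 : R (.inl 0) = 0) (hR1 : R (.inl (Fin.last T.M)) = 0) :
    κ ^ 2 * (∫ y in a..b, ⟪T.interp R y, Q y⟫) - κ ^ 3 * T.h ^ 2 * (√(b - a) * √(T.energy R R))
      ≤ T.energy (fun z => Q (T.node z)) R := by
  have hκ := hQ.nonneg
  have he := T.piecewiseC1_interp hab R
  have hI := T.piecewiseC1_interp hab fun z => Q (T.node z)
  have hQ'm : MemL2 a b Q' := memL2_of_continuousOn hQ.continuous'.continuousOn
  have hQm : MemL2 a b Q := memL2_of_continuousOn hQ.continuous.continuousOn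
  have hem : MemL2 a b (T.interp R) := memL2_of_continuousOn he.1
  rw [← T.integral_inner_deriv_interp hab (fun z => Q (T.node z)) R]
  have i1 := hQ'm.integrable_inner hab.le he.memL2_deriv
  have i2 := hQm.integrable_inner hab.le hem
  -- Integration by parts with `Q'' = -κ² Q`; the boundary terms vanish with `R`.
  have s1 : ∫ y in a..b, ⟪Q' y, deriv (T.interp R) y⟫
      = κ ^ 2 * ∫ y in a..b, ⟪T.interp R y, Q y⟫ := by
    have h0 := ((hQ.piecewiseC1' (a := a) (b := b)).inner he).integral_deriv hab.le
    rw [T.interp_left hab, T.interp_right hab, hR0, hR1, inner_zero_right, inner_zero_right,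
      sub_zero] at h0
    have h1 : ∫ y in a..b, deriv (fun y => ⟪Q' y, T.interp R y⟫) y
        = ∫ y in a..b, (⟪Q' y, deriv (T.interp R) y⟫ - κ ^ 2 * ⟪Q y, T.interp R y⟫) := by
      refine integral_congr_ae_Ioo hab.le ?_
      filter_upwards [he.ae_differentiableAt] with y hy
      rw [((hQ.hasDerivAt' y).inner ℝ hy.hasDerivAt).deriv, inner_smul_left, conj_trivial]
      ring
    rw [h0, intervalIntegral.integral_sub i1 (i2.const_mul _),
      intervalIntegral.integral_const_mul] at h1
    have h2 : ∫ y in a..b, ⟪T.interp R y, Q y⟫ = ∫ y in a..b, ⟪Q y, T.interp R y⟫ :=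
      intervalIntegral.integral_congr fun y _ => real_inner_comm _ _
    rw [h2]
    linarith
  have i3 := hI.memL2_deriv.integrable_inner hab.le he.memL2_deriv
  have i4 : IntervalIntegrable (fun y => ‖deriv (T.interp R) y‖) volume a b :=
    (he.memL2_deriv.intervalIntegrable hab.le).norm
  have key : ∫ y in a..b, (⟪Q' y, deriv (T.interp R) y⟫
      - κ ^ 3 * T.h ^ 2 * ‖deriv (T.interp R) y‖)
      ≤ ∫ y in a..b, ⟪deriv (T.interp fun z => Q (T.node z)) y, deriv (T.interp R) y⟫ := by
    refine intervalIntegral.integral_mono_ae_restrict hab.le (i1.sub (i4.const_mul _)) i3 ?_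
    rw [← Measure.restrict_congr_set Ioo_ae_eq_Icc]
    filter_upwards [T.ae_norm_deriv_interp_sub_le hab hQ] with y hy
    have h1 := (neg_le_abs _).trans ((abs_real_inner_le_norm
      (deriv (T.interp fun z => Q (T.node z)) y - Q' y) (deriv (T.interp R) y)).trans
      (mul_le_mul_of_nonneg_right hy (norm_nonneg _)))
    rw [inner_sub_left] at h1
    linarith
  rw [intervalIntegral.integral_sub i1 (i4.const_mul _), s1,
    intervalIntegral.integral_const_mul] at key
  refine le_trans (sub_le_sub_left (mul_le_mul_of_nonneg_left ?_ (by positivity)) _) key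
  rw [← T.energy_self_eq hab]
  exact integral_norm_le_sqrt hab.le he.memL2_deriv

/-- The error inequality for a discrete curve of smaller energy than the interpolant. -/
theorem energy_error_le (hab : a < b) (hQ : IsGreatCircle κ Q Q') {c C : ℝ} (hC : 0 ≤ C)
    (hG : ∀ e : ℝ → E, PiecewiseC1 a b e → e a = 0 → e b = 0 →
      c * (∫ x in a..b, ‖deriv e x‖ ^ 2) ≤ (∫ x in a..b, ‖deriv e x‖ ^ 2)
        - κ ^ 2 * (∫ x in a..b, ‖e x‖ ^ 2) + C * ∫ x in a..b, ⟪e x, Q x⟫ ^ 2)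
    {P : T.Idx → E} (hP : ∀ z, ‖P z‖ = 1) {R : T.Idx → E} (hR : ∀ z, R z = P z - Q (T.node z))
    (hR0 : R (.inl 0) = 0) (hR1 : R (.inl (Fin.last T.M)) = 0)
    (hE : T.energy P P ≤ T.energy (fun z => Q (T.node z)) (fun z => Q (T.node z))) :
    c * T.energy R R ≤ (C * (b - a) * ((b - a) / 2 * √(T.energy R R) + √T.h
        + √(b - a) * κ * T.h) ^ 2 + 4 * κ ^ 2 * (b - a) * √(b - a) * √T.h) * T.energy R R
      + (4 * κ ^ 4 * (b - a) * √(b - a) + 2 * κ ^ 3 * √(b - a)) * T.h ^ 2 * √(T.energy R R) := by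
  set W := T.energy R R
  have hW : √W ^ 2 = W := Real.sq_sqrt (T.energy_self_nonneg R)
  set P₀ : T.Idx → E := fun z => Q (T.node z)
  have hPR : P = P₀ + R := funext fun z => by simp [P₀, hR]
  -- Expanding the energy of `P₀ + R` shows that a competitor of no larger energy must have a
  -- negative cross term if `W > 0`. The remaining steps bound that term below by `-(κ²/2) ∫ |R|²`,
  -- up to small errors, and insert the coercivity inequality.
  have s1 : W + 2 * T.energy P₀ R ≤ 0 := by
    have : T.energy P P = T.energy P₀ P₀ + 2 * T.energy P₀ R + W := by
      rw [hPR]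
      simp only [← energyForm_apply, map_add, LinearMap.add_apply, W]
      rw [T.energyForm_apply R P₀, T.energy_comm R P₀, ← T.energyForm_apply]
      ring
    linarith
  have s2 := T.energy_interp_ge hab hQ hR0 hR1
  have s3 := (abs_le.1 (T.abs_integral_inner_sub_simpson_le hab hQ hR0)).1
  have s4 : T.simpson (fun z => ⟪R z, Q (T.node z)⟫) = -(1 / 2) * T.simpson fun z => ‖R z‖ ^ 2 := by
    have h := T.simpsonForm.map_smul (-(1 / 2)) fun z => ‖R z‖ ^ 2
    refine Eq.trans ?_ h
    show _ = T.simpson _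
    congr 1
    funext z
    simp only [Pi.smul_apply, smul_eq_mul, hR]
    exact T.inner_node_sub hQ hP z
  have s5 := T.simpson_norm_sq_le hab hR0
  have s6 := hG _ (T.piecewiseC1_interp hab R) (by rw [T.interp_left hab, hR0])
    (by rw [T.interp_right hab, hR1])
  rw [T.energy_self_eq hab] at s6
  have s7 : ∫ y in a..b, ⟪T.interp R y, Q y⟫ ^ 2 ≤ (b - a) * (((b - a) / 2 * √W + √T.h
      + √(b - a) * κ * T.h) ^ 2 * W) := by
    have hc : Continuous fun y => ⟪T.interp R y, Q y⟫ ^ 2 :=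
      ((T.continuous_interp R).inner hQ.continuous).pow 2
    have := intervalIntegral.integral_mono_on hab.le (hc.intervalIntegrable a b)
      (intervalIntegrable_const (μ := volume) (c := ((b - a) / 2 * √W + √T.h + √(b - a) * κ * T.h) ^ 2 * W))
      fun y hy => by
        have h := pow_le_pow_left₀ (abs_nonneg _) (T.abs_inner_interp_le hab hQ hP hR hR0 hy) 2
        rwa [sq_abs, mul_pow, hW] at h
    rwa [intervalIntegral.integral_const, smul_eq_mul] at this
  have s8 := mul_le_mul_of_nonneg_left s7 hC
  rw [s4] at s3
  have s9 := mul_le_mul_of_nonneg_left s3 (sq_nonneg κ)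
  have s10 := mul_le_mul_of_nonneg_left s5 (sq_nonneg κ)
  linarith

/-- A priori bound for discrete curves near the interpolant of `Q` whose energy is not larger. -/
theorem _root_.InextensibleCurve.exists_apriori_bound (hab : a < b) (hQ : IsGreatCircle κ Q Q')
    {c C : ℝ} (hc : 0 < c) (hC : 0 ≤ C)
    (hG : ∀ e : ℝ → E, PiecewiseC1 a b e → e a = 0 → e b = 0 →
      c * (∫ x in a..b, ‖deriv e x‖ ^ 2) ≤ (∫ x in a..b, ‖deriv e x‖ ^ 2)
        - κ ^ 2 * (∫ x in a..b, ‖e x‖ ^ 2) + C * ∫ x in a..b, ⟪e x, Q x⟫ ^ 2) :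
    ∃ ρ h₀ K : ℝ, 0 < ρ ∧ 0 < h₀ ∧ 0 ≤ K ∧ ∀ T : Mesh a b, T.h ≤ h₀ → K * T.h ^ 4 < ρ ∧
      ∀ P : T.Idx → E, (∀ z, ‖P z‖ = 1) → (∀ z ∈ T.bdry, P z = Q (T.node z)) →
        T.energy (P - fun z => Q (T.node z)) (P - fun z => Q (T.node z)) ≤ ρ →
        T.energy P P ≤ T.energy (fun z => Q (T.node z)) (fun z => Q (T.node z)) →
        T.energy (P - fun z => Q (T.node z)) (P - fun z => Q (T.node z)) ≤ K * T.h ^ 4 := by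
  have hκ := hQ.nonneg
  have hL : 0 < b - a := sub_pos.2 hab
  -- `f s` bounds the coefficient of `W` in `energy_error_le` once `√W ≤ s` and `h ≤ s`. As `f 0 =
  -- 0`, a small `s` makes it less than `c / 2`, and the term is absorbed.
  let f : ℝ → ℝ := fun s => C * (b - a) * ((b - a) / 2 * s + √s + √(b - a) * κ * s) ^ 2
    + 4 * κ ^ 2 * (b - a) * √(b - a) * √s
  have hf : Continuous f := by fun_prop
  have hf0 : f 0 = 0 := by simp [f]
  obtain ⟨δ, hδ, hfδ⟩ := Metric.eventually_nhds_iff.1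
    (hf.continuousAt.eventually_lt (continuousAt_const (y := c / 2)) (by rw [hf0]; positivity) :
      ∀ᶠ s in nhds (0 : ℝ), f s < c / 2)
  set s := δ / 2
  have hs : 0 < s := by positivity
  have hfs : f s < c / 2 := hfδ (by
    rw [dist_zero_right, Real.norm_of_nonneg hs.le]; exact half_lt_self hδ)
  set K₁ := 4 * κ ^ 4 * (b - a) * √(b - a) + 2 * κ ^ 3 * √(b - a)
  have hK₁ : 0 ≤ K₁ := by positivity
  set K := 2 * K₁ / c
  have hK : 0 ≤ K := by positivity
  -- The radius `ρ = s²` encodes `√W ≤ s`. The last two bounds on the mesh size give `K h² < s`, so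
  -- the resulting estimate `W ≤ K² h⁴` is strictly stronger than `W ≤ ρ`.
  refine ⟨s ^ 2, min s (min 1 (s / (2 * (K + 1)))), K ^ 2, by positivity,
    lt_min hs (lt_min one_pos (by positivity)), sq_nonneg _, fun T hT => ⟨?_, ?_⟩⟩
  · have h0 := (T.h_pos hab).le
    have h1 : T.h ≤ 1 := hT.trans ((min_le_right _ _).trans (min_le_left _ _))
    have h2 : T.h ≤ s / (2 * (K + 1)) := hT.trans ((min_le_right _ _).trans (min_le_right _ _))
    have h3 : K * T.h ^ 2 < s := by
      have e1 : K * T.h ^ 2 ≤ K * T.h := mul_le_mul_of_nonneg_left (by nlinarith) hK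
      have e2 : (K + 1) * T.h ≤ s / 2 := by
        rw [le_div_iff₀ (by positivity)] at h2
        linarith
      linarith
    have := pow_lt_pow_left₀ h3 (by positivity) two_ne_zero
    linarith [show (K * T.h ^ 2) ^ 2 = K ^ 2 * T.h ^ 4 by ring]
  · intro P hP hbd hρ hE
    have hTs : T.h ≤ s := hT.trans (min_le_left _ _)
    have h0 := (T.h_pos hab).le
    set R : T.Idx → E := P - fun z => Q (T.node z)
    have hR : ∀ z, R z = P z - Q (T.node z) := fun z => rfl
    have key := T.energy_error_le hab hQ hC hG hP hR
      (by rw [hR, hbd _ (Or.inl rfl), sub_self]) (by rw [hR, hbd _ (Or.inr rfl), sub_self]) hE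
    set W := T.energy R R
    have hW0 : 0 ≤ W := T.energy_self_nonneg R
    set w := √W
    have hw0 : 0 ≤ w := Real.sqrt_nonneg _
    have hw : w ^ 2 = W := Real.sq_sqrt hW0
    have hws : w ≤ s := Real.sqrt_le_iff.2 ⟨hs.le, hρ⟩
    have hmono : C * (b - a) * ((b - a) / 2 * w + √T.h + √(b - a) * κ * T.h) ^ 2
        + 4 * κ ^ 2 * (b - a) * √(b - a) * √T.h ≤ f s := by
      simp only [f]
      gcongr
    have h1 : c * W ≤ c / 2 * W + K₁ * T.h ^ 2 * w := by
      refine key.trans (add_le_add_left (mul_le_mul_of_nonneg_right (hmono.trans hfs.le) hW0) _)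
    have h2 : w * (c / 2 * w) ≤ w * (K₁ * T.h ^ 2) := by rw [← hw] at h1; linarith
    have h3 : w ≤ K * T.h ^ 2 := by
      rcases hw0.eq_or_lt with h | h
      · rw [← h]; positivity
      · have := le_of_mul_le_mul_left h2 h
        have e : K * T.h ^ 2 = (K₁ * T.h ^ 2) / (c / 2) := by simp only [K]; field_simp
        rw [e, le_div_iff₀ (by positivity)]
        linarith
    calc W = w ^ 2 := hw.symm
      _ ≤ (K * T.h ^ 2) ^ 2 := pow_le_pow_left₀ hw0 h3 2
      _ = _ := by ring

end Mesh

/-! ### From the tangent error back to the `H²` norm, and the discrete solution. -/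

section NormEstimate

variable {E : Type*} [NormedAddCommGroup E] [InnerProductSpace ℝ E] [CompleteSpace E] {a b : ℝ}

theorem D_sub_eqOn (hab : a < b) {u v : ℝ → E} (hu : MemH a b 2 u) (hv : MemH a b 2 v) :
    EqOn (D a b (u - v)) (D a b u - D a b v) (Icc a b) :=
  D_eqOn hab ((MemH.hasWeakDeriv_D (m := 1) hu).sub hab.le (MemH.hasWeakDeriv_D (m := 1) hv))
    ((hu.continuousOn_D hab).sub (hv.continuousOn_D hab))

theorem integral_norm_sq_le_of_forall_le (hab : a ≤ b) {f : ℝ → E} (hf : ContinuousOn f (Icc a b))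
    {K : ℝ} (hK : ∀ x ∈ Icc a b, ‖f x‖ ≤ K) : ∫ x in a..b, ‖f x‖ ^ 2 ≤ (b - a) * K ^ 2 := by
  have h := intervalIntegral.integral_mono_on hab
    ((memL2_of_continuousOn hf).integrable_norm_sq hab)
    (intervalIntegrable_const (μ := volume) (c := K ^ 2))
    fun x hx => pow_le_pow_left₀ (norm_nonneg _) (hK x hx) 2
  rwa [intervalIntegral.integral_const, smul_eq_mul] at h

/-- The `H²`-norm of a function vanishing at `a` together with its derivative is controlled by the
second derivative. -/
theorem normH_primitive_le (hab : a < b) {v p : ℝ → E} (hp : PiecewiseC1 a b p)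
    (hv : ∀ x ∈ Icc a b, v x = v a + ∫ y in a..x, p y) (hva : v a = 0) (hpa : p a = 0) {W : ℝ}
    (hW : ∫ x in a..b, ‖deriv p x‖ ^ 2 ≤ W) :
    normH a b 2 v ≤ √(((b - a) ^ 4 + (b - a) ^ 2 + 1) * W) := by
  have hL : 0 ≤ b - a := sub_nonneg.2 hab.le
  have hW0 : 0 ≤ W := (intervalIntegral.integral_nonneg hab.le fun x _ => sq_nonneg _).trans hW
  obtain ⟨h1, h2, h3⟩ := primitive_spec hab hp.1 (hp.hasWeakDeriv hab) hv
  have hpb : ∀ x ∈ Icc a b, ‖p x‖ ≤ √(b - a) * √W := fun x hx => by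
    have := hp.norm_sub_le le_rfl hx.1 hx.2
    rw [hpa, sub_zero] at this
    exact this.trans (mul_le_mul (Real.sqrt_le_sqrt (by linarith [hx.2])) (Real.sqrt_le_sqrt hW)
      (Real.sqrt_nonneg _) (Real.sqrt_nonneg _))
  have hvb : ∀ x ∈ Icc a b, ‖v x‖ ≤ (b - a) * (√(b - a) * √W) := fun x hx => by
    rw [hv x hx, hva, zero_add]
    refine (intervalIntegral.norm_integral_le_of_norm_le_const (C := √(b - a) * √W)
      fun y hy => ?_).trans ?_
    · rw [uIoc_of_le hx.1] at hy
      exact hpb y ⟨hy.1.le, hy.2.trans hx.2⟩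
    · rw [abs_of_nonneg (by linarith [hx.1]), mul_comm]
      exact mul_le_mul_of_nonneg_right (by linarith [hx.2]) (by positivity)
  have e0 := integral_norm_sq_le_of_forall_le hab.le h1.2 hvb
  have e1 := integral_norm_sq_le_of_forall_le hab.le hp.1 hpb
  have e1' : ∫ x in a..b, ‖D a b v x‖ ^ 2 = ∫ x in a..b, ‖p x‖ ^ 2 :=
    integral_congr_ae_Ioo hab.le (ae_Ioo_of_eqOn fun x hx => by simp only [h2 hx])
  have e2 : ∫ x in a..b, ‖D a b (D a b v) x‖ ^ 2 = ∫ x in a..b, ‖deriv p x‖ ^ 2 :=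
    integral_congr_ae_Ioo hab.le (h3.mono fun x hx => by simp only [hx])
  rw [normH]
  refine Real.sqrt_le_sqrt ?_
  simp only [Finset.sum_range_succ, Finset.sum_range_zero, Function.iterate_succ,
    Function.iterate_zero, Function.comp, id, zero_add, e1', e2]
  have q : (√(b - a) * √W) ^ 2 = (b - a) * W := by
    rw [mul_pow, Real.sq_sqrt hL, Real.sq_sqrt hW0]
  rw [mul_pow, q] at e0
  rw [q] at e1
  linarith

end NormEstimate

namespace Mesh

variable {a b : ℝ} (T : Mesh a b)

/-- The Dirichlet integral of the error in terms of the nodal error. -/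
theorem integral_norm_sq_deriv_error_le {E : Type*} [NormedAddCommGroup E] [InnerProductSpace ℝ E]
    [CompleteSpace E] (hab : a < b) {κ : ℝ} {Q Q' : ℝ → E} (hQ : IsGreatCircle κ Q Q')
    (P : T.Idx → E) :
    ∫ x in a..b, ‖deriv (fun x => Q x - T.interp P x) x‖ ^ 2
      ≤ 2 * T.energy (P - fun z => Q (T.node z)) (P - fun z => Q (T.node z))
        + 2 * (b - a) * (κ ^ 3 * T.h ^ 2) ^ 2 := by
  set P₀ : T.Idx → E := fun z => Q (T.node z)
  have hP := T.piecewiseC1_interp hab P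
  have hP₀ := T.piecewiseC1_interp hab P₀
  have hr := (hQ.piecewiseC1 (a := a) (b := b)).sub hP
  have hR := T.piecewiseC1_interp hab (P - P₀)
  rw [← T.energy_self_eq hab]
  have iR := hR.memL2_deriv.integrable_norm_sq hab.le
  have h := intervalIntegral.integral_mono_ae_restrict hab.le
    (hr.memL2_deriv.integrable_norm_sq hab.le)
    ((iR.const_mul 2).add
      (intervalIntegrable_const (μ := volume) (c := 2 * (κ ^ 3 * T.h ^ 2) ^ 2))) (by
      rw [← Measure.restrict_congr_set Ioo_ae_eq_Icc]
      filter_upwards [hP.ae_differentiableAt, hP₀.ae_differentiableAt,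
        T.ae_norm_deriv_interp_sub_le hab hQ] with x h1 h2 h3
      have d1 : deriv (fun x => Q x - T.interp P x) x = Q' x - deriv (T.interp P) x :=
        ((hQ.hasDerivAt x).sub h1.hasDerivAt).deriv
      have d2 : deriv (T.interp (P - P₀)) x = deriv (T.interp P) x - deriv (T.interp P₀) x := by
        rw [show T.interp (P - P₀) = fun y => T.interp P y - T.interp P₀ y from
          funext fun y => T.interp_sub P P₀ y]
        exact (h1.hasDerivAt.sub h2.hasDerivAt).deriv
      have d3 : ‖Q' x - deriv (T.interp P) x‖
          ≤ ‖deriv (T.interp (P - P₀)) x‖ + κ ^ 3 * T.h ^ 2 := by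
        rw [d2]
        have : Q' x - deriv (T.interp P) x = -(deriv (T.interp P) x - deriv (T.interp P₀) x)
            - (deriv (T.interp P₀) x - Q' x) := by abel
        rw [this]
        refine (norm_sub_le _ _).trans (add_le_add (norm_neg _).le h3)
      rw [d1]
      have d4 := pow_le_pow_left₀ (norm_nonneg _) d3 2
      nlinarith [sq_nonneg (‖deriv (T.interp (P - P₀)) x‖ - κ ^ 3 * T.h ^ 2)])
  rw [intervalIntegral.integral_add (iR.const_mul 2) intervalIntegrable_const,
    intervalIntegral.integral_const_mul, intervalIntegral.integral_const, smul_eq_mul] at h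
  linarith

/-- A constrained critical point of the discrete Dirichlet energy yields a discrete stationary
pair. -/
theorem exists_discrete_solution {d : ℕ} (hab : a < b) {uD : ℝ → Vec d}
    {P : T.Idx → Vec d} (hP : ∀ z, ‖P z‖ = 1) (hPa : P (.inl 0) = D a b uD a)
    (hPb : P (.inl (Fin.last T.M)) = D a b uD b)
    (hcrit : ∀ z ∉ T.bdry, ∀ w, ⟪P z, w⟫ = 0 → T.energy P (Pi.single z w) = 0) {uh : ℝ → Vec d}
    (huh : ∀ x ∈ Icc a b, uh x = uD a + ∫ y in a..x, T.interp P y) :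
    uh - T.I3 uD ∈ T.S31D ∧ ∃ lamh ∈ T.S200 hab,
      ∀ vh ∈ T.S31D, ∀ μh ∈ T.S200 hab, T.Fh uh lamh vh μh = 0 := by
  have ha := left_mem_Icc.2 hab.le
  have hb := right_mem_Icc.2 hab.le
  have huha : uh a = uD a := by rw [huh a ha]; simp
  have huh' : ∀ x ∈ Icc a b, uh x = uh a + ∫ y in a..x, T.interp P y := by rwa [huha]
  have hS := T.primitive_mem_S P huh'
  have hc := (T.continuous_interp P).continuousOn (s := Icc a b)
  have hD : EqOn (D a b uh) (T.interp P) (Icc a b) :=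
    D_eqOn hab (hasWeakDeriv_of_eq_integral hab (memL2_of_continuousOn hc) huh') hc
  have hDz : ∀ z, D a b uh (T.node z) = P z := fun z => by
    rw [hD (T.node_mem z), T.interp_node hab]
  obtain ⟨hIS, hIz⟩ := T.I3_spec hab (v := uD)
  have hIa := hIz a ⟨0, T.left⟩
  have hIb := hIz b ⟨Fin.last _, T.right⟩
  have hsub := D_sub_eqOn hab (T.mem_S_spec hab hS).1.1 (T.mem_S_spec hab hIS).1.1
  refine ⟨⟨T.S_sub hS hIS, (T.mem_S_spec hab (T.S_sub hS hIS)).1, ?_, ?_, ?_⟩, ?_⟩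
  · rw [Pi.sub_apply, huha, hIa.1, sub_self]
  · rw [hsub ha, Pi.sub_apply, hD ha, T.interp_left hab, hIa.2, hPa, sub_self]
  · rw [hsub hb, Pi.sub_apply, hD hb, T.interp_right hab, hIb.2, hPb, sub_self]
  obtain ⟨m, hm0, hm⟩ := T.exists_multiplier hab T.bdry hP hcrit
  -- Quadrature sees only nodal values, so the piecewise quadratic with values `m` is the required
  -- multiplier; `m` vanishes at the end points, as `H^1_0` demands.
  refine ⟨T.interp m, ⟨T.interp_mem_S m, mem_H10_of_piecewiseC1 hab (T.piecewiseC1_interp hab m)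
    (by rw [T.interp_left hab, hm0 _ (Or.inl rfl)])
    (by rw [T.interp_right hab, hm0 _ (Or.inr rfl)])⟩, fun vh hvh μh _ => ?_⟩
  rw [T.Fh_eq hab _ _ hS hvh.1]
  have h0 : T.simpson (fun z => μh (T.node z) * (‖D a b uh (T.node z)‖ ^ 2 - 1)) = 0 := by
    rw [T.simpson_eq_sum]
    exact Finset.sum_eq_zero fun z _ => by rw [hDz, hP]; ring
  have h1 := hm (fun z => D a b vh (T.node z)) (by
    rintro z (rfl | rfl)
    · exact (congrArg _ T.left).trans hvh.2.2.2.1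
    · exact (congrArg _ T.right).trans hvh.2.2.2.2)
  rw [h0, mul_zero, add_zero]
  simp only [hDz, T.interp_node hab]
  exact h1

end Mesh

end InextensibleCurve

end

/-! ### The theorem. -/

theorem theorem3 (d : ℕ) (a b : ℝ) (hab : a < b)
    -- boundary data with unit tangents at the end points
    (uD : ℝ → Vec d) (huD : uD ∈ InextensibleCurve.H a b 2)
    (huDa : ‖D a b uD a‖ = 1) (huDb : ‖D a b uD b‖ = 1)
    -- the regular stationary pair
    (u : ℝ → Vec d) (hu : u ∈ InextensibleCurve.H a b 4) (huA : u - uD ∈ H2D a b)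
    (lam : ℝ → ℝ) (hlam : lam ∈ InextensibleCurve.H a b 2)
    (hF : ∀ v ∈ H2D a b, ∀ μ : HMinusOne a b hab, F u (ofL2 hab lam hlam.1.memL2) v μ = 0)
    (hcoer : CoerciveOnKer u (ofL2 hab lam hlam.1.memL2)) :
    ∀ σ : ℝ, 0 < σ → ∃ h₀ : ℝ, 0 < h₀ ∧ ∃ c : ℝ, 0 < c ∧
      ∀ T : Mesh a b, T.QuasiUniform σ → T.h ≤ h₀ →
        ∃ (uh : ℝ → Vec d) (lamh : ℝ → ℝ),
          uh - T.I3 uD ∈ T.S31D ∧ lamh ∈ T.S200 hab ∧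
          (∀ vh ∈ T.S31D, ∀ μh ∈ T.S200 hab, T.Fh uh lamh vh μh = 0) ∧
          normH a b 2 (u - uh) ≤ c * T.h ^ 2 := by
  intro σ _
  have ha := left_mem_Icc.2 hab.le
  have hb := right_mem_Icc.2 hab.le
  have hu2 : MemH a b 2 u := by
    obtain ⟨⟨g, h1, g1, h2, -⟩, -⟩ := hu
    exact ⟨g, h1, g1, h2, h2.2.1⟩
  have hsub := D_sub_eqOn hab hu2 huD.1
  have hua : D a b u a = D a b uD a := sub_eq_zero.1 ((hsub ha).symm.trans huA.2.2.1)
  have hub : D a b u b = D a b uD b := sub_eq_zero.1 ((hsub hb).symm.trans huA.2.2.2)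
  obtain ⟨κ, Q, Q', hQ, huQ, hl⟩ := exists_isGreatCircle_of_stationary hab hu hlam
    (by rw [hua, huDa]) (by rw [hub, huDb]) hF
  obtain ⟨c, C, hc, hC, hG⟩ := exists_garding hab _ hQ huQ hl hcoer
  obtain ⟨ρ, h₀, K, hρ, hh₀, hK, hT⟩ := exists_apriori_bound hab hQ hc hC hG
  have hL : 0 < b - a := sub_pos.2 hab
  have hκ := hQ.nonneg
  set A := ((b - a) ^ 4 + (b - a) ^ 2 + 1) * (2 * K + 2 * (b - a) * κ ^ 6)
  -- `A` combines the nodal error, the interpolation error of `Q` and the Poincaré constants. It may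
  -- vanish, for instance when `K = κ = 0`; the summand `1` keeps the constant positive.
  refine ⟨h₀, hh₀, √A + 1, by positivity, fun T _ hTh => ?_⟩
  obtain ⟨hlt, hap⟩ := hT T hTh
  obtain ⟨P, hP1, hP2, hP3, hP4⟩ := exists_constrained_critical T.energyForm T.energy_comm
    T.continuous_energy T.bdry (P₀ := fun z => Q (T.node z)) (fun z => hQ.norm_eq _) hρ.le hlt hap
  have hPa : P (.inl 0) = Q a := (hP2 _ (Or.inl rfl)).trans (congrArg Q T.left)
  have hPb : P (.inl (Fin.last T.M)) = Q b := (hP2 _ (Or.inr rfl)).trans (congrArg Q T.right)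
  set uh : ℝ → Vec d := fun x => uD a + ∫ y in a..x, T.interp P y with huh
  obtain ⟨r1, lamh, r2, r3⟩ := T.exists_discrete_solution hab hP1
    (by rw [hPa, ← huQ ha, hua]) (by rw [hPb, ← huQ hb, hub]) hP4 (uh := uh) fun x _ => rfl
  refine ⟨uh, lamh, r1, r2, r3, ?_⟩
  have hp := (hQ.piecewiseC1 (a := a) (b := b)).sub (T.piecewiseC1_interp hab P)
  have hua0 : u a - uD a = 0 := huA.2.1
  have huha : uh a = uD a := by simp [huh]
  -- The error is the primitive of the tangent error and vanishes at `a`, so `normH_primitive_le`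
  -- reduces the `H²` bound to the Dirichlet integral of `Q - T.interp P`.
  have hv : ∀ x ∈ Icc a b, (u - uh) x = (u - uh) a + ∫ y in a..x, (Q y - T.interp P y) := by
    intro x hx
    have i1 : IntervalIntegrable Q volume a x := hQ.continuous.intervalIntegrable _ _
    have i2 : IntervalIntegrable (T.interp P) volume a x :=
      (T.continuous_interp P).intervalIntegrable _ _
    have e1 := (MemH.hasWeakDeriv_D (m := 1) hu2).eq_integral hab hu.2 x hx
    have e2 : ∫ y in a..x, D a b u y = ∫ y in a..x, Q y :=
      intervalIntegral.integral_congr fun y hy => by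
        rw [uIcc_of_le hx.1] at hy
        exact huQ ⟨hy.1, hy.2.trans hx.2⟩
    rw [intervalIntegral.integral_sub i1 i2, Pi.sub_apply, Pi.sub_apply, e1, e2, huha]
    simp only [huh]
    abel
  refine (normH_primitive_le hab hp hv (by rw [Pi.sub_apply, huha, hua0])
    (by rw [T.interp_left hab, hPa, sub_self])
    (W := (2 * K + 2 * (b - a) * κ ^ 6) * T.h ^ 4) ?_).trans ?_
  · refine (T.integral_norm_sq_deriv_error_le hab hQ P).trans ?_
    have : T.energy (P - fun z => Q (T.node z)) (P - fun z => Q (T.node z)) ≤ K * T.h ^ 4 := hP3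
    linarith [show (κ ^ 3 * T.h ^ 2) ^ 2 = κ ^ 6 * T.h ^ 4 by ring]
  · rw [← mul_assoc, show T.h ^ 4 = (T.h ^ 2) ^ 2 by ring, Real.sqrt_mul (by positivity),
      Real.sqrt_sq (sq_nonneg _)]
    exact mul_le_mul_of_nonneg_right (by simp [A]) (sq_nonneg _)
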